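/- Let $K$ be a field of characteristic $0$, $\Gamma$ a finite abelian group, $H=K[\Gamma]$. Let $V=Kx_1\oplus Kx_2$ be a quantum plane: $g_1,g_2\in\Gamma$, characters $\chi_1,\chi_2$ of $\Gamma$ with $\chi_1(g_2)\chi_2(g_1)=1$, $\chi_i(g_i)$ a primitive $r_i$-th root of unity with $r_i\ge 2$, and $x_i$ of degree $g_i$ and weight $\chi_i$ (so $h\cdot x_i=\chi_i(h)x_i$, $\rho(x_i)=g_i\otimes x_i$). Let $R=\mathcal B(V)$ be its Nichols algebra, with basis $x_1^ix_2^j$ ($0\le i<r_1$, $0\le j<r_2$), and $A=R\#H$ the Radford biproduct. Let $a_1,a_2,a\in K$ be such that $a_i\ne0$ implies $g_i^{r_i}\neq1$ and $\chi_i^{r_i}=\varepsilon$, and $a\neq0$ implies $g_1g_2\ne1$ and $\chi_1\chi_2=\varepsilon$ (in which case $r_1=r_2=:r$). Let $B=A(a_1,a_2,a)$ be the corresponding lifting of $A$: the algebra generated by $\Gamma$, $x_1,x_2$ with the relations of $\Gamma$ and $$hx_i=\chi_i(h)x_ih,\quad x_i^{r_i}=a_i(1-g_i^{r_i}),\quad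 x_2x_1=\chi_1(g_2)x_1x_2+a(1-g_1g_2),$$ with $h\in\Gamma$ grouplike and $\Delta(x_i)=x_i\otimes1+g_i\otimes x_i$. Define $H$-bilinear forms $\gamma_1,\gamma_2,\gamma_a:A\otimes A\to K$ (i.e. $\gamma(hx\otimes yk)=\varepsilon(h)\varepsilon(k)\gamma(x\otimes y)$ for $h,k\in H$) by requiring that they equal $\varepsilon\otimes\varepsilon$ on pairs of basis monomials of $R$, except that $\gamma_i(x_i^m\otimes x_i^{r_i-m})=a_i$ for $0<m<r_i$, and $\gamma_a(x_2^m\otimes x_1^m)=(m)!_q\,a^m$ with $q=\chi_1(g_1)$. Let $\alpha=\gamma_a*\gamma_1*\gamma_2$ (convolution product), and let $\alpha_R$ be its restriction to $R\otimes R$. Then: (a) $\alpha$ is a convolution invertible normalized $H$-bilinear 2-cocycle on $A$, $\alpha_R$ is convolution invertible over the braided coalgebra $R\otimes R$, and the identification of the bases $x_1^ix_2^jh$ is an isomorphism of bialgebras from $A^\alpha$ (multiplication $\alpha*m_A*\alpha^{-1}$) onto $B$. (b) Under the same identification $B=R^{\alpha_R}\#_{\varepsilon_{\alpha_R}}H$,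 where $R^{\alpha_R}$ is $R$ with the multiplication $\alpha_R*m_R*\alpha_R^{-1}$ and $$\varepsilon_{\alpha_R}=u_H\alpha_R*\varepsilon_{R\otimes R}*(H\otimes\alpha_R^{-1})\rho_{R\otimes R}:R\otimes R\to H .$$ Here, for $\xi:R\otimes R\to H$, $R\#_\xi H$ denotes $R\otimes H$ with $(r\#h)(s\#k)=m_R(z^{(1)})\#\xi(z^{(2)})h_{(2)}k$, $z=r\otimes h_{(1)}\cdot s$, and $\Delta(r\#h)=r^{(1)}\#r^{(2)}_{(-1)}h_{(1)}\otimes r^{(2)}_{(0)}\#h_{(2)}$. (c) Suppose that one of the following conditions holds: (i) $\alpha=\gamma_1$ or $\alpha=\gamma_2$; (ii) $\alpha=\gamma_1*\gamma_2$ and $g_1^{r_1}g_2^{r_2}\neq1$; (iii) $a\ne0$, $r$ is odd or $r=2$, and $(g_1g_2)^r\neq1$; (iv) $a\neq0$, $r=2r'>2$, $(g_1g_2)^{tr'}\ne1$ for $t=1,2,3$, $(g_1g_2)^{r'}g_2^r\neq1$ and $g_1^r(g_1g_2)^{r'}\ne1$. Then for the total integral $\lambda:H\to K$, $\lambda(g)=\delta_{g,1}$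 for $g\in\Gamma$, $$\lambda\circ\varepsilon_{\alpha_R}=\alpha_R .$$ -/

import Mathlib

open scoped TensorProduct

noncomputable section

namespace QPlane

/-! ### Gaussian numbers -/

section Gauss

variable {K : Type*} [Field K]

/-- `(n)_q = 1 + q + ⋯ + q ^ (n - 1)`. -/
def qNat (q : K) (n : ℕ) : K := ∑ i ∈ Finset.range n, q ^ i

/-- `(n)!_q = (1)_q (2)_q ⋯ (n)_q`. -/
def qFact (q : K) (n : ℕ) : K := ∏ i ∈ Finset.range n, qNat q (i + 1)

/-- The Gaussian binomial coefficient, through the Pascal rule (so that it makes sense also when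
`q` is a root of unity). -/
def qBinom (q : K) : ℕ → ℕ → K
  | _, 0 => 1
  | 0, _ + 1 => 0
  | n + 1, k + 1 => qBinom q n k + q ^ (k + 1) * qBinom q n (k + 1)

lemma qBinom_zero_right (q : K) (n : ℕ) : qBinom q n 0 = 1 := by cases n <;> simp [qBinom]

lemma qBinom_eq_zero (q : K) {n k : ℕ} (h : n < k) : qBinom q n k = 0 := by
  induction n generalizing k with
  | zero => obtain ⟨k, rfl⟩ : ∃ m, k = m + 1 := ⟨k - 1, by omega⟩; simp [qBinom]
  | succ n ih =>
    obtain ⟨k, rfl⟩ : ∃ m, k = m + 1 := ⟨k - 1, by omega⟩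
    simp [qBinom, ih (show n < k by omega), ih (show n < k + 1 by omega)]

lemma qBinom_self (q : K) (n : ℕ) : qBinom q n n = 1 := by
  induction n with
  | zero => simp [qBinom]
  | succ n ih => simp [qBinom, ih, qBinom_eq_zero q (Nat.lt_succ_self n)]

lemma qFact_succ (q : K) (n : ℕ) : qFact q (n + 1) = qFact q n * qNat q (n + 1) := by
  simp [qFact, Finset.prod_range_succ]

lemma qNat_add (q : K) (m n : ℕ) : qNat q (m + n) = qNat q m + q ^ m * qNat q n := by
  simp [qNat, Finset.sum_range_add, pow_add, Finset.mul_sum]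

lemma qBinom_mul_qFact (q : K) (m k : ℕ) :
    qBinom q (m + k) k * (qFact q k * qFact q m) = qFact q (m + k) := by
  induction k generalizing m with
  | zero => simp [qBinom_zero_right, qFact]
  | succ k ihk =>
    induction m with
    | zero => simp [qBinom_self, qFact]
    | succ m ihm =>
      have e : m + 1 + (k + 1) = (m + k + 1) + 1 := by omega
      have h1 := ihk (m + 1)
      have h2 := ihm
      rw [show m + 1 + k = m + k + 1 by omega] at h1
      rw [show m + (k + 1) = m + k + 1 by omega] at h2
      rw [e, qBinom, qFact_succ q (m + k + 1), show m + k + 1 + 1 = (k + 1) + (m + 1) by omega,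
        qNat_add q (k + 1) (m + 1), qFact_succ q k, qFact_succ q m]
      rw [qFact_succ q m] at h1
      rw [qFact_succ q k] at h2
      linear_combination qNat q (k + 1) * h1 + q ^ (k + 1) * qNat q (m + 1) * h2

lemma qBinom_eq_zero_of_primitive {q : K} {r k : ℕ} (hq : IsPrimitiveRoot q r) (hk : 0 < k)
    (hkr : k < r) : qBinom q r k = 0 := by
  have hne : ∀ n, n < r → qFact q n ≠ 0 := by
    intro n hn
    refine Finset.prod_ne_zero_iff.2 fun i hi h0 => ?_
    have hi' := Finset.mem_range.1 hi
    have h1 : q ^ (i + 1) = 1 := by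
      have := mul_neg_geom_sum q (i + 1)
      rw [show ∑ j ∈ Finset.range (i + 1), q ^ j = 0 from h0, mul_zero] at this
      exact (sub_eq_zero.1 this.symm).symm
    have := Nat.le_of_dvd (by omega) (hq.dvd_of_pow_eq_one _ h1)
    omega
  have h0 : qFact q r = 0 := by
    refine Finset.prod_eq_zero (i := r - 1) (Finset.mem_range.2 (by omega)) ?_
    rw [show r - 1 + 1 = r by omega]
    exact hq.geom_sum_eq_zero (by omega)
  have h := qBinom_mul_qFact q (r - k) k
  rw [show r - k + k = r by omega, h0] at h
  exact (mul_eq_zero.1 h).resolve_right (mul_ne_zero (hne _ hkr) (hne _ (by omega)))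

lemma pow_add_of_skew {A : Type*} [Ring A] [Algebra K A] {q : K} {x y : A}
    (h : y * x = q • (x * y)) (n : ℕ) :
    (x + y) ^ n = ∑ k ∈ Finset.range (n + 1), qBinom q n k • (x ^ k * y ^ (n - k)) := by
  have hyx : ∀ k, y * x ^ k = q ^ k • (x ^ k * y) := by
    intro k
    induction k with
    | zero => simp
    | succ k ih =>
      rw [pow_succ, ← mul_assoc, ih, smul_mul_assoc, mul_assoc, h, mul_smul_comm, smul_smul,
        ← pow_succ, mul_assoc]
  induction n with
  | zero => simp [qBinom]
  | succ n ih =>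
    rw [pow_succ', ih, add_mul, Finset.mul_sum, Finset.mul_sum, Finset.sum_range_succ' _ (n + 1)]
    have e1 : ∀ k ∈ Finset.range (n + 1), qBinom q (n + 1) (k + 1) •
        (x ^ (k + 1) * y ^ (n + 1 - (k + 1))) =
        x * (qBinom q n k • (x ^ k * y ^ (n - k))) +
        (q ^ (k + 1) * qBinom q n (k + 1)) • (x ^ (k + 1) * y ^ (n - k)) := by
      intro k _
      rw [qBinom, add_smul, show n + 1 - (k + 1) = n - k by omega, mul_smul_comm, ← mul_assoc,
        ← pow_succ']
    rw [Finset.sum_congr rfl e1, Finset.sum_add_distrib, add_assoc]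
    congr 1
    rw [Finset.sum_range_succ' _ n, Finset.sum_range_succ _ n,
      qBinom_eq_zero q (Nat.lt_succ_self n), mul_zero, zero_smul, add_zero]
    congr 1
    · refine Finset.sum_congr rfl fun k hk => ?_
      have := Finset.mem_range.1 hk
      rw [mul_smul_comm, ← mul_assoc, hyx, smul_mul_assoc, smul_smul, mul_assoc, ← pow_succ',
        show n - (k + 1) + 1 = n - k by omega, mul_comm (qBinom q n (k + 1))]
    · simp [qBinom_zero_right, pow_succ']

lemma pow_add_of_primitive {A : Type*} [Ring A] [Algebra K A] {q : K} {x y : A} {r : ℕ}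
    (hr : 2 ≤ r) (hq : IsPrimitiveRoot q r) (h : y * x = q • (x * y)) :
    (x + y) ^ r = x ^ r + y ^ r := by
  obtain ⟨m, rfl⟩ : ∃ m, r = m + 1 := ⟨r - 1, by omega⟩
  rw [pow_add_of_skew h, Finset.sum_range_succ, Finset.sum_range_succ']
  rw [Finset.sum_eq_zero]
  · simp [qBinom_zero_right, qBinom_self, add_comm]
  · intro k hk
    have := Finset.mem_range.1 hk
    rw [qBinom_eq_zero_of_primitive hq (by omega) (by omega), zero_smul]

end Gauss

/-! ### Convolution, bialgebra data, cocycles and cocycle twists -/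

section Conv

variable {K : Type*} [Field K] {C L M N : Type*} [AddCommMonoid C] [Module K C]
  [AddCommMonoid L] [Module K L] [AddCommMonoid M] [Module K M] [AddCommMonoid N] [Module K N]

/-- The convolution `c ↦ f (c₍₁₎) g (c₍₂₎)`, with respect to a comultiplication `Δ` on `C` and a
pairing `μ` of the targets. -/
def conv (Δ : C →ₗ[K] C ⊗[K] C) (μ : L ⊗[K] M →ₗ[K] N) (f : C →ₗ[K] L) (g : C →ₗ[K] M) :
    C →ₗ[K] N :=
  μ ∘ₗ TensorProduct.map f g ∘ₗ Δ

/-- Convolution of two linear forms. -/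
def convForm (Δ : C →ₗ[K] C ⊗[K] C) (f g : C →ₗ[K] K) : C →ₗ[K] K :=
  conv Δ (LinearMap.mul' K K) f g

/-- `f * m * f'` for linear forms `f`, `f'` and a map `m` into a module. -/
def convTwist (Δ : C →ₗ[K] C ⊗[K] C) (f f' : C →ₗ[K] K) (m : C →ₗ[K] M) : C →ₗ[K] M :=
  conv Δ (TensorProduct.lid K M).toLinearMap f
    (conv Δ (TensorProduct.rid K M).toLinearMap m f')

/-- `f'` is the two-sided convolution inverse of the linear form `f`. -/
def IsConvInv (Δ : C →ₗ[K] C ⊗[K] C) (ε f f' : C →ₗ[K] K) : Prop :=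
  convForm Δ f f' = ε ∧ convForm Δ f' f = ε

end Conv

/-- The four structure maps of a bialgebra on a vector space. -/
structure BialgData (K A : Type*) [Field K] [AddCommMonoid A] [Module K A] where
  mul : A ⊗[K] A →ₗ[K] A
  one : A
  comul : A →ₗ[K] A ⊗[K] A
  counit : A →ₗ[K] K

namespace BialgData

variable {K A : Type*} [Field K] [AddCommMonoid A] [Module K A]

/-- The comultiplication `x ⊗ y ↦ (x₍₁₎ ⊗ y₍₁₎) ⊗ (x₍₂₎ ⊗ y₍₂₎)` of `A ⊗ A`. -/
def comul₂ (S : BialgData K A) : A ⊗[K] A →ₗ[K] (A ⊗[K] A) ⊗[K] (A ⊗[K] A) :=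
  (TensorProduct.tensorTensorTensorComm K A A A A).toLinearMap ∘ₗ
    TensorProduct.map S.comul S.comul

/-- The counit of `A ⊗ A`. -/
def counit₂ (S : BialgData K A) : A ⊗[K] A →ₗ[K] K :=
  LinearMap.mul' K K ∘ₗ TensorProduct.map S.counit S.counit

/-- `γ` is a normalized 2-cocycle, convolution invertible with inverse `γ'`, that is bilinear over
the Hopf subalgebra embedded by `ι : H → A`. -/
structure IsBilinearCocycle (S : BialgData K A) {H : Type*} [Ring H] [Bialgebra K H]
    (ι : H →ₗ[K] A) (γ γ' : A ⊗[K] A →ₗ[K] K) : Prop where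
  inv : IsConvInv S.comul₂ S.counit₂ γ γ'
  /-- `γ(y₍₁₎ ⊗ z₍₁₎) γ(x ⊗ y₍₂₎z₍₂₎) = γ(x₍₁₎ ⊗ y₍₁₎) γ(x₍₂₎y₍₂₎ ⊗ z)`. -/
  cocycle : ∀ x y z : A,
    convForm S.comul₂ γ (γ ∘ₗ TensorProduct.mk K A A x ∘ₗ S.mul) (y ⊗ₜ z) =
      convForm S.comul₂ γ (γ ∘ₗ (TensorProduct.mk K A A).flip z ∘ₗ S.mul) (x ⊗ₜ y)
  unit_right : ∀ x : A, γ (x ⊗ₜ S.one) = S.counit x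
  unit_left : ∀ x : A, γ (S.one ⊗ₜ x) = S.counit x
  bilinear : ∀ (h k : H) (x y : A),
    γ (S.mul (ι h ⊗ₜ x) ⊗ₜ S.mul (y ⊗ₜ ι k)) =
      Coalgebra.counit (R := K) h * Coalgebra.counit (R := K) k * γ (x ⊗ₜ y)

/-- The cocycle twist `A^γ`: the multiplication becomes `γ * m * γ⁻¹`. -/
def twist (S : BialgData K A) (γ γ' : A ⊗[K] A →ₗ[K] K) : BialgData K A :=
  { S with mul := convTwist S.comul₂ γ γ' S.mul }

/-- `φ` identifies the bialgebra data `S` on `A` with the bialgebra `B`. -/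
structure IsIso (S : BialgData K A) {B : Type*} [Ring B] [Bialgebra K B] (φ : A ≃ₗ[K] B) :
    Prop where
  map_mul : ∀ x y : A, φ (S.mul (x ⊗ₜ y)) = φ x * φ y
  map_one : φ S.one = 1
  map_comul : ∀ x : A,
    TensorProduct.map φ.toLinearMap φ.toLinearMap (S.comul x) = Coalgebra.comul (R := K) (φ x)
  map_counit : ∀ x : A, Coalgebra.counit (R := K) (φ x) = S.counit x

end BialgData

/-! ### Braided data in the category of Yetter-Drinfeld modules over a group algebra -/

/-- The maps of a (pre-)bialgebra in the category of left Yetter-Drinfeld modules over `K[Γ]`. -/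
structure BraidedData (K Γ N : Type*) [Field K] [CommGroup Γ] [AddCommMonoid N] [Module K N] where
  mul : N ⊗[K] N →ₗ[K] N
  one : N
  comul : N →ₗ[K] N ⊗[K] N
  counit : N →ₗ[K] K
  act : MonoidAlgebra K Γ →ₐ[K] Module.End K N
  coact : N →ₗ[K] MonoidAlgebra K Γ ⊗[K] N

namespace BraidedData

variable {K Γ N : Type*} [Field K] [CommGroup Γ] [AddCommMonoid N] [Module K N]

/-- The action as a map `h ⊗ r ↦ h · r`. -/
def actT (R : BraidedData K Γ N) : MonoidAlgebra K Γ ⊗[K] N →ₗ[K] N :=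
  TensorProduct.lift R.act.toLinearMap

/-- The braiding `r ⊗ s ↦ r₍₋₁₎ · s ⊗ r₍₀₎`. -/
def braiding (R : BraidedData K Γ N) : N ⊗[K] N →ₗ[K] N ⊗[K] N :=
  TensorProduct.map R.actT LinearMap.id ∘ₗ
    (TensorProduct.rightComm K (MonoidAlgebra K Γ) N N).toLinearMap ∘ₗ
      TensorProduct.map R.coact LinearMap.id

/-- The comultiplication of the coalgebra `R ⊗ R` in the braided category,
`r ⊗ s ↦ (r⁽¹⁾ ⊗ r⁽²⁾₍₋₁₎ · s⁽¹⁾) ⊗ (r⁽²⁾₍₀₎ ⊗ s⁽²⁾)`. -/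
def comul₂ (R : BraidedData K Γ N) : N ⊗[K] N →ₗ[K] (N ⊗[K] N) ⊗[K] (N ⊗[K] N) :=
  (TensorProduct.assoc K N N (N ⊗[K] N)).symm.toLinearMap ∘ₗ
    TensorProduct.map LinearMap.id
      ((TensorProduct.assoc K N N N).toLinearMap ∘ₗ
        TensorProduct.map R.braiding LinearMap.id ∘ₗ
          (TensorProduct.assoc K N N N).symm.toLinearMap) ∘ₗ
      (TensorProduct.assoc K N N (N ⊗[K] N)).toLinearMap ∘ₗ
        TensorProduct.map R.comul R.comul

/-- The counit of `R ⊗ R`. -/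
def counit₂ (R : BraidedData K Γ N) : N ⊗[K] N →ₗ[K] K :=
  LinearMap.mul' K K ∘ₗ TensorProduct.map R.counit R.counit

/-- The diagonal coaction `r ⊗ s ↦ r₍₋₁₎s₍₋₁₎ ⊗ (r₍₀₎ ⊗ s₍₀₎)` on `R ⊗ R`. -/
def coact₂ (R : BraidedData K Γ N) : N ⊗[K] N →ₗ[K] MonoidAlgebra K Γ ⊗[K] (N ⊗[K] N) :=
  TensorProduct.map (LinearMap.mul' K (MonoidAlgebra K Γ)) LinearMap.id ∘ₗ
    (TensorProduct.tensorTensorTensorComm K (MonoidAlgebra K Γ) N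
      (MonoidAlgebra K Γ) N).toLinearMap ∘ₗ
      TensorProduct.map R.coact R.coact

/-- The trivial cocycle `ε_{R ⊗ R}`, with values in `H = K[Γ]`. -/
def trivialCocycle (R : BraidedData K Γ N) : N ⊗[K] N →ₗ[K] MonoidAlgebra K Γ :=
  Algebra.linearMap K (MonoidAlgebra K Γ) ∘ₗ R.counit₂

/-- The structure maps of `R #_ξ H` on `R ⊗ H`, for `ξ : R ⊗ R → H`:
`(r # h)(s # k) = m_R(z⁽¹⁾) # ξ(z⁽²⁾) h₍₂₎ k` where `z = r ⊗ h₍₁₎ · s ∈ R ⊗ R`, and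
`Δ(r # h) = (r⁽¹⁾ # r⁽²⁾₍₋₁₎ h₍₁₎) ⊗ (r⁽²⁾₍₀₎ # h₍₂₎)`. -/
def biproduct (R : BraidedData K Γ N) (ξ : N ⊗[K] N →ₗ[K] MonoidAlgebra K Γ) :
    BialgData K (N ⊗[K] MonoidAlgebra K Γ) where
  mul :=
    TensorProduct.map LinearMap.id (LinearMap.mul' K (MonoidAlgebra K Γ)) ∘ₗ
      (TensorProduct.assoc K N (MonoidAlgebra K Γ) (MonoidAlgebra K Γ)).toLinearMap ∘ₗ
        TensorProduct.map
          (TensorProduct.map R.mul ξ ∘ₗ R.comul₂ ∘ₗ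
            TensorProduct.map LinearMap.id R.actT ∘ₗ
              (TensorProduct.assoc K N (MonoidAlgebra K Γ) N).toLinearMap)
          (LinearMap.mul' K (MonoidAlgebra K Γ)) ∘ₗ
          (TensorProduct.tensorTensorTensorComm K (N ⊗[K] MonoidAlgebra K Γ)
            (MonoidAlgebra K Γ) N (MonoidAlgebra K Γ)).toLinearMap ∘ₗ
            TensorProduct.map
              ((TensorProduct.assoc K N (MonoidAlgebra K Γ)
                (MonoidAlgebra K Γ)).symm.toLinearMap ∘ₗ
                TensorProduct.map LinearMap.id Coalgebra.comul)
              LinearMap.id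
  one := R.one ⊗ₜ 1
  comul :=
    TensorProduct.map
        (TensorProduct.map LinearMap.id (LinearMap.mul' K (MonoidAlgebra K Γ)) ∘ₗ
          (TensorProduct.assoc K N (MonoidAlgebra K Γ) (MonoidAlgebra K Γ)).toLinearMap)
        LinearMap.id ∘ₗ
      (TensorProduct.tensorTensorTensorComm K (N ⊗[K] MonoidAlgebra K Γ) N
        (MonoidAlgebra K Γ) (MonoidAlgebra K Γ)).toLinearMap ∘ₗ
        TensorProduct.map
          ((TensorProduct.assoc K N (MonoidAlgebra K Γ) N).symm.toLinearMap ∘ₗ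
            TensorProduct.map LinearMap.id R.coact ∘ₗ R.comul)
          Coalgebra.comul
  counit := LinearMap.mul' K K ∘ₗ TensorProduct.map R.counit Coalgebra.counit

/-- The Radford biproduct `R # H`. -/
def radford (R : BraidedData K Γ N) : BialgData K (N ⊗[K] MonoidAlgebra K Γ) :=
  R.biproduct R.trivialCocycle

/-- The inclusion `h ↦ 1 # h` of `H` into `R # H`. -/
def inclH (R : BraidedData K Γ N) : MonoidAlgebra K Γ →ₗ[K] N ⊗[K] MonoidAlgebra K Γ :=
  TensorProduct.mk K N (MonoidAlgebra K Γ) R.one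

/-- The extension of a form on `R ⊗ R` to an `H`-bilinear form on `A ⊗ A`, `A = R # H`:
as `r # h = h₍₁₎ (S(h₍₂₎) · r # 1)`, it is `(r # h) ⊗ (s # k) ↦ v(S(h) · r ⊗ s) ε(k)`. -/
def extend (R : BraidedData K Γ N) (v : N ⊗[K] N →ₗ[K] K) :
    (N ⊗[K] MonoidAlgebra K Γ) ⊗[K] (N ⊗[K] MonoidAlgebra K Γ) →ₗ[K] K :=
  v ∘ₗ TensorProduct.map
    (R.actT ∘ₗ (TensorProduct.comm K N (MonoidAlgebra K Γ)).toLinearMap ∘ₗ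
      TensorProduct.map LinearMap.id (HopfAlgebra.antipode K))
    ((TensorProduct.rid K N).toLinearMap ∘ₗ
      TensorProduct.map LinearMap.id Coalgebra.counit)

/-- The restriction `γ_R` of a form on `A ⊗ A` to `R ⊗ R`. -/
def restrict (_R : BraidedData K Γ N)
    (γ : (N ⊗[K] MonoidAlgebra K Γ) ⊗[K] (N ⊗[K] MonoidAlgebra K Γ) →ₗ[K] K) :
    N ⊗[K] N →ₗ[K] K :=
  γ ∘ₗ TensorProduct.map ((TensorProduct.mk K N (MonoidAlgebra K Γ)).flip 1)
    ((TensorProduct.mk K N (MonoidAlgebra K Γ)).flip 1)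

/-- `R^v`, for `R` a bialgebra in the category (so with trivial cocycle): the multiplication
becomes `v * m_R * v⁻¹`, with convolution over the braided coalgebra `R ⊗ R`. -/
def twist (R : BraidedData K Γ N) (v v' : N ⊗[K] N →ₗ[K] K) : BraidedData K Γ N :=
  { R with mul := convTwist R.comul₂ v v' R.mul }

/-- The twisted cocycle `ξ_v = u_H v * ξ * (H ⊗ v⁻¹) ρ_{R ⊗ R}`. -/
def twistCocycle (R : BraidedData K Γ N) (ξ : N ⊗[K] N →ₗ[K] MonoidAlgebra K Γ)
    (v v' : N ⊗[K] N →ₗ[K] K) : N ⊗[K] N →ₗ[K] MonoidAlgebra K Γ :=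
  conv R.comul₂ (LinearMap.mul' K (MonoidAlgebra K Γ))
    (Algebra.linearMap K (MonoidAlgebra K Γ) ∘ₗ v)
    (conv R.comul₂ (LinearMap.mul' K (MonoidAlgebra K Γ)) ξ
      ((TensorProduct.rid K (MonoidAlgebra K Γ)).toLinearMap ∘ₗ
        TensorProduct.map LinearMap.id v' ∘ₗ R.coact₂))

/-- `R` is a bialgebra in the category of left Yetter-Drinfeld modules over `K[Γ]`. All conditions
involving the action are stated on the basis `Γ`, and commutativity of `Γ` is used in `yd`. -/
structure IsBraidedBialgebra (R : BraidedData K Γ N) : Prop where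
  mul_assoc : ∀ r s t : N, R.mul (R.mul (r ⊗ₜ s) ⊗ₜ t) = R.mul (r ⊗ₜ R.mul (s ⊗ₜ t))
  one_mul : ∀ r : N, R.mul (R.one ⊗ₜ r) = r
  mul_one : ∀ r : N, R.mul (r ⊗ₜ R.one) = r
  coassoc : (TensorProduct.assoc K N N N).toLinearMap ∘ₗ
      TensorProduct.map R.comul LinearMap.id ∘ₗ R.comul =
    TensorProduct.map LinearMap.id R.comul ∘ₗ R.comul
  counit_left : (TensorProduct.lid K N).toLinearMap ∘ₗ
    TensorProduct.map R.counit LinearMap.id ∘ₗ R.comul = LinearMap.id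
  counit_right : (TensorProduct.rid K N).toLinearMap ∘ₗ
    TensorProduct.map LinearMap.id R.counit ∘ₗ R.comul = LinearMap.id
  coact_coassoc : (TensorProduct.assoc K (MonoidAlgebra K Γ) (MonoidAlgebra K Γ) N).toLinearMap ∘ₗ
      TensorProduct.map Coalgebra.comul LinearMap.id ∘ₗ R.coact =
    TensorProduct.map LinearMap.id R.coact ∘ₗ R.coact
  coact_counit : (TensorProduct.lid K N).toLinearMap ∘ₗ
    TensorProduct.map Coalgebra.counit LinearMap.id ∘ₗ R.coact = LinearMap.id
  yd : ∀ g : Γ, R.coact ∘ₗ R.act (MonoidAlgebra.of K Γ g) =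
    TensorProduct.map LinearMap.id (R.act (MonoidAlgebra.of K Γ g)) ∘ₗ R.coact
  act_mul : ∀ (g : Γ) (r s : N), R.act (MonoidAlgebra.of K Γ g) (R.mul (r ⊗ₜ s)) =
    R.mul (R.act (MonoidAlgebra.of K Γ g) r ⊗ₜ R.act (MonoidAlgebra.of K Γ g) s)
  act_one : ∀ g : Γ, R.act (MonoidAlgebra.of K Γ g) R.one = R.one
  act_comul : ∀ g : Γ, R.comul ∘ₗ R.act (MonoidAlgebra.of K Γ g) =
    TensorProduct.map (R.act (MonoidAlgebra.of K Γ g)) (R.act (MonoidAlgebra.of K Γ g)) ∘ₗ R.comul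
  act_counit : ∀ g : Γ, R.counit ∘ₗ R.act (MonoidAlgebra.of K Γ g) = R.counit
  coact_mul : R.coact ∘ₗ R.mul = TensorProduct.map LinearMap.id R.mul ∘ₗ R.coact₂
  coact_one : R.coact R.one = 1 ⊗ₜ R.one
  coact_comul : TensorProduct.map LinearMap.id R.comul ∘ₗ R.coact = R.coact₂ ∘ₗ R.comul
  coact_counit_unit : ∀ r : N,
    TensorProduct.map LinearMap.id R.counit (R.coact r) = 1 ⊗ₜ R.counit r
  comul_mul : R.comul ∘ₗ R.mul = TensorProduct.map R.mul R.mul ∘ₗ R.comul₂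
  comul_one : R.comul R.one = R.one ⊗ₜ R.one
  counit_mul : R.counit ∘ₗ R.mul = R.counit₂
  counit_one : R.counit R.one = 1

end BraidedData

/-- The total integral `λ` on `K[Γ]`: `λ(g) = δ_{g,1}` for `g ∈ Γ`. -/
def totalIntegral (K Γ : Type*) [Field K] [CommGroup Γ] : MonoidAlgebra K Γ →ₗ[K] K :=
  Finsupp.lapply (1 : Γ) ∘ₗ (MonoidAlgebra.coeffLinearEquiv K).toLinearMap

end QPlane

/-! ### Quantum planes -/

/-- A quantum plane `V = K x₁ ⊕ K x₂` over `K[Γ]`, with `xᵢ` of degree `gᵢ` and weight `χᵢ`. -/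
structure QuantumPlane (K Γ : Type*) [Field K] [CommGroup Γ] where
  g₁ : Γ
  g₂ : Γ
  χ₁ : Γ →* K
  χ₂ : Γ →* K
  r₁ : ℕ
  r₂ : ℕ
  two_le_r₁ : 2 ≤ r₁
  two_le_r₂ : 2 ≤ r₂
  braid : χ₁ g₂ * χ₂ g₁ = 1
  prim₁ : IsPrimitiveRoot (χ₁ g₁) r₁
  prim₂ : IsPrimitiveRoot (χ₂ g₂) r₂

namespace QuantumPlane

open QPlane

variable {K Γ : Type*} [Field K] [CommGroup Γ] (D : QuantumPlane K Γ)

/-- `R` (with grading `𝒢` and generators `x₁, x₂`) is the Nichols algebra of the quantum plane `V`: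
a graded bialgebra in the category of Yetter-Drinfeld modules with `R(0) = K`, with
`R(1) = K x₁ ⊕ K x₂ ≅ V` equal to the space of primitive elements, and generated by `R(1)`.
(An antipode exists automatically, since `R` is graded and connected.) -/
structure IsNicholsAlgebra {N : Type*} [AddCommMonoid N] [Module K N] (R : BraidedData K Γ N)
    (x₁ x₂ : N) (𝒢 : ℕ → Submodule K N) : Prop where
  bialgebra : R.IsBraidedBialgebra
  internal : DirectSum.IsInternal 𝒢
  act_mem : ∀ (n : ℕ) (g : Γ), ∀ r ∈ 𝒢 n, R.act (MonoidAlgebra.of K Γ g) r ∈ 𝒢 n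
  coact_mem : ∀ n : ℕ, ∀ r ∈ 𝒢 n, R.coact r ∈
    LinearMap.range (TensorProduct.map (LinearMap.id (R := K) (M := MonoidAlgebra K Γ))
      (𝒢 n).subtype)
  mul_mem : ∀ m n : ℕ, ∀ r ∈ 𝒢 m, ∀ s ∈ 𝒢 n, R.mul (r ⊗ₜ s) ∈ 𝒢 (m + n)
  comul_mem : ∀ n : ℕ, ∀ r ∈ 𝒢 n, R.comul r ∈
    ⨆ p ∈ Finset.HasAntidiagonal.antidiagonal n,
      LinearMap.range (TensorProduct.map (𝒢 p.1).subtype (𝒢 p.2).subtype)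
  degree_zero : 𝒢 0 = Submodule.span K {R.one}
  degree_one : 𝒢 1 = Submodule.span K {x₁, x₂}
  independent : LinearIndependent K ![x₁, x₂]
  act_x₁ : ∀ g : Γ, R.act (MonoidAlgebra.of K Γ g) x₁ = D.χ₁ g • x₁
  act_x₂ : ∀ g : Γ, R.act (MonoidAlgebra.of K Γ g) x₂ = D.χ₂ g • x₂
  coact_x₁ : R.coact x₁ = MonoidAlgebra.of K Γ D.g₁ ⊗ₜ x₁
  coact_x₂ : R.coact x₂ = MonoidAlgebra.of K Γ D.g₂ ⊗ₜ x₂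
  primitive : ∀ r : N, R.comul r = r ⊗ₜ R.one + R.one ⊗ₜ r ↔ r ∈ 𝒢 1
  generated : ∀ S : Submodule K N, R.one ∈ S → x₁ ∈ S → x₂ ∈ S →
    (∀ r ∈ S, ∀ s ∈ S, R.mul (r ⊗ₜ s) ∈ S) → S = ⊤

/-! #### The Nichols algebra in its monomial basis -/

/-- The vector space with basis the monomials `x₁ⁱx₂ʲ`, `0 ≤ i < r₁`, `0 ≤ j < r₂`. -/
abbrev Nic : Type _ := Fin D.r₁ × Fin D.r₂ →₀ K

/-- The monomial `x₁ⁱx₂ʲ`, which is `0` if `i ≥ r₁` or `j ≥ r₂`. -/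
def mon (i j : ℕ) : D.Nic :=
  if h : i < D.r₁ ∧ j < D.r₂ then Finsupp.single (⟨i, h.1⟩, ⟨j, h.2⟩) 1 else 0

/-- The linear map on the Nichols algebra with given values on the monomials `x₁ⁱx₂ʲ`. -/
def lin {M : Type*} [AddCommMonoid M] [Module K M] (f : ℕ → ℕ → M) : D.Nic →ₗ[K] M :=
  Finsupp.linearCombination K fun p => f p.1 p.2

/-- The linear map with given values on the `x₁ⁱx₂ʲ ⊗ x₁ᵏx₂ˡ`. -/
def lin₂ {M : Type*} [AddCommMonoid M] [Module K M] (f : ℕ → ℕ → ℕ → ℕ → M) :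
    D.Nic ⊗[K] D.Nic →ₗ[K] M :=
  TensorProduct.lift (D.lin fun i j => D.lin fun k l => f i j k l)

/-- The action of `Γ`, `g · x₁ⁱx₂ʲ = χ₁(g)ⁱ χ₂(g)ʲ x₁ⁱx₂ʲ`. -/
def rep : Γ →* Module.End K D.Nic where
  toFun g := D.lin fun i j => (D.χ₁ g ^ i * D.χ₂ g ^ j) • D.mon i j
  map_one' := by
    ext p : 2
    simp [lin, mon]
  map_mul' g h := by
    ext p : 2
    simp only [lin, mon, LinearMap.comp_apply, Finsupp.lsingle_apply, Module.End.mul_apply,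
      Finsupp.linearCombination_single, Fin.is_lt, and_self, dite_true, map_smul,
      map_mul, mul_pow, smul_smul]
    congr 1
    ring

/-- The Nichols algebra `R = B(V)` of the quantum plane, with
`x₂x₁ = χ₁(g₂) x₁x₂`, `x₁^{r₁} = 0 = x₂^{r₂}` and `x₁`, `x₂` primitive. -/
def nichols : BraidedData K Γ D.Nic where
  mul := D.lin₂ fun i j k l => (D.χ₁ D.g₂ ^ (j * k)) • D.mon (i + k) (j + l)
  one := D.mon 0 0
  comul := D.lin fun i j => ∑ n ∈ Finset.range (i + 1), ∑ m ∈ Finset.range (j + 1),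
    (qBinom (D.χ₁ D.g₁) i n * qBinom (D.χ₂ D.g₂) j m * D.χ₂ D.g₁ ^ ((i - n) * m)) •
      (D.mon n m ⊗ₜ[K] D.mon (i - n) (j - m))
  counit := D.lin fun i j => if i = 0 ∧ j = 0 then 1 else 0
  act := MonoidAlgebra.lift K (Module.End K D.Nic) Γ D.rep
  coact := D.lin fun i j => MonoidAlgebra.of K Γ (D.g₁ ^ i * D.g₂ ^ j) ⊗ₜ[K] D.mon i j

/-- The grading of the Nichols algebra, `x₁ⁱx₂ʲ` having degree `i + j`. -/
def nicholsGrading (n : ℕ) : Submodule K D.Nic :=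
  Submodule.span K {r | ∃ i j : ℕ, i + j = n ∧ r = D.mon i j}

/-- The underlying space of `A = R # H`. -/
abbrev Bos : Type _ := D.Nic ⊗[K] MonoidAlgebra K Γ

/-! #### The cocycles -/

/-- `γ₁`: it is `ε` on all pairs of monomials, except that `γ₁(x₁ᵐ ⊗ x₁^{r₁ - m}) = a₁` for
`0 < m < r₁`, extended `H`-bilinearly. -/
def gamma₁ (a₁ : K) : D.Bos ⊗[K] D.Bos →ₗ[K] K :=
  D.nichols.extend <| D.lin₂ fun i j k l =>
    if j = 0 ∧ l = 0 ∧ 0 < i ∧ i < D.r₁ ∧ i + k = D.r₁ then a₁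
    else if i = 0 ∧ j = 0 ∧ k = 0 ∧ l = 0 then 1 else 0

/-- `γ₂`: it is `ε` on all pairs of monomials, except that `γ₂(x₂ᵐ ⊗ x₂^{r₂ - m}) = a₂` for
`0 < m < r₂`, extended `H`-bilinearly. -/
def gamma₂ (a₂ : K) : D.Bos ⊗[K] D.Bos →ₗ[K] K :=
  D.nichols.extend <| D.lin₂ fun i j k l =>
    if i = 0 ∧ k = 0 ∧ 0 < j ∧ j < D.r₂ ∧ j + l = D.r₂ then a₂
    else if i = 0 ∧ j = 0 ∧ k = 0 ∧ l = 0 then 1 else 0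

/-- `γ_a`: it is `ε` on all pairs of monomials, except that `γ_a(x₂ᵐ ⊗ x₁ᵐ) = (m)!_q aᵐ` for
`0 ≤ m < r₁`, with `q = χ₁(g₁)`, extended `H`-bilinearly. -/
def gamma₁₂ (a : K) : D.Bos ⊗[K] D.Bos →ₗ[K] K :=
  D.nichols.extend <| D.lin₂ fun i j k l =>
    if i = 0 ∧ l = 0 ∧ j = k then qFact (D.χ₁ D.g₁) j * a ^ j else 0

/-- The convolution of forms on `A ⊗ A`. -/
def convA (f g : D.Bos ⊗[K] D.Bos →ₗ[K] K) : D.Bos ⊗[K] D.Bos →ₗ[K] K :=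
  convForm D.nichols.radford.comul₂ f g

/-- The twisting cocycle `α = γ_a * γ₁ * γ₂`. -/
def alpha (a₁ a₂ a : K) : D.Bos ⊗[K] D.Bos →ₗ[K] K :=
  D.convA (D.gamma₁₂ a) (D.convA (D.gamma₁ a₁) (D.gamma₂ a₂))

/-! #### The liftings -/

/-- The parameters `(a₁, a₂, a)` define a lifting of `B(V) # K[Γ]`. -/
structure IsLiftingDatum (a₁ a₂ a : K) : Prop where
  cond₁ : a₁ ≠ 0 → D.g₁ ^ D.r₁ ≠ 1 ∧ D.χ₁ ^ D.r₁ = 1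
  cond₂ : a₂ ≠ 0 → D.g₂ ^ D.r₂ ≠ 1 ∧ D.χ₂ ^ D.r₂ = 1
  cond₁₂ : a ≠ 0 → D.g₁ * D.g₂ ≠ 1 ∧ D.χ₁ * D.χ₂ = 1

/-- Generators of a lifting. -/
inductive Gen (Γ : Type*)
  | grp (h : Γ)
  | x₁
  | x₂

/-- A free generator. -/
abbrev fr (K : Type*) {Γ : Type*} [Field K] (s : Gen Γ) : FreeAlgebra K (Gen Γ) :=
  FreeAlgebra.ι K s

/-- The defining relations of the lifting `A(a₁, a₂, a)`. -/
inductive Rel (a₁ a₂ a : K) : FreeAlgebra K (Gen Γ) → FreeAlgebra K (Gen Γ) → Prop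
  | one : Rel a₁ a₂ a (fr K (.grp 1)) 1
  | mul (h k : Γ) : Rel a₁ a₂ a (fr K (.grp h) * fr K (.grp k)) (fr K (.grp (h * k)))
  | comm₁ (h : Γ) : Rel a₁ a₂ a (fr K (.grp h) * fr K .x₁) (D.χ₁ h • (fr K .x₁ * fr K (.grp h)))
  | comm₂ (h : Γ) : Rel a₁ a₂ a (fr K (.grp h) * fr K .x₂) (D.χ₂ h • (fr K .x₂ * fr K (.grp h)))
  | pow₁ : Rel a₁ a₂ a (fr K .x₁ ^ D.r₁) (a₁ • (1 - fr K (.grp (D.g₁ ^ D.r₁))))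
  | pow₂ : Rel a₁ a₂ a (fr K .x₂ ^ D.r₂) (a₂ • (1 - fr K (.grp (D.g₂ ^ D.r₂))))
  | link : Rel a₁ a₂ a (fr K .x₂ * fr K .x₁)
      (D.χ₁ D.g₂ • (fr K .x₁ * fr K .x₂) + a • (1 - fr K (.grp (D.g₁ * D.g₂))))

/-- The algebra `A(a₁, a₂, a)`. -/
def Lifting (a₁ a₂ a : K) : Type _ := RingQuot (D.Rel a₁ a₂ a)

namespace Lifting

variable (a₁ a₂ a : K)

instance : Ring (D.Lifting a₁ a₂ a) := inferInstanceAs (Ring (RingQuot (D.Rel a₁ a₂ a)))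

instance : Algebra K (D.Lifting a₁ a₂ a) :=
  inferInstanceAs (Algebra K (RingQuot (D.Rel a₁ a₂ a)))

/-- The quotient map from the free algebra. -/
def mk : FreeAlgebra K (Gen Γ) →ₐ[K] D.Lifting a₁ a₂ a := RingQuot.mkAlgHom K (D.Rel a₁ a₂ a)

/-- The image of a generator. -/
def gen (s : Gen Γ) : D.Lifting a₁ a₂ a := mk D a₁ a₂ a (fr K s)

variable {a₁ a₂ a} in
lemma mk_rel {x y : FreeAlgebra K (Gen Γ)} (h : D.Rel a₁ a₂ a x y) :
    mk D a₁ a₂ a x = mk D a₁ a₂ a y :=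
  RingQuot.mkAlgHom_rel K h

lemma gen_one : gen D a₁ a₂ a (.grp 1) = 1 := by
  simpa [gen] using mk_rel D (Rel.one (D := D) (a₁ := a₁) (a₂ := a₂) (a := a))

lemma gen_mul (h k : Γ) :
    gen D a₁ a₂ a (.grp h) * gen D a₁ a₂ a (.grp k) = gen D a₁ a₂ a (.grp (h * k)) := by
  simpa [gen] using mk_rel D (Rel.mul (D := D) (a₁ := a₁) (a₂ := a₂) (a := a) h k)

lemma gen_pow (h : Γ) (n : ℕ) :
    gen D a₁ a₂ a (.grp h) ^ n = gen D a₁ a₂ a (.grp (h ^ n)) := by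
  induction n with
  | zero => simp [gen_one]
  | succ n ih => rw [pow_succ, ih, gen_mul, pow_succ]

lemma gen_comm₁ (h : Γ) : gen D a₁ a₂ a (.grp h) * gen D a₁ a₂ a .x₁ =
    D.χ₁ h • (gen D a₁ a₂ a .x₁ * gen D a₁ a₂ a (.grp h)) := by
  simpa [gen] using mk_rel D (Rel.comm₁ (D := D) (a₁ := a₁) (a₂ := a₂) (a := a) h)

lemma gen_comm₂ (h : Γ) : gen D a₁ a₂ a (.grp h) * gen D a₁ a₂ a .x₂ =
    D.χ₂ h • (gen D a₁ a₂ a .x₂ * gen D a₁ a₂ a (.grp h)) := by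
  simpa [gen] using mk_rel D (Rel.comm₂ (D := D) (a₁ := a₁) (a₂ := a₂) (a := a) h)

lemma gen_pow₁ : gen D a₁ a₂ a .x₁ ^ D.r₁ = a₁ • (1 - gen D a₁ a₂ a (.grp (D.g₁ ^ D.r₁))) := by
  simpa [gen] using mk_rel D (Rel.pow₁ (D := D) (a₁ := a₁) (a₂ := a₂) (a := a))

lemma gen_pow₂ : gen D a₁ a₂ a .x₂ ^ D.r₂ = a₂ • (1 - gen D a₁ a₂ a (.grp (D.g₂ ^ D.r₂))) := by
  simpa [gen] using mk_rel D (Rel.pow₂ (D := D) (a₁ := a₁) (a₂ := a₂) (a := a))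

lemma gen_link : gen D a₁ a₂ a .x₂ * gen D a₁ a₂ a .x₁ =
    D.χ₁ D.g₂ • (gen D a₁ a₂ a .x₁ * gen D a₁ a₂ a .x₂) +
      a • (1 - gen D a₁ a₂ a (.grp (D.g₁ * D.g₂))) := by
  simpa [gen] using mk_rel D (Rel.link (D := D) (a₁ := a₁) (a₂ := a₂) (a := a))

/-- The values of the comultiplication on the generators: `h ↦ h ⊗ h` for `h ∈ Γ` and
`xᵢ ↦ xᵢ ⊗ 1 + gᵢ ⊗ xᵢ`. -/
def comulGen : Gen Γ → D.Lifting a₁ a₂ a ⊗[K] D.Lifting a₁ a₂ a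
  | .grp h => gen D a₁ a₂ a (.grp h) ⊗ₜ gen D a₁ a₂ a (.grp h)
  | .x₁ => gen D a₁ a₂ a .x₁ ⊗ₜ 1 + gen D a₁ a₂ a (.grp D.g₁) ⊗ₜ gen D a₁ a₂ a .x₁
  | .x₂ => gen D a₁ a₂ a .x₂ ⊗ₜ 1 + gen D a₁ a₂ a (.grp D.g₂) ⊗ₜ gen D a₁ a₂ a .x₂

/-- The values of the counit on the generators. -/
def counitGen : Gen Γ → K
  | .grp _ => 1
  | .x₁ => 0
  | .x₂ => 0

lemma comul_rel ⦃x y : FreeAlgebra K (Gen Γ)⦄ (h : D.Rel a₁ a₂ a x y) :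
    FreeAlgebra.lift K (comulGen D a₁ a₂ a) x = FreeAlgebra.lift K (comulGen D a₁ a₂ a) y := by
  cases h with
  | one =>
    simp [comulGen, gen_one, Algebra.TensorProduct.one_def]
  | mul h k =>
    simp [comulGen, gen_mul]
  | comm₁ h =>
    simp only [map_mul, map_smul, FreeAlgebra.lift_ι_apply, comulGen, mul_add, add_mul,
      Algebra.TensorProduct.tmul_mul_tmul, gen_comm₁, gen_mul, one_mul, mul_one, smul_add,
      TensorProduct.smul_tmul', TensorProduct.tmul_smul, mul_comm h]
  | comm₂ h =>
    simp only [map_mul, map_smul, FreeAlgebra.lift_ι_apply, comulGen, mul_add, add_mul,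
      Algebra.TensorProduct.tmul_mul_tmul, gen_comm₂, gen_mul, one_mul, mul_one, smul_add,
      TensorProduct.smul_tmul', TensorProduct.tmul_smul, mul_comm h]
  | pow₁ =>
    simp only [map_pow, map_smul, map_sub, map_one, FreeAlgebra.lift_ι_apply, comulGen]
    rw [pow_add_of_primitive D.two_le_r₁ D.prim₁]
    · simp only [Algebra.TensorProduct.tmul_pow, gen_pow₁, gen_pow, one_pow,
        Algebra.TensorProduct.one_def, TensorProduct.sub_tmul, TensorProduct.tmul_sub,
        TensorProduct.tmul_smul, ← TensorProduct.smul_tmul', smul_sub]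
      abel
    · simp [gen_comm₁, TensorProduct.smul_tmul']
  | pow₂ =>
    simp only [map_pow, map_smul, map_sub, map_one, FreeAlgebra.lift_ι_apply, comulGen]
    rw [pow_add_of_primitive D.two_le_r₂ D.prim₂]
    · simp only [Algebra.TensorProduct.tmul_pow, gen_pow₂, gen_pow, one_pow,
        Algebra.TensorProduct.one_def, TensorProduct.sub_tmul, TensorProduct.tmul_sub,
        TensorProduct.tmul_smul, ← TensorProduct.smul_tmul', smul_sub]
      abel
    · simp [gen_comm₂, TensorProduct.smul_tmul']
  | link =>
    have hb : D.χ₁ D.g₂ * D.χ₂ D.g₁ = 1 := D.braid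
    simp only [map_mul, map_add, map_smul, map_sub, map_one, FreeAlgebra.lift_ι_apply, comulGen,
      mul_add, add_mul, Algebra.TensorProduct.tmul_mul_tmul, one_mul, mul_one, gen_comm₁,
      gen_comm₂, gen_link, gen_mul, Algebra.TensorProduct.one_def, TensorProduct.sub_tmul,
      TensorProduct.add_tmul, TensorProduct.tmul_add,
      TensorProduct.tmul_sub, TensorProduct.tmul_smul, ← TensorProduct.smul_tmul', smul_sub,
      smul_add, smul_smul, hb, one_smul, mul_comm D.g₂ D.g₁]
    abel

lemma counit_rel ⦃x y : FreeAlgebra K (Gen Γ)⦄ (h : D.Rel a₁ a₂ a x y) :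
    FreeAlgebra.lift K (counitGen (K := K)) x = FreeAlgebra.lift K (counitGen (K := K)) y := by
  have h1 : D.r₁ ≠ 0 := by have := D.two_le_r₁; omega
  have h2 : D.r₂ ≠ 0 := by have := D.two_le_r₂; omega
  cases h <;> simp [counitGen, h1, h2]

/-- The comultiplication of the lifting. -/
def comulHom : D.Lifting a₁ a₂ a →ₐ[K] D.Lifting a₁ a₂ a ⊗[K] D.Lifting a₁ a₂ a :=
  RingQuot.liftAlgHom K ⟨FreeAlgebra.lift K (comulGen D a₁ a₂ a), comul_rel D a₁ a₂ a⟩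

/-- The counit of the lifting. -/
def counitHom : D.Lifting a₁ a₂ a →ₐ[K] K :=
  RingQuot.liftAlgHom K ⟨FreeAlgebra.lift K (counitGen (K := K)), counit_rel D a₁ a₂ a⟩

lemma comulHom_gen (s : Gen Γ) :
    comulHom D a₁ a₂ a (gen D a₁ a₂ a s) = comulGen D a₁ a₂ a s :=
  (RingQuot.liftAlgHom_mkAlgHom_apply K _ (comul_rel D a₁ a₂ a) _).trans (by simp)

lemma counitHom_gen (s : Gen Γ) :
    counitHom D a₁ a₂ a (gen D a₁ a₂ a s) = counitGen s :=
  (RingQuot.liftAlgHom_mkAlgHom_apply K _ (counit_rel D a₁ a₂ a) _).trans (by simp)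

variable {a₁ a₂ a} in
lemma hom_ext {S : Type*} [Semiring S] [Algebra K S] {f f' : D.Lifting a₁ a₂ a →ₐ[K] S}
    (h : ∀ s, f (gen D a₁ a₂ a s) = f' (gen D a₁ a₂ a s)) : f = f' :=
  RingQuot.ringQuot_ext' (S := K) f f' (FreeAlgebra.hom_ext (funext h))

instance : Bialgebra K (D.Lifting a₁ a₂ a) :=
  Bialgebra.ofAlgHom (comulHom D a₁ a₂ a) (counitHom D a₁ a₂ a)
    (by
      refine hom_ext D fun s => ?_
      cases s <;>
        simp [comulHom_gen, comulGen, TensorProduct.add_tmul, TensorProduct.tmul_add,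
          Algebra.TensorProduct.one_def, add_assoc])
    (by
      refine hom_ext D fun s => ?_
      cases s <;> simp [comulHom_gen, counitHom_gen, comulGen, counitGen])
    (by
      refine hom_ext D fun s => ?_
      cases s <;> simp [comulHom_gen, counitHom_gen, comulGen, counitGen])

end Lifting

/-- The four alternative conditions of the theorem. If `a ≠ 0` then `χ₁χ₂ = 1` and hence `r₁ = r₂`
is the number called `r`. -/
def Cond (a₁ a₂ a : K) : Prop :=
  (D.alpha a₁ a₂ a = D.gamma₁ a₁ ∨ D.alpha a₁ a₂ a = D.gamma₂ a₂) ∨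
  (D.alpha a₁ a₂ a = D.convA (D.gamma₁ a₁) (D.gamma₂ a₂) ∧ D.g₁ ^ D.r₁ * D.g₂ ^ D.r₂ ≠ 1) ∨
  (a ≠ 0 ∧ (Odd D.r₁ ∨ D.r₁ = 2) ∧ (D.g₁ * D.g₂) ^ D.r₁ ≠ 1) ∨
  (a ≠ 0 ∧ ∃ r' : ℕ, D.r₁ = 2 * r' ∧ 2 < D.r₁ ∧
    (∀ t ∈ ({1, 2, 3} : Set ℕ), (D.g₁ * D.g₂) ^ (t * r') ≠ 1) ∧
    (D.g₁ * D.g₂) ^ r' * D.g₂ ^ D.r₁ ≠ 1 ∧ D.g₁ ^ D.r₁ * (D.g₁ * D.g₂) ^ r' ≠ 1)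

end QuantumPlane

end

open scoped TensorProduct

noncomputable section

namespace QuantumPlane
open QPlane
variable {K Γ : Type*} [Field K] [CommGroup Γ] (D : QuantumPlane K Γ)

/-! ### Bases -/

section Bases

variable {M : Type*} [AddCommMonoid M] [Module K M]

/-! The lifting B and the cocycle α are placed in a family. For two parameter triples P and Q let
E(P, Q) (`Cog`) be the algebra generated by Γ, x₁, x₂ with the usual commutation of Γ and xᵢ ^ rᵢ =
Pᵢ - Qᵢ gᵢ ^ rᵢ, x₂x₁ = χ₁(g₂)x₁x₂ + P₁₂ - Q₁₂ g₁g₂. Then E(P, P) is the lifting with parameters P,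
E(0, 0) is A, and E(P, Q) plays the role of a bi-Galois object between two liftings. The formulas h
↦ h ⊗ h, xᵢ ↦ xᵢ ⊗ 1 + gᵢ ⊗ xᵢ define algebra maps E(P, Q) → E(P, S) ⊗ E(S, Q) for every S, since
the terms in S cancel (`Rep.tensor`). On monomials such a map is given by the comultiplication of A,
whatever the parameters (`Rep.mono_tensor`).

All E(P, Q) have the monomials x₁ⁱx₂ʲh as a basis (`Cog.mono_injective`, `Cog.mono_surjective`).
They span by rewriting. They are independent because E(P, Q) maps to U ⊗ (End A ⊗ V), where U and V
are any nonzero solutions for (P, 0) and (0, Q) and A acts on itself by left multiplication; looking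
at a coefficient of highest degree shows that tensoring with a nonzero solution does not destroy the
independence that End A has. Hence each product can be carried to the space of A, as `cmul P Q`, and
the comultiplication Δ of A satisfies Δ ∘ cmul(P, Q) = (cmul(P, S) ⊗ cmul(S, Q)) ∘ Δ₂
(`comul_cmul`), where Δ₂ is the comultiplication of A ⊗ A.

Let form(P, Q) = ε ∘ cmul(P, Q). Applying ε to one side of the last identity gives form(P, S) *
cmul(S, Q) = cmul(P, Q) = cmul(P, S) * form(S, Q) and form(P, S) * form(S, Q) = form(P, Q), with
form(P, P) = ε. So form(P, 0) has inverse form(0, P), it twists cmul(0, 0) = m_A into cmul(P, P),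
and its cocycle identity is the associativity of cmul(P, 0). The three elementary cocycles are such
forms: γ_a, γ₁, γ₂ belong to the successive steps (a₁, a₂, a), (a₁, a₂, 0), (0, a₂, 0), (0, 0, 0),
so α = form((a₁, a₂, a), 0) (`IsLiftingDatum.alpha_eq`). This is (a).

For (b), convolution over A ⊗ A restricts to convolution over the braided coalgebra R ⊗ R as soon as
the left factor does not see Γ in the way expressed by `proj` (`conv_comp_incl₂`). Thus the product
of R^{α_R} is the R-component of cmul(P, P), the cocycle ε_{α_R} is its H-component, and (toNic ⊗
toGrp) ∘ Δ = id puts them together (`biproduct_twist_mul`).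

For (c), λ ∘ ε_{α_R} is α_R * (λ ⊗ α_R⁻¹)ρ, so it is enough that (λ ⊗ α_R⁻¹)ρ = ε. On a pair of
monomials of total bidegree (b, c) this is α_R⁻¹ times λ(g₁ᵇg₂ᶜ). The form can be nonzero only if
the relations lower (b, c) to (0, 0), that is b = s r₁ + n and c = t r₂ + n
(`drop_of_form_ne_zero`), and for such exponents each of the four conditions makes g₁ᵇg₂ᶜ ≠ 1 unless
b = c = 0 (`Cond.eq_zero_of_drop`). -/

lemma mon_of_lt {i j : ℕ} (hi : i < D.r₁) (hj : j < D.r₂) :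
    D.mon i j = Finsupp.single (⟨i, hi⟩, ⟨j, hj⟩) 1 := by
  simp [mon, hi, hj]

lemma mon_eq_zero {i j : ℕ} (h : ¬ (i < D.r₁ ∧ j < D.r₂)) : D.mon i j = 0 := by
  simp [mon, h]

lemma r₁_pos : 0 < D.r₁ := by have := D.two_le_r₁; omega

lemma r₂_pos : 0 < D.r₂ := by have := D.two_le_r₂; omega

lemma lin_mon (f : ℕ → ℕ → M) {i j : ℕ} (hi : i < D.r₁) (hj : j < D.r₂) :
    D.lin f (D.mon i j) = f i j := by
  simp [lin, mon_of_lt D hi hj]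

lemma lin₂_mon (f : ℕ → ℕ → ℕ → ℕ → M) {i j k l : ℕ} (hi : i < D.r₁) (hj : j < D.r₂)
    (hk : k < D.r₁) (hl : l < D.r₂) :
    D.lin₂ f (D.mon i j ⊗ₜ D.mon k l) = f i j k l := by
  simp [lin₂, lin_mon, hi, hj, hk, hl]

variable {D}

lemma nic_ext {f g : D.Nic →ₗ[K] M}
    (h : ∀ i < D.r₁, ∀ j < D.r₂, f (D.mon i j) = g (D.mon i j)) : f = g := by
  ext ⟨i, j⟩
  simpa [mon_of_lt D i.2 j.2] using h i i.2 j j.2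

lemma nic₂_ext {f g : D.Nic ⊗[K] D.Nic →ₗ[K] M}
    (h : ∀ i < D.r₁, ∀ j < D.r₂, ∀ k < D.r₁, ∀ l < D.r₂,
      f (D.mon i j ⊗ₜ D.mon k l) = g (D.mon i j ⊗ₜ D.mon k l)) : f = g :=
  TensorProduct.ext (nic_ext fun i hi j hj => nic_ext fun k hk l hl => h i hi j hj k hk l hl)

variable (D)

/-- The basis element `x₁ⁱx₂ʲh` of `A`. -/
def bas (i j : ℕ) (h : Γ) : D.Bos := D.mon i j ⊗ₜ MonoidAlgebra.of K Γ h

lemma bas_eq_zero {i j : ℕ} (hij : ¬ (i < D.r₁ ∧ j < D.r₂)) (h : Γ) : D.bas i j h = 0 := by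
  simp [bas, mon_eq_zero D hij]

variable {D}

lemma bos_ext {f g : D.Bos →ₗ[K] M}
    (h : ∀ i < D.r₁, ∀ j < D.r₂, ∀ k, f (D.bas i j k) = g (D.bas i j k)) : f = g :=
  TensorProduct.ext (nic_ext fun i hi j hj => MonoidAlgebra.lhom_ext' fun k => by
    ext
    simpa [bas] using h i hi j hj k)

lemma bos₂_ext {f g : D.Bos ⊗[K] D.Bos →ₗ[K] M}
    (h : ∀ i < D.r₁, ∀ j < D.r₂, ∀ u, ∀ k < D.r₁, ∀ l < D.r₂, ∀ w,
      f (D.bas i j u ⊗ₜ D.bas k l w) = g (D.bas i j u ⊗ₜ D.bas k l w)) : f = g :=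
  TensorProduct.ext (bos_ext fun i hi j hj u => bos_ext fun k hk l hl w =>
    h i hi j hj u k hk l hl w)

end Bases

/-! ### The structure maps on the basis -/

lemma act_mon (g : Γ) (i j : ℕ) :
    D.nichols.act (MonoidAlgebra.of K Γ g) (D.mon i j) =
      (D.χ₁ g ^ i * D.χ₂ g ^ j) • D.mon i j := by
  by_cases h : i < D.r₁ ∧ j < D.r₂
  · simp [nichols, rep, lin_mon, h]
  · simp [mon_eq_zero D h]

lemma coact_mon (i j : ℕ) :
    D.nichols.coact (D.mon i j) = MonoidAlgebra.of K Γ (D.g₁ ^ i * D.g₂ ^ j) ⊗ₜ D.mon i j := by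
  by_cases h : i < D.r₁ ∧ j < D.r₂
  · simp [nichols, lin_mon, h]
  · simp [mon_eq_zero D h]

lemma mul_mon (i j k l : ℕ) :
    D.nichols.mul (D.mon i j ⊗ₜ D.mon k l) =
      (D.χ₁ D.g₂ ^ (j * k)) • D.mon (i + k) (j + l) := by
  by_cases h : i < D.r₁ ∧ j < D.r₂
  · by_cases h' : k < D.r₁ ∧ l < D.r₂
    · simp [nichols, lin₂_mon, h, h']
    · rw [mon_eq_zero D h', mon_eq_zero D (i := i + k) (by omega)]; simp
  · rw [mon_eq_zero D h, mon_eq_zero D (i := i + k) (by omega)]; simp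

lemma counit_mon {i j : ℕ} (hi : i < D.r₁) (hj : j < D.r₂) :
    D.nichols.counit (D.mon i j) = if i = 0 ∧ j = 0 then 1 else 0 := by
  simp [nichols, lin_mon, hi, hj]

lemma comul_mon {i j : ℕ} (hi : i < D.r₁) (hj : j < D.r₂) :
    D.nichols.comul (D.mon i j) = ∑ n ∈ Finset.range (i + 1), ∑ m ∈ Finset.range (j + 1),
    (qBinom (D.χ₁ D.g₁) i n * qBinom (D.χ₂ D.g₂) j m * D.χ₂ D.g₁ ^ ((i - n) * m)) •
      (D.mon n m ⊗ₜ[K] D.mon (i - n) (j - m)) := by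
  simp [nichols, lin_mon, hi, hj]

lemma one_eq : D.nichols.one = D.mon 0 0 := rfl

lemma radford_counit_bas {i j : ℕ} (hi : i < D.r₁) (hj : j < D.r₂) (h : Γ) :
    D.nichols.radford.counit (D.bas i j h) = if i = 0 ∧ j = 0 then 1 else 0 := by
  simp [BraidedData.radford, BraidedData.biproduct, bas, counit_mon, hi, hj]

/-- The group element of the right factor stays h, while the left factor absorbs the degree of the
right one. The leading-coefficient arguments and the comparison with `Rep.tensor` both rest on this
formula. -/
lemma radford_comul_bas {i j : ℕ} (hi : i < D.r₁) (hj : j < D.r₂) (h : Γ) :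
    D.nichols.radford.comul (D.bas i j h) =
      ∑ n ∈ Finset.range (i + 1), ∑ m ∈ Finset.range (j + 1),
        (qBinom (D.χ₁ D.g₁) i n * qBinom (D.χ₂ D.g₂) j m * D.χ₂ D.g₁ ^ ((i - n) * m)) •
          (D.bas n m (D.g₁ ^ (i - n) * D.g₂ ^ (j - m) * h) ⊗ₜ[K] D.bas (i - n) (j - m) h) := by
  simp only [BraidedData.radford, BraidedData.biproduct, bas, LinearMap.comp_apply,
    TensorProduct.map_tmul, comul_mon D hi hj, map_sum, map_smul, LinearMap.id_apply, coact_mon,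
    MonoidAlgebra.of_apply, MonoidAlgebra.comul_single, CommSemiring.comul_apply,
    LinearEquiv.coe_coe, TensorProduct.assoc_symm_tmul, TensorProduct.sum_tmul,
    ← TensorProduct.smul_tmul', TensorProduct.tensorTensorTensorComm_tmul,
    TensorProduct.assoc_tmul, LinearMap.mul'_apply, MonoidAlgebra.single_mul_single, mul_one,
    MonoidAlgebra.lsingle_apply]

end QuantumPlane

namespace QuantumPlane
open QPlane
variable {K Γ : Type*} [Field K] [CommGroup Γ] (D : QuantumPlane K Γ)

/-! ### Solutions of the deformed relations -/

/-- The parameters of the deformed relations. -/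
structure Params (K : Type*) where
  c₁ : K
  c₂ : K
  c₁₂ : K

instance : Zero (Params K) := ⟨⟨0, 0, 0⟩⟩

@[simp] lemma Params.zero_c₁ : (0 : Params K).c₁ = 0 := rfl
@[simp] lemma Params.zero_c₂ : (0 : Params K).c₂ = 0 := rfl
@[simp] lemma Params.zero_c₁₂ : (0 : Params K).c₁₂ = 0 := rfl

/-- A solution in the algebra `U` of the relations of `Γ`, `h xᵢ = χᵢ(h) xᵢ h` and
`xᵢ ^ rᵢ = Pᵢ - Qᵢ gᵢ ^ rᵢ`, `x₂ x₁ = χ₁(g₂) x₁ x₂ + P₁₂ - Q₁₂ g₁ g₂`. -/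
structure Rep (P Q : Params K) (U : Type*) [Ring U] [Algebra K U] where
  G : Γ →* U
  x₁ : U
  x₂ : U
  comm₁ : ∀ h, G h * x₁ = D.χ₁ h • (x₁ * G h)
  comm₂ : ∀ h, G h * x₂ = D.χ₂ h • (x₂ * G h)
  pow₁ : x₁ ^ D.r₁ = P.c₁ • 1 - Q.c₁ • G (D.g₁ ^ D.r₁)
  pow₂ : x₂ ^ D.r₂ = P.c₂ • 1 - Q.c₂ • G (D.g₂ ^ D.r₂)
  link : x₂ * x₁ = D.χ₁ D.g₂ • (x₁ * x₂) + (P.c₁₂ • 1 - Q.c₁₂ • G (D.g₁ * D.g₂))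

namespace Rep

variable {D} {P Q S : Params K} {U V : Type*} [Ring U] [Algebra K U] [Ring V] [Algebra K V]

lemma comm_pow₁ (u : D.Rep P Q U) (h : Γ) (n : ℕ) :
    u.G h * u.x₁ ^ n = D.χ₁ h ^ n • (u.x₁ ^ n * u.G h) := by
  induction n with
  | zero => simp
  | succ n ih =>
    rw [pow_succ, ← mul_assoc, ih, smul_mul_assoc, mul_assoc, u.comm₁, mul_smul_comm, smul_smul,
      ← pow_succ, mul_assoc]

lemma comm_pow₂ (u : D.Rep P Q U) (h : Γ) (n : ℕ) :
    u.G h * u.x₂ ^ n = D.χ₂ h ^ n • (u.x₂ ^ n * u.G h) := by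
  induction n with
  | zero => simp
  | succ n ih =>
    rw [pow_succ, ← mul_assoc, ih, smul_mul_assoc, mul_assoc, u.comm₂, mul_smul_comm, smul_smul,
      ← pow_succ, mul_assoc]

lemma comm_mon (u : D.Rep P Q U) (h : Γ) (i j : ℕ) :
    u.G h * (u.x₁ ^ i * u.x₂ ^ j) =
      (D.χ₁ h ^ i * D.χ₂ h ^ j) • (u.x₁ ^ i * u.x₂ ^ j * u.G h) := by
  rw [← mul_assoc, comm_pow₁, smul_mul_assoc, mul_assoc, comm_pow₂, mul_smul_comm, smul_smul,
    mul_assoc]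

/-- The monomial map `x₁ⁱx₂ʲh ↦ x₁ⁱx₂ʲh`. -/
def mono (u : D.Rep P Q U) : D.Bos →ₗ[K] U :=
  TensorProduct.lift (D.lin fun i j =>
    LinearMap.mulLeft K (u.x₁ ^ i * u.x₂ ^ j) ∘ₗ (MonoidAlgebra.lift K U Γ u.G).toLinearMap)

lemma mono_bas (u : D.Rep P Q U) {i j : ℕ} (hi : i < D.r₁) (hj : j < D.r₂) (h : Γ) :
    u.mono (D.bas i j h) = u.x₁ ^ i * u.x₂ ^ j * u.G h := by
  simp [mono, bas, lin_mon D _ hi hj, mul_assoc]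

/-- The diagonal homomorphism `h ↦ h ⊗ h`. -/
def diagG (u : D.Rep P S U) (v : D.Rep S Q V) : Γ →* U ⊗[K] V where
  toFun h := u.G h ⊗ₜ v.G h
  map_one' := by simp [Algebra.TensorProduct.one_def]
  map_mul' h k := by simp

lemma diagG_apply (u : D.Rep P S U) (v : D.Rep S Q V) (h : Γ) :
    u.diagG v h = u.G h ⊗ₜ v.G h := rfl

/-- The tensor product of solutions, `h ↦ h ⊗ h` and `xᵢ ↦ xᵢ ⊗ 1 + gᵢ ⊗ xᵢ`. -/
def tensor (u : D.Rep P S U) (v : D.Rep S Q V) : D.Rep P Q (U ⊗[K] V) where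
  G := u.diagG v
  x₁ := u.x₁ ⊗ₜ 1 + u.G D.g₁ ⊗ₜ v.x₁
  x₂ := u.x₂ ⊗ₜ 1 + u.G D.g₂ ⊗ₜ v.x₂
  comm₁ h := by
    simp only [diagG_apply, mul_add, add_mul,
      Algebra.TensorProduct.tmul_mul_tmul, u.comm₁, v.comm₁, ← map_mul, one_mul, mul_one, smul_add,
      TensorProduct.smul_tmul', TensorProduct.tmul_smul, mul_comm h]
  comm₂ h := by
    simp only [diagG_apply, mul_add, add_mul,
      Algebra.TensorProduct.tmul_mul_tmul, u.comm₂, v.comm₂, ← map_mul, one_mul, mul_one, smul_add,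
      TensorProduct.smul_tmul', TensorProduct.tmul_smul, mul_comm h]
  pow₁ := by
    -- The summands skew-commute with factor χ₁(g₁), a primitive r₁-th root of unity, so only the
    -- two pure powers survive. Their contributions ∓S.c₁ g₁^r₁ ⊗ 1 cancel, which is why the middle
    -- parameter disappears.
    rw [pow_add_of_primitive D.two_le_r₁ D.prim₁]
    · simp only [diagG_apply, Algebra.TensorProduct.tmul_pow, u.pow₁, v.pow₁,
        ← map_pow, one_pow, Algebra.TensorProduct.one_def, TensorProduct.sub_tmul,
        TensorProduct.tmul_sub, TensorProduct.tmul_smul, ← TensorProduct.smul_tmul']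
      abel
    · simp [u.comm₁, TensorProduct.smul_tmul']
  pow₂ := by
    rw [pow_add_of_primitive D.two_le_r₂ D.prim₂]
    · simp only [diagG_apply, Algebra.TensorProduct.tmul_pow, u.pow₂, v.pow₂,
        ← map_pow, one_pow, Algebra.TensorProduct.one_def, TensorProduct.sub_tmul,
        TensorProduct.tmul_sub, TensorProduct.tmul_smul, ← TensorProduct.smul_tmul']
      abel
    · simp [u.comm₂, TensorProduct.smul_tmul']
  link := by
    -- The mixed terms, in which one generator sits on each side of ⊗, agree on both sides of the
    -- relation exactly because of the braiding condition.
    have hb : D.χ₁ D.g₂ * D.χ₂ D.g₁ = 1 := D.braid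
    simp only [diagG_apply,
      mul_add, add_mul, Algebra.TensorProduct.tmul_mul_tmul, one_mul, mul_one, u.comm₁,
      u.comm₂, u.link, v.link, ← map_mul, Algebra.TensorProduct.one_def, TensorProduct.sub_tmul,
      TensorProduct.add_tmul, TensorProduct.tmul_add,
      TensorProduct.tmul_sub, TensorProduct.tmul_smul, ← TensorProduct.smul_tmul',
      smul_add, smul_smul, hb, one_smul, mul_comm D.g₂ D.g₁]
    abel

/-- Expanding (x₁ ⊗ 1 + g₁ ⊗ x₁)ⁱ(x₂ ⊗ 1 + g₂ ⊗ x₂)ʲ by the q-binomial formula uses only the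
commutation with Γ. No power or linking relation enters, so the result is the comultiplication of A
for all parameters. -/
lemma mono_tensor (u : D.Rep P S U) (v : D.Rep S Q V) :
    (u.tensor v).mono = TensorProduct.map u.mono v.mono ∘ₗ D.nichols.radford.comul := by
  refine bos_ext fun i hi j hj h => ?_
  have h₁ : u.G D.g₁ ⊗ₜ v.x₁ * u.x₁ ⊗ₜ[K] 1 =
      D.χ₁ D.g₁ • (u.x₁ ⊗ₜ[K] 1 * u.G D.g₁ ⊗ₜ v.x₁) := by
    simp [u.comm₁, TensorProduct.smul_tmul']
  have h₂ : u.G D.g₂ ⊗ₜ v.x₂ * u.x₂ ⊗ₜ[K] 1 =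
      D.χ₂ D.g₂ • (u.x₂ ⊗ₜ[K] 1 * u.G D.g₂ ⊗ₜ v.x₂) := by
    simp [u.comm₂, TensorProduct.smul_tmul']
  rw [mono_bas _ hi hj, LinearMap.comp_apply, radford_comul_bas D hi hj]
  simp only [tensor, diagG_apply, pow_add_of_skew h₁, pow_add_of_skew h₂,
    Finset.sum_mul, Finset.mul_sum, map_sum, map_smul]
  rw [Finset.sum_comm]
  refine Finset.sum_congr rfl fun n hn => Finset.sum_congr rfl fun m hm => ?_
  have hn := Finset.mem_range.1 hn
  have hm := Finset.mem_range.1 hm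
  rw [TensorProduct.map_tmul, mono_bas _ (by omega) (by omega), mono_bas _ (by omega) (by omega)]
  simp only [Algebra.TensorProduct.tmul_pow, Algebra.TensorProduct.tmul_mul_tmul, one_pow, one_mul,
    smul_mul_assoc, mul_smul_comm, smul_smul, map_mul]
  -- Moving g₁^(i - n) past x₂ᵐ produces the factor χ₂(g₁)^((i - n)m) of the braided
  -- comultiplication.
  have : u.x₁ ^ n * u.G D.g₁ ^ (i - n) * (u.x₂ ^ m * u.G D.g₂ ^ (j - m)) * u.G h =
      D.χ₂ D.g₁ ^ ((i - n) * m) • (u.x₁ ^ n * u.x₂ ^ m *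
        (u.G D.g₁ ^ (i - n) * u.G D.g₂ ^ (j - m) * u.G h)) := by
    rw [mul_assoc (u.x₁ ^ n), ← mul_assoc (u.G D.g₁ ^ (i - n)) (u.x₂ ^ m), ← map_pow u.G,
      comm_pow₂]
    simp only [smul_mul_assoc, mul_smul_comm, mul_assoc, map_pow, pow_mul]
  simp only [map_pow, ← mul_assoc] at this ⊢
  rw [this, ← TensorProduct.smul_tmul', smul_smul]
  congr 1
  ring

/-! ### Leading coefficients -/

lemma G_ne_zero [Nontrivial U] (u : D.Rep P Q U) (h : Γ) : u.G h ≠ 0 := by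
  intro h0
  have : u.G h * u.G h⁻¹ = 1 := by rw [← map_mul]; simp
  simp [h0] at this

end Rep

/-- The monomial basis of `A`. -/
def basis : Module.Basis ((Fin D.r₁ × Fin D.r₂) × Γ) K D.Bos :=
  Module.Basis.tensorProduct Finsupp.basisSingleOne (MonoidAlgebra.basis Γ K)

lemma basis_apply (p : (Fin D.r₁ × Fin D.r₂) × Γ) : D.basis p = D.bas p.1.1 p.1.2 p.2 := by
  simp [basis, bas, Module.Basis.tensorProduct_apply', mon_of_lt D p.1.1.2 p.1.2.2]

open Classical in
lemma coord_bas (p : (Fin D.r₁ × Fin D.r₂) × Γ) {i j : ℕ} (hi : i < D.r₁) (hj : j < D.r₂) (h : Γ) :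
    D.basis.coord p (D.bas i j h) = if i = p.1.1 ∧ j = p.1.2 ∧ h = p.2 then 1 else 0 := by
  have := D.basis_apply ((⟨i, hi⟩, ⟨j, hj⟩), h)
  rw [← this, Module.Basis.coord_apply, Module.Basis.repr_self, Finsupp.single_apply]
  refine if_congr ?_ rfl rfl
  rw [Prod.ext_iff, Prod.ext_iff, Fin.ext_iff, Fin.ext_iff]
  tauto

/-- A nonzero coefficient of maximal degree. -/
lemma exists_leading {x : D.Bos} (hx : x ≠ 0) : ∃ p, D.basis.coord p x ≠ 0 ∧
    ∀ q, D.basis.coord q x ≠ 0 → (q.1.1 + q.1.2 : ℕ) ≤ p.1.1 + p.1.2 := by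
  have hne : (D.basis.repr x).support.Nonempty := by
    rw [Finsupp.support_nonempty_iff]
    simpa using hx
  obtain ⟨p, hp, hmax⟩ := Finset.exists_max_image _
    (fun q : (Fin D.r₁ × Fin D.r₂) × Γ => (q.1.1 + q.1.2 : ℕ)) hne
  exact ⟨p, by simpa using hp, fun q hq => hmax q (by simpa using hq)⟩

/-- A map that kills every other basis element of degree at most that of p sees only the
p-coefficient of an element whose degree does not exceed that of p. -/
lemma eq_smul_of_leading {M : Type*} [AddCommMonoid M] [Module K M] (T : D.Bos →ₗ[K] M)
    (p : (Fin D.r₁ × Fin D.r₂) × Γ) (y : M) {x : D.Bos}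
    (hmax : ∀ q, D.basis.coord q x ≠ 0 → (q.1.1 + q.1.2 : ℕ) ≤ p.1.1 + p.1.2)
    (hp : T (D.basis p) = y)
    (hT : ∀ q ≠ p, (q.1.1 + q.1.2 : ℕ) ≤ p.1.1 + p.1.2 → T (D.basis q) = 0) :
    T x = D.basis.coord p x • y := by
  classical
  conv_lhs => rw [← D.basis.linearCombination_repr x, Finsupp.linearCombination_apply, Finsupp.sum,
    map_sum]
  rw [Finset.sum_eq_single p]
  · simp [hp]
  · intro q hq hqp
    rw [map_smul, hT q hqp (hmax q (by simpa using hq)), smul_zero]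
  · intro h
    simp [Finsupp.notMem_support_iff.1 h]

-- The left factors of Δ(x₁ⁱx₂ʲh) have degree at most i + j, with equality only for the term x₁ⁱx₂ʲh
-- ⊗ h. So the coordinate of p on the left detects, among elements of no larger degree, only p
-- itself.
open Classical in
lemma comul_coord_left (p q : (Fin D.r₁ × Fin D.r₂) × Γ)
    (hq : (q.1.1 + q.1.2 : ℕ) ≤ p.1.1 + p.1.2) :
    (TensorProduct.lid K D.Bos) (TensorProduct.map (D.basis.coord p) LinearMap.id
      (D.nichols.radford.comul (D.basis q))) =
      if q = p then D.bas 0 0 p.2 else 0 := by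
  obtain ⟨⟨⟨i, hi⟩, ⟨j, hj⟩⟩, h⟩ := q
  obtain ⟨⟨⟨i', hi'⟩, ⟨j', hj'⟩⟩, h'⟩ := p
  simp only at hq
  simp only [basis_apply, radford_comul_bas D hi hj, map_sum, map_smul, TensorProduct.map_tmul,
    LinearMap.id_apply, TensorProduct.lid_tmul, Prod.mk.injEq, Fin.mk.injEq]
  have key : ∀ n ∈ Finset.range (i + 1), ∀ m ∈ Finset.range (j + 1),
      D.basis.coord ((⟨i', hi'⟩, ⟨j', hj'⟩), h')
        (D.bas n m (D.g₁ ^ (i - n) * D.g₂ ^ (j - m) * h)) =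
      if n = i ∧ m = j ∧ (i = i' ∧ j = j') ∧ h = h' then 1 else 0 := by
    intro n hn m hm
    have hn := Finset.mem_range.1 hn
    have hm := Finset.mem_range.1 hm
    rw [coord_bas D _ (by omega) (by omega)]
    refine if_congr ?_ rfl rfl
    constructor
    · rintro ⟨h1, h2, h3⟩
      simp only at h1 h2 h3
      obtain rfl : n = i := by omega
      obtain rfl : m = j := by omega
      simp_all
    · rintro ⟨rfl, rfl, ⟨rfl, rfl⟩, rfl⟩
      simp
  rw [Finset.sum_eq_single i, Finset.sum_eq_single j]
  · rw [key _ (by simp) _ (by simp)]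
    by_cases hc : (i = i' ∧ j = j') ∧ h = h'
    · simp [hc, qBinom_self]
    · simp [hc]
  · intro m hm hmj
    rw [key _ (by simp) _ hm]
    simp [hmj]
  · simp
  · intro n hn hni
    refine Finset.sum_eq_zero fun m hm => ?_
    rw [key _ hn _ hm]
    simp [hni]
  · simp

-- The mirror image: the only term whose right factor has full degree is g₁ⁱg₂ʲh ⊗ x₁ⁱx₂ʲh.
open Classical in
lemma comul_coord_right (p q : (Fin D.r₁ × Fin D.r₂) × Γ)
    (hq : (q.1.1 + q.1.2 : ℕ) ≤ p.1.1 + p.1.2) :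
    (TensorProduct.rid K D.Bos) (TensorProduct.map LinearMap.id (D.basis.coord p)
      (D.nichols.radford.comul (D.basis q))) =
      if q = p then D.bas 0 0 (D.g₁ ^ (p.1.1 : ℕ) * D.g₂ ^ (p.1.2 : ℕ) * p.2) else 0 := by
  obtain ⟨⟨⟨i, hi⟩, ⟨j, hj⟩⟩, h⟩ := q
  obtain ⟨⟨⟨i', hi'⟩, ⟨j', hj'⟩⟩, h'⟩ := p
  simp only at hq
  simp only [basis_apply, radford_comul_bas D hi hj, map_sum, map_smul, TensorProduct.map_tmul,
    LinearMap.id_apply, TensorProduct.rid_tmul, Prod.mk.injEq, Fin.mk.injEq]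
  have key : ∀ n ∈ Finset.range (i + 1), ∀ m ∈ Finset.range (j + 1),
      D.basis.coord ((⟨i', hi'⟩, ⟨j', hj'⟩), h') (D.bas (i - n) (j - m) h) =
      if n = 0 ∧ m = 0 ∧ (i = i' ∧ j = j') ∧ h = h' then 1 else 0 := by
    intro n hn m hm
    have hn := Finset.mem_range.1 hn
    have hm := Finset.mem_range.1 hm
    rw [coord_bas D _ (by omega) (by omega)]
    refine if_congr ?_ rfl rfl
    constructor
    · rintro ⟨h1, h2, h3⟩
      simp only at h1 h2 h3
      exact ⟨by omega, by omega, ⟨by omega, by omega⟩, h3⟩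
    · rintro ⟨rfl, rfl, ⟨rfl, rfl⟩, rfl⟩
      simp
  rw [Finset.sum_eq_single 0, Finset.sum_eq_single 0]
  · rw [key _ (by simp) _ (by simp)]
    by_cases hc : (i = i' ∧ j = j') ∧ h = h'
    · obtain ⟨⟨rfl, rfl⟩, rfl⟩ := hc
      simp [qBinom_zero_right]
    · simp [hc]
  · intro m hm hmj
    rw [key _ (by simp) _ hm]
    simp [hmj]
  · simp
  · intro n hn hni
    refine Finset.sum_eq_zero fun m hm => ?_
    rw [key _ hn _ hm]
    simp [hni]
  · simp

/-! ### Independence of monomials survives tensoring with a nonzero solution. -/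

namespace Rep

variable {D} {P Q S : Params K} {U V : Type*} [Ring U] [Algebra K U] [Ring V] [Algebra K V]

/-- By `mono_tensor` and flatness, an element x of the kernel satisfies (id ⊗ v)(Δx) = 0. Applying
the coordinate of a leading monomial x₁ⁱx₂ʲh of x on the left leaves its coefficient times v(h), and
v(h) is invertible in V ≠ 0. -/
lemma mono_tensor_injective_left [Nontrivial V] (u : D.Rep P S U) (v : D.Rep S Q V)
    (hu : Function.Injective u.mono) : Function.Injective (u.tensor v).mono := by
  refine (injective_iff_map_eq_zero _).2 fun x hx => ?_
  by_contra hne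
  obtain ⟨p, hp, hmax⟩ := exists_leading D hne
  have h0 : TensorProduct.map LinearMap.id v.mono (D.nichols.radford.comul x) = 0 := by
    apply Module.Flat.rTensor_preserves_injective_linearMap (M := V) u.mono hu
    rw [map_zero, ← hx, mono_tensor, LinearMap.comp_apply, LinearMap.rTensor,
      ← LinearMap.comp_apply, ← TensorProduct.map_comp]
    simp
  have h1 := eq_smul_of_leading D ((TensorProduct.lid K V).toLinearMap ∘ₗ
    TensorProduct.map (D.basis.coord p) v.mono ∘ₗ D.nichols.radford.comul) p (v.G p.2) hmax
  have hfac : ∀ y : D.Bos, TensorProduct.lid K V (TensorProduct.map (D.basis.coord p) v.mono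
      (D.nichols.radford.comul y)) = v.mono (TensorProduct.lid K D.Bos
        (TensorProduct.map (D.basis.coord p) LinearMap.id (D.nichols.radford.comul y))) := by
    intro y
    induction D.nichols.radford.comul y with
    | zero => simp
    | add a b ha hb => simp only [map_add, ha, hb]
    | tmul a b => simp
  have h2 : TensorProduct.lid K V (TensorProduct.map (D.basis.coord p) v.mono
      (D.nichols.radford.comul x)) = 0 := by
    have := congrArg (TensorProduct.map (D.basis.coord p) LinearMap.id) h0
    rw [← LinearMap.comp_apply, ← TensorProduct.map_comp] at this
    simp only [LinearMap.comp_id, LinearMap.id_comp, map_zero] at this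
    rw [this, map_zero]
  simp only [LinearMap.comp_apply, LinearEquiv.coe_coe, h2] at h1
  refine smul_ne_zero hp (v.G_ne_zero p.2) (h1 ?_ ?_).symm
  · rw [hfac, comul_coord_left D _ _ le_rfl, if_pos rfl, mono_bas _ D.r₁_pos D.r₂_pos]
    simp
  · intro q hqp hq
    rw [hfac, comul_coord_left D _ _ hq, if_neg hqp, map_zero]

/-- The argument of `mono_tensor_injective_left` with the coordinate applied on the right; what
remains is the leading coefficient times the invertible element u(g₁ⁱg₂ʲh). -/
lemma mono_tensor_injective_right [Nontrivial U] (u : D.Rep P S U) (v : D.Rep S Q V)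
    (hv : Function.Injective v.mono) : Function.Injective (u.tensor v).mono := by
  refine (injective_iff_map_eq_zero _).2 fun x hx => ?_
  by_contra hne
  obtain ⟨p, hp, hmax⟩ := exists_leading D hne
  have h0 : TensorProduct.map u.mono LinearMap.id (D.nichols.radford.comul x) = 0 := by
    apply Module.Flat.lTensor_preserves_injective_linearMap (M := U) v.mono hv
    rw [map_zero, ← hx, mono_tensor, LinearMap.comp_apply, LinearMap.lTensor,
      ← LinearMap.comp_apply, ← TensorProduct.map_comp]
    simp
  have h1 := eq_smul_of_leading D ((TensorProduct.rid K U).toLinearMap ∘ₗ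
    TensorProduct.map u.mono (D.basis.coord p) ∘ₗ D.nichols.radford.comul) p
      (u.G (D.g₁ ^ (p.1.1 : ℕ) * D.g₂ ^ (p.1.2 : ℕ) * p.2)) hmax
  have hfac : ∀ y : D.Bos, TensorProduct.rid K U (TensorProduct.map u.mono (D.basis.coord p)
      (D.nichols.radford.comul y)) = u.mono (TensorProduct.rid K D.Bos
        (TensorProduct.map LinearMap.id (D.basis.coord p) (D.nichols.radford.comul y))) := by
    intro y
    induction D.nichols.radford.comul y with
    | zero => simp
    | add a b ha hb => simp only [map_add, ha, hb]
    | tmul a b => simp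
  have h2 : TensorProduct.rid K U (TensorProduct.map u.mono (D.basis.coord p)
      (D.nichols.radford.comul x)) = 0 := by
    have := congrArg (TensorProduct.map LinearMap.id (D.basis.coord p)) h0
    rw [← LinearMap.comp_apply, ← TensorProduct.map_comp] at this
    simp only [LinearMap.comp_id, LinearMap.id_comp, map_zero] at this
    rw [this, map_zero]
  simp only [LinearMap.comp_apply, LinearEquiv.coe_coe, h2] at h1
  refine smul_ne_zero hp (u.G_ne_zero _) (h1 ?_ ?_).symm
  · rw [hfac, comul_coord_right D _ _ le_rfl, if_pos rfl, mono_bas _ D.r₁_pos D.r₂_pos]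
    simp
  · intro q hqp hq
    rw [hfac, comul_coord_right D _ _ hq, if_neg hqp, map_zero]

end Rep

end QuantumPlane

namespace QuantumPlane
open QPlane
variable {K Γ : Type*} [Field K] [CommGroup Γ] (D : QuantumPlane K Γ)

/-! ### The regular representation of `A` -/

/-- The action of `h ∈ Γ` on `A` by left multiplication. -/
def regG : Γ →* Module.End K D.Bos where
  toFun h := TensorProduct.map (D.rep h) (LinearMap.mulLeft K (MonoidAlgebra.of K Γ h))
  map_one' := by
    refine bos_ext fun i hi j hj k => ?_
    simp [bas]
  map_mul' h k := by
    refine bos_ext fun i hi j hj l => ?_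
    simp [bas, mul_assoc]

lemma rep_mon (g : Γ) (i j : ℕ) :
    D.rep g (D.mon i j) = (D.χ₁ g ^ i * D.χ₂ g ^ j) • D.mon i j := by
  simpa [nichols] using D.act_mon g i j

lemma regG_bas (h k : Γ) (i j : ℕ) :
    D.regG h (D.bas i j k) = (D.χ₁ h ^ i * D.χ₂ h ^ j) • D.bas i j (h * k) := by
  simp [regG, bas, rep_mon, TensorProduct.smul_tmul']

/-- Left multiplication by `x₁`. -/
def regX₁ : Module.End K D.Bos :=
  TensorProduct.map (D.nichols.mul ∘ₗ TensorProduct.mk K _ _ (D.mon 1 0)) LinearMap.id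

/-- Left multiplication by `x₂`. -/
def regX₂ : Module.End K D.Bos :=
  TensorProduct.map (D.nichols.mul ∘ₗ TensorProduct.mk K _ _ (D.mon 0 1)) LinearMap.id

lemma regX₁_bas (i j : ℕ) (k : Γ) : D.regX₁ (D.bas i j k) = D.bas (i + 1) j k := by
  simp [regX₁, bas, mul_mon, add_comm]

lemma regX₂_bas (i j : ℕ) (k : Γ) :
    D.regX₂ (D.bas i j k) = D.χ₁ D.g₂ ^ i • D.bas i (j + 1) k := by
  simp [regX₂, bas, mul_mon, add_comm, TensorProduct.smul_tmul']

lemma regX₁_pow_bas (n i j : ℕ) (k : Γ) : (D.regX₁ ^ n) (D.bas i j k) = D.bas (i + n) j k := by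
  induction n with
  | zero => simp
  | succ n ih => rw [pow_succ', Module.End.mul_apply, ih, regX₁_bas, add_assoc]

lemma regX₂_pow_bas (n i j : ℕ) (k : Γ) :
    (D.regX₂ ^ n) (D.bas i j k) = (D.χ₁ D.g₂ ^ i) ^ n • D.bas i (j + n) k := by
  induction n with
  | zero => simp
  | succ n ih =>
    rw [pow_succ', Module.End.mul_apply, ih, map_smul, regX₂_bas, add_assoc, smul_smul, ← pow_succ]

instance : Ring (Module.End K D.Bos) := Algebra.semiringToRing K

/-- `A` acting on itself by left multiplication. -/
def reg : D.Rep 0 0 (Module.End K D.Bos) where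
  G := D.regG
  x₁ := D.regX₁
  x₂ := D.regX₂
  comm₁ h := bos_ext fun i hi j hj k => by
    simp only [Module.End.mul_apply, LinearMap.smul_apply, regX₁_bas, regG_bas, map_smul, smul_smul]
    congr 1
    ring
  comm₂ h := bos_ext fun i hi j hj k => by
    simp only [Module.End.mul_apply, LinearMap.smul_apply, regX₂_bas, regG_bas, map_smul, smul_smul]
    congr 1
    ring
  pow₁ := bos_ext fun i hi j hj k => by
    rw [regX₁_pow_bas, bas_eq_zero D (by omega)]
    simp
  pow₂ := bos_ext fun i hi j hj k => by
    rw [regX₂_pow_bas, bas_eq_zero D (by omega)]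
    simp
  link := bos_ext fun i hi j hj k => by
    simp only [Module.End.mul_apply, LinearMap.smul_apply, regX₁_bas, regX₂_bas,
      map_smul, smul_smul, Params.zero_c₁₂, zero_smul, sub_zero, add_zero]
    congr 1
    ring

/-- Evaluating at 1 recovers an element from its left multiplication, so the regular solution has
independent monomials. -/
lemma mono_reg_apply (x : D.Bos) : D.reg.mono x (D.bas 0 0 1) = x := by
  suffices (LinearMap.applyₗ (D.bas 0 0 1)) ∘ₗ D.reg.mono = LinearMap.id from
    LinearMap.congr_fun this x
  refine bos_ext fun i hi j hj k => ?_
  simp [Rep.mono_bas, hi, hj, reg, regG_bas, regX₂_pow_bas, regX₁_pow_bas]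

lemma mono_reg_injective : Function.Injective D.reg.mono :=
  fun x y h => by rw [← D.mono_reg_apply x, h, D.mono_reg_apply]

/-! ### Nontrivial solutions -/

/-- The operator `x₁ⁱx₂ʲ ↦ x₁ⁱ⁺¹x₂ʲ`, with `x₁ ^ r₁ = a`. -/
def shift₁ (a : K) : Module.End K D.Nic :=
  D.lin fun i j => if i + 1 < D.r₁ then D.mon (i + 1) j else a • D.mon 0 j

/-- The operator `x₁ⁱx₂ʲ ↦ x₁ⁱx₂ʲ⁺¹`, with `x₂ ^ r₂ = a`. -/
def shift₂ (a : K) : Module.End K D.Nic :=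
  D.lin fun i j => if j + 1 < D.r₂ then D.mon i (j + 1) else a • D.mon i 0

/-- The operator `x₁ⁱx₂ʲ ↦ pⁱ x₁ⁱx₂ʲ`. -/
def scale₁ (p : K) : Module.End K D.Nic := D.lin fun i j => p ^ i • D.mon i j

/-- The `p`-derivative `x₁ⁱx₂ʲ ↦ (i)_p x₁ⁱ⁻¹x₂ʲ`. -/
def deriv₁ (p : K) : Module.End K D.Nic := D.lin fun i j => qNat p i • D.mon (i - 1) j

variable {D} in
lemma shift₁_pow_mon (a : K) {n j : ℕ} (hn : n < D.r₁) (hj : j < D.r₂) :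
    (D.shift₁ a ^ n) (D.mon 0 j) = D.mon n j := by
  induction n with
  | zero => simp
  | succ n ih =>
    rw [pow_succ', Module.End.mul_apply, ih (by omega), shift₁, lin_mon D _ (by omega) hj,
      if_pos hn]

variable {D} in
lemma shift₂_pow_mon (a : K) {n i : ℕ} (hn : n < D.r₂) (hi : i < D.r₁) :
    (D.shift₂ a ^ n) (D.mon i 0) = D.mon i n := by
  induction n with
  | zero => simp
  | succ n ih =>
    rw [pow_succ', Module.End.mul_apply, ih (by omega), shift₂, lin_mon D _ hi (by omega),
      if_pos hn]

/-- On x₁⁰x₂ʲ the first r₁ - 1 steps climb to the top power of x₁ and the last one wraps around with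
the factor a. Every other monomial is a power of the shift applied to such an element, and powers
commute. -/
lemma shift₁_pow (a : K) : D.shift₁ a ^ D.r₁ = a • 1 := by
  refine nic_ext fun i hi j hj => ?_
  have h0 : (D.shift₁ a ^ D.r₁) (D.mon 0 j) = a • D.mon 0 j := by
    obtain ⟨n, hn⟩ : ∃ n, n + 1 = D.r₁ := ⟨D.r₁ - 1, by omega⟩
    rw [show D.shift₁ a ^ D.r₁ = D.shift₁ a ^ (n + 1) by rw [hn], pow_succ', Module.End.mul_apply, shift₁_pow_mon a (by omega) hj, shift₁,
      lin_mon D _ (by omega) hj, if_neg (by omega)]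
  rw [← shift₁_pow_mon a hi hj, ← Module.End.mul_apply, ← pow_add, add_comm, pow_add,
    Module.End.mul_apply, h0]
  simp

lemma shift₂_pow (a : K) : D.shift₂ a ^ D.r₂ = a • 1 := by
  refine nic_ext fun i hi j hj => ?_
  have h0 : (D.shift₂ a ^ D.r₂) (D.mon i 0) = a • D.mon i 0 := by
    obtain ⟨n, hn⟩ : ∃ n, n + 1 = D.r₂ := ⟨D.r₂ - 1, by omega⟩
    rw [show D.shift₂ a ^ D.r₂ = D.shift₂ a ^ (n + 1) by rw [hn], pow_succ', Module.End.mul_apply, shift₂_pow_mon a (by omega) hi, shift₂,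
      lin_mon D _ hi (by omega), if_neg (by omega)]
  rw [← shift₂_pow_mon a hj hi, ← Module.End.mul_apply, ← pow_add, add_comm, pow_add,
    Module.End.mul_apply, h0]
  simp

variable {D}

lemma scale₁_mon (p : K) {i j : ℕ} (hi : i < D.r₁) (hj : j < D.r₂) :
    D.scale₁ p (D.mon i j) = p ^ i • D.mon i j := lin_mon D _ hi hj

lemma deriv₁_mon (p : K) {i j : ℕ} (hi : i < D.r₁) (hj : j < D.r₂) :
    D.deriv₁ p (D.mon i j) = qNat p i • D.mon (i - 1) j := lin_mon D _ hi hj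

lemma shift₁_mon (a : K) {i j : ℕ} (hi : i < D.r₁) (hj : j < D.r₂) :
    D.shift₁ a (D.mon i j) = if i + 1 < D.r₁ then D.mon (i + 1) j else a • D.mon 0 j :=
  lin_mon D _ hi hj

lemma shift₂_mon (a : K) {i j : ℕ} (hi : i < D.r₁) (hj : j < D.r₂) :
    D.shift₂ a (D.mon i j) = if j + 1 < D.r₂ then D.mon i (j + 1) else a • D.mon i 0 :=
  lin_mon D _ hi hj

lemma scale₁_pow (p : K) (n : ℕ) : D.scale₁ p ^ n = D.scale₁ (p ^ n) := by
  refine nic_ext fun i hi j hj => ?_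
  induction n with
  | zero => simp [scale₁_mon, hi, hj]
  | succ n ih =>
    rw [pow_succ, Module.End.mul_apply, scale₁_mon p hi hj, map_smul, ih, scale₁_mon _ hi hj,
      scale₁_mon _ hi hj, smul_smul]
    congr 1
    ring

lemma scale₁_one : D.scale₁ 1 = 1 := nic_ext fun i hi j hj => by simp [scale₁_mon, hi, hj]

lemma deriv₁_pow (p : K) : D.deriv₁ p ^ D.r₁ = 0 := by
  have : ∀ n i j, i < n → i < D.r₁ → j < D.r₂ → (D.deriv₁ p ^ n) (D.mon i j) = 0 := by
    intro n
    induction n with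
    | zero => intro i j h; omega
    | succ n ih =>
      intro i j h hi hj
      rw [pow_succ, Module.End.mul_apply, deriv₁_mon p hi hj, map_smul]
      obtain rfl | h0 := Nat.eq_zero_or_pos i
      · simp [qNat]
      · rw [ih _ _ (by omega) (by omega) hj, smul_zero]
  exact nic_ext fun i hi j hj => by simpa using this _ i j hi hi hj

lemma shift₂_commute_scale₁ (a p : K) : Commute (D.shift₂ a) (D.scale₁ p) := by
  refine nic_ext fun i hi j hj => ?_
  simp only [Module.End.mul_apply, scale₁_mon p hi hj, map_smul, shift₂_mon a hi hj]
  split_ifs with h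
  · rw [scale₁_mon p hi h]
  · rw [map_smul, scale₁_mon p hi D.r₂_pos, smul_comm]

lemma shift₂_commute_deriv₁ (a p : K) : Commute (D.shift₂ a) (D.deriv₁ p) := by
  refine nic_ext fun i hi j hj => ?_
  simp only [Module.End.mul_apply, deriv₁_mon p hi hj, map_smul, shift₂_mon a hi hj,
    shift₂_mon a (show i - 1 < D.r₁ by omega) hj]
  split_ifs with h
  · rw [deriv₁_mon p hi h]
  · rw [map_smul, deriv₁_mon p hi D.r₂_pos, smul_comm]

lemma shift₂_commute_shift₁ (a b : K) : Commute (D.shift₂ a) (D.shift₁ b) := by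
  refine nic_ext fun i hi j hj => ?_
  simp only [Module.End.mul_apply, shift₁_mon b hi hj, shift₂_mon a hi hj]
  split_ifs with h h' h'
  · rw [shift₂_mon a h hj, shift₁_mon b hi h', if_pos h', if_pos h]
  · rw [shift₂_mon a h hj, map_smul, shift₁_mon b hi D.r₂_pos, if_neg h', if_pos h]
  · rw [map_smul, shift₂_mon a D.r₁_pos hj, shift₁_mon b hi h', if_pos h', if_neg h]
  · rw [map_smul, map_smul, shift₂_mon a D.r₁_pos hj, shift₁_mon b hi D.r₂_pos, if_neg h',
      if_neg h, smul_comm]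

/-- The condition p^r₁ = 1 is needed only where the shift wraps around with a nonzero factor, from
x₁^(r₁ - 1) to x₁⁰. -/
lemma scale₁_mul_shift₁ {p b : K} (hb : b ≠ 0 → p ^ D.r₁ = 1) :
    D.scale₁ p * D.shift₁ b = p • (D.shift₁ b * D.scale₁ p) := by
  refine nic_ext fun i hi j hj => ?_
  simp only [Module.End.mul_apply, LinearMap.smul_apply, shift₁_mon b hi hj, scale₁_mon p hi hj,
    map_smul]
  split_ifs with h
  · rw [scale₁_mon p h hj, smul_smul, pow_succ']
  · rw [map_smul, scale₁_mon p D.r₁_pos hj]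
    by_cases h0 : b = 0
    · simp [h0]
    · rw [smul_smul, smul_smul, smul_smul, ← pow_succ', show i + 1 = D.r₁ by omega, hb h0]
      simp

lemma deriv₁_mul_scale₁ (p : K) :
    D.deriv₁ p * D.scale₁ p = p • (D.scale₁ p * D.deriv₁ p) := by
  refine nic_ext fun i hi j hj => ?_
  simp only [Module.End.mul_apply, LinearMap.smul_apply, deriv₁_mon p hi hj, scale₁_mon p hi hj,
    map_smul, scale₁_mon p (show i - 1 < D.r₁ by omega) hj, smul_smul]
  obtain rfl | h0 := Nat.eq_zero_or_pos i
  · simp [qNat]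
  · congr 1
    obtain ⟨i, rfl⟩ : ∃ m, i = m + 1 := ⟨i - 1, by omega⟩
    simp
    ring

/-- Below the top degree this is (i + 1)_p = p(i)_p + 1. At i = r₁ - 1 the wrapped term is killed by
the derivative, and the identity holds because (r₁)_p = 0. -/
lemma deriv₁_mul_shift₁ {p : K} (b : K) (hp : IsPrimitiveRoot p D.r₁) :
    D.deriv₁ p * D.shift₁ b = p • (D.shift₁ b * D.deriv₁ p) + 1 := by
  have hq : ∀ n, qNat p (n + 1) = p * qNat p n + 1 := fun n => by
    rw [add_comm n, qNat_add]; simp [qNat, add_comm]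
  refine nic_ext fun i hi j hj => ?_
  simp only [Module.End.mul_apply, LinearMap.smul_apply, LinearMap.add_apply, shift₁_mon b hi hj,
    deriv₁_mon p hi hj, map_smul, shift₁_mon b (show i - 1 < D.r₁ by omega) hj,
    Module.End.one_apply]
  have e : qNat p i • D.mon (i - 1 + 1) j = qNat p i • D.mon i j := by
    obtain rfl | h0 := Nat.eq_zero_or_pos i
    · simp [qNat]
    · rw [Nat.sub_add_cancel h0]
  have h' : i - 1 + 1 < D.r₁ := by have := D.two_le_r₁; omega
  rw [if_pos h', e]
  split_ifs with h
  · rw [deriv₁_mon p h hj, hq, add_smul, smul_smul]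
    simp
  · have h0 : p * qNat p i + 1 = 0 := by
      rw [← hq, show i + 1 = D.r₁ by omega]
      exact hp.geom_sum_eq_zero (by have := D.two_le_r₁; omega)
    rw [map_smul, deriv₁_mon p D.r₁_pos hj, smul_smul]
    have h1 := congrArg (· • D.mon i j) h0
    simp only [add_smul, one_smul, zero_smul] at h1
    rw [smul_smul, h1]
    simp [qNat]

variable (D) in
/-- Operators with `X₁ ^ r₁ = a₁`, `X₂ ^ r₂ = a₂` and `X₂ X₁ = p X₁ X₂ + a`. -/
lemma exists_weyl {p a₁ a₂ a : K} (h₁ : a₁ ≠ 0 → p ^ D.r₁ = 1) (h₂ : a₂ ≠ 0 → p ^ D.r₂ = 1)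
    (h : a ≠ 0 → D.r₁ = D.r₂ ∧ IsPrimitiveRoot p D.r₁) :
    ∃ X₁ X₂ : Module.End K D.Nic, X₁ ^ D.r₁ = a₁ • 1 ∧ X₂ ^ D.r₂ = a₂ • 1 ∧
      X₂ * X₁ = p • (X₁ * X₂) + a • 1 := by
  have hS : (D.shift₂ a₂ * D.scale₁ p) ^ D.r₂ = a₂ • 1 := by
    rw [(shift₂_commute_scale₁ a₂ p).mul_pow, shift₂_pow, scale₁_pow]
    by_cases h0 : a₂ = 0
    · simp [h0]
    · rw [h₂ h0, scale₁_one, mul_one]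
  -- The first summand of X₂ q-commutes with X₁, and the p-derivative contributes the constant a.
  -- These two summands skew-commute with each other with factor p and the derivative is nilpotent,
  -- so for a ≠ 0 the r₂-th power of X₂ is still a₂.
  refine ⟨D.shift₁ a₁, D.shift₂ a₂ * D.scale₁ p + a • D.deriv₁ p, D.shift₁_pow a₁, ?_, ?_⟩
  · by_cases h0 : a = 0
    · simpa [h0] using hS
    · obtain ⟨hr, hp⟩ := h h0
      rw [hr] at hp
      rw [pow_add_of_primitive (A := Module.End K D.Nic) D.two_le_r₂ hp, hS, smul_pow,
        show D.deriv₁ p ^ D.r₂ = D.deriv₁ p ^ D.r₁ from congrArg (D.deriv₁ p ^ ·) hr.symm,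
        deriv₁_pow, smul_zero, add_zero]
      rw [smul_mul_assoc, mul_smul_comm, smul_comm p a, ← mul_assoc,
        ← (shift₂_commute_deriv₁ a₂ p).eq, mul_assoc, deriv₁_mul_scale₁, mul_smul_comm, mul_assoc]
  · rw [add_mul, mul_add, mul_assoc, scale₁_mul_shift₁ h₁, mul_smul_comm, ← mul_assoc,
      (shift₂_commute_shift₁ a₂ a₁).eq, mul_assoc, smul_add, add_assoc]
    congr 1
    by_cases h0 : a = 0
    · simp [h0]
    · rw [smul_mul_assoc, deriv₁_mul_shift₁ a₁ (h h0).2, smul_add, mul_smul_comm, smul_comm]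

/-- The operator `f ↦ (k ↦ χ(k) X f(gk))` on functions. -/
def funOp (X : Module.End K D.Nic) (χ : Γ →* K) (g : Γ) : Module.End K (Γ → D.Nic) where
  toFun f k := χ k • X (f (g * k))
  map_add' f f' := by ext1 k; simp
  map_smul' c f := by ext1 k; simp [smul_comm c]

lemma funOp_apply (X : Module.End K D.Nic) (χ : Γ →* K) (g : Γ) (f : Γ → D.Nic) (k : Γ) :
    funOp X χ g f k = χ k • X (f (g * k)) := rfl

/-- The character is evaluated at k, gk, …, gⁿ⁻¹k in turn, which yields χ(g) to the power 0 + 1 + ⋯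
+ (n - 1). -/
lemma funOp_pow_apply (X : Module.End K D.Nic) (χ : Γ →* K) (g : Γ) (n : ℕ) (f : Γ → D.Nic)
    (k : Γ) : (funOp X χ g ^ n) f k =
      (χ g ^ n.choose 2 * χ k ^ n) • (X ^ n) (f (g ^ n * k)) := by
  induction n generalizing f with
  | zero => simp
  | succ n ih =>
    rw [pow_succ, Module.End.mul_apply, ih, funOp_apply, map_smul, smul_smul, pow_succ X,
      Module.End.mul_apply, ← mul_assoc, ← pow_succ', map_mul, map_pow,
      Nat.choose_succ_succ' n 1, Nat.choose_one_right]
    congr 1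
    ring

variable (D) in
/-- The translations `f ↦ (k ↦ f(hk))`. -/
def transl : Γ →* Module.End K (Γ → D.Nic) where
  toFun h := { toFun := fun f k => f (h * k), map_add' := fun _ _ => rfl, map_smul' := fun _ _ => rfl }
  map_one' := by ext1 f; ext1 k; simp
  map_mul' h h' := by
    refine LinearMap.ext fun f => funext fun k => ?_
    change f (h * h' * k) = f (h' * (h * k))
    rw [mul_comm h, mul_assoc]

lemma transl_apply (h : Γ) (f : Γ → D.Nic) (k : Γ) : D.transl h f k = f (h * k) := rfl

variable (D) in
/-- The conditions on the characters that make the deformed relations consistent. -/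
structure Admissible (P : Params K) : Prop where
  cond₁ : P.c₁ ≠ 0 → D.χ₁ ^ D.r₁ = 1
  cond₂ : P.c₂ ≠ 0 → D.χ₂ ^ D.r₂ = 1
  cond₁₂ : P.c₁₂ ≠ 0 → D.χ₁ * D.χ₂ = 1

lemma admissible_zero : D.Admissible 0 := ⟨by simp, by simp, by simp⟩

lemma char_apply_ne_zero (χ : Γ →* K) (g : Γ) : χ g ≠ 0 := by
  intro h
  have : χ g * χ g⁻¹ = 1 := by rw [← map_mul]; simp
  simp [h] at this

/-- Comparing χ₁(g₂)χ₂(g₁) = 1 with χ₁(g₁)χ₂(g₁) = 1 gives the first claim. Then χ₂(g₂) is the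
inverse of χ₁(g₁), and the two have the same order. -/
lemma χ_link (h : D.χ₁ * D.χ₂ = 1) : D.χ₁ D.g₂ = D.χ₁ D.g₁ ∧ D.r₁ = D.r₂ := by
  have h1 : ∀ g, D.χ₁ g * D.χ₂ g = 1 := fun g => DFunLike.congr_fun h g
  have h2 : D.χ₁ D.g₂ = D.χ₁ D.g₁ := by
    refine mul_right_cancel₀ (char_apply_ne_zero D.χ₂ D.g₁) ?_
    rw [D.braid, h1]
  refine ⟨h2, ?_⟩
  have h3 : D.χ₂ D.g₂ = (D.χ₁ D.g₁)⁻¹ := by rw [← h2]; exact eq_inv_of_mul_eq_one_right (h1 _)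
  have := D.prim₂
  rw [h3] at this
  exact D.prim₁.inv.unique this

/-! ### Nonzero solutions of the relations with Q = 0 or with P = 0. -/

namespace Admissible

variable {P : Params K}

lemma pow₁ (hP : D.Admissible P) (g : Γ) (h : P.c₁ ≠ 0) : D.χ₁ g ^ D.r₁ = 1 := by
  simpa using DFunLike.congr_fun (hP.cond₁ h) g

lemma pow₂ (hP : D.Admissible P) (g : Γ) (h : P.c₂ ≠ 0) : D.χ₂ g ^ D.r₂ = 1 := by
  simpa using DFunLike.congr_fun (hP.cond₂ h) g

lemma mul₁₂ (hP : D.Admissible P) (g : Γ) (h : P.c₁₂ ≠ 0) : D.χ₁ g * D.χ₂ g = 1 := by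
  simpa using DFunLike.congr_fun (hP.cond₁₂ h) g

lemma pow₂' (hP : D.Admissible P) (h : P.c₂ ≠ 0) : D.χ₁ D.g₂ ^ D.r₂ = 1 := by
  rw [eq_inv_of_mul_eq_one_left D.braid, inv_pow, hP.pow₂ _ h, inv_one]

lemma prim (hP : D.Admissible P) (h : P.c₁₂ ≠ 0) : D.r₁ = D.r₂ ∧ IsPrimitiveRoot (D.χ₁ D.g₂) D.r₁ := by
  obtain ⟨h1, h2⟩ := χ_link (hP.cond₁₂ h)
  exact ⟨h2, h1 ▸ D.prim₁⟩

/-- On functions Γ → R, let Γ act by translation and xᵢ by f ↦ (k ↦ χᵢ(k) Xᵢ f(k)). The factor χᵢ(k)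
gives the commutation with Γ, and the conditions on the characters make its contribution to each
constant term trivial. -/
lemma exists_rep_left (hP : D.Admissible P) :
    Nonempty (D.Rep P 0 (Module.End K (Γ → D.Nic))) := by
  obtain ⟨X₁, X₂, h₁, h₂, h⟩ := D.exists_weyl (hP.pow₁ D.g₂) hP.pow₂' hP.prim
  refine ⟨⟨D.transl, funOp X₁ D.χ₁ 1, funOp X₂ D.χ₂ 1, ?_, ?_, ?_, ?_, ?_⟩⟩
  · intro g
    refine LinearMap.ext fun f => funext fun k => ?_
    simp [funOp_apply, transl_apply, smul_smul]
  · intro g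
    refine LinearMap.ext fun f => funext fun k => ?_
    simp [funOp_apply, transl_apply, smul_smul]
  · refine LinearMap.ext fun f => funext fun k => ?_
    by_cases h0 : P.c₁ = 0
    · simp [funOp_pow_apply, h₁, h0]
    · simp [funOp_pow_apply, h₁, hP.pow₁ k h0]
  · refine LinearMap.ext fun f => funext fun k => ?_
    by_cases h0 : P.c₂ = 0
    · simp [funOp_pow_apply, h₂, h0]
    · simp [funOp_pow_apply, h₂, hP.pow₂ k h0]
  · refine LinearMap.ext fun f => funext fun k => ?_
    have := LinearMap.congr_fun h (f k)
    simp only [Module.End.mul_apply, LinearMap.add_apply, LinearMap.smul_apply,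
      Module.End.one_apply] at this
    simp only [Module.End.mul_apply, LinearMap.add_apply, LinearMap.smul_apply, Pi.add_apply,
      Pi.smul_apply, funOp_apply, one_mul, map_smul, this, smul_add, smul_smul,
      LinearMap.sub_apply, Pi.sub_apply, Module.End.one_apply, Params.zero_c₁₂, zero_smul]
    congr 1
    · congr 1; ring
    · by_cases h0 : P.c₁₂ = 0
      · simp [h0]
      · have := hP.mul₁₂ k h0
        simp only [LinearMap.zero_apply, Pi.zero_apply, sub_zero]
        congr 1
        linear_combination P.c₁₂ * this

/-- Here xᵢ also translates by gᵢ, so that xᵢ ^ rᵢ and the constant in the linking relation carry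
the translations by gᵢ ^ rᵢ and g₁g₂ which these relations demand. -/
lemma exists_rep_right (hP : D.Admissible P) :
    Nonempty (D.Rep 0 P (Module.End K (Γ → D.Nic))) := by
  have hp := char_apply_ne_zero D.χ₁ D.g₂
  have hq₁ := pow_ne_zero (D.r₁.choose 2) (char_apply_ne_zero D.χ₁ D.g₁)
  have hq₂ := pow_ne_zero (D.r₂.choose 2) (char_apply_ne_zero D.χ₂ D.g₂)
  -- The constants undo what the translations contribute: χᵢ(gᵢ)^(rᵢ choose 2) in the powers, and
  -- χ₁(g₂) in x₂x₁ against χ₂(g₁) = χ₁(g₂)⁻¹ in x₁x₂. The latter turns the commutation factor into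
  -- χ₁(g₂)⁻¹.
  obtain ⟨X₁, X₂, h₁, h₂, h⟩ := D.exists_weyl (p := (D.χ₁ D.g₂)⁻¹)
    (a₁ := - (D.χ₁ D.g₁ ^ D.r₁.choose 2)⁻¹ * P.c₁) (a₂ := - (D.χ₂ D.g₂ ^ D.r₂.choose 2)⁻¹ * P.c₂)
    (a := - (D.χ₁ D.g₂)⁻¹ * P.c₁₂)
    (fun h => by rw [inv_pow, hP.pow₁ _ (right_ne_zero_of_mul h), inv_one])
    (fun h => by rw [inv_pow, hP.pow₂' (right_ne_zero_of_mul h), inv_one])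
    (fun h => ⟨(hP.prim (right_ne_zero_of_mul h)).1, (hP.prim (right_ne_zero_of_mul h)).2.inv⟩)
  refine ⟨⟨D.transl, funOp X₁ D.χ₁ D.g₁, funOp X₂ D.χ₂ D.g₂, ?_, ?_, ?_, ?_, ?_⟩⟩
  · intro g
    refine LinearMap.ext fun f => funext fun k => ?_
    simp [funOp_apply, transl_apply, smul_smul, mul_left_comm]
  · intro g
    refine LinearMap.ext fun f => funext fun k => ?_
    simp [funOp_apply, transl_apply, smul_smul, mul_left_comm]
  · refine LinearMap.ext fun f => funext fun k => ?_
    by_cases h0 : P.c₁ = 0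
    · simp [funOp_pow_apply, h₁, h0]
    · simp [funOp_pow_apply, h₁, hP.pow₁ k h0, transl_apply, smul_smul, mul_inv_cancel_left₀ hq₁,
        -map_pow]
  · refine LinearMap.ext fun f => funext fun k => ?_
    by_cases h0 : P.c₂ = 0
    · simp [funOp_pow_apply, h₂, h0]
    · simp [funOp_pow_apply, h₂, hP.pow₂ k h0, transl_apply, smul_smul, mul_inv_cancel_left₀ hq₂,
        -map_pow]
  · refine LinearMap.ext fun f => funext fun k => ?_
    have := LinearMap.congr_fun h (f (D.g₁ * (D.g₂ * k)))
    simp only [Module.End.mul_apply, LinearMap.add_apply, LinearMap.smul_apply,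
      Module.End.one_apply] at this
    simp only [Module.End.mul_apply, LinearMap.add_apply, LinearMap.smul_apply, Pi.add_apply,
      Pi.smul_apply, funOp_apply, map_smul, this, smul_add, smul_smul, map_mul, transl_apply,
      LinearMap.sub_apply, Pi.sub_apply, Params.zero_c₁₂, zero_smul, mul_left_comm D.g₂ D.g₁, mul_assoc]
    congr 1
    · congr 1
      rw [eq_inv_of_mul_eq_one_right D.braid]
      field_simp
    · by_cases h0 : P.c₁₂ = 0
      · simp [h0]
      · have := hP.mul₁₂ k h0
        simp only [LinearMap.zero_apply, Pi.zero_apply, zero_sub, ← neg_smul]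
        congr 1
        field_simp
        linear_combination -this

end Admissible

/-- This makes the function-space solutions nonzero, which is all that the tensor argument asks of
them. -/
instance : Nontrivial D.Nic :=
  ⟨⟨D.mon 0 0, 0, by rw [mon_of_lt D D.r₁_pos D.r₂_pos]; simp⟩⟩

end QuantumPlane

namespace QuantumPlane
open QPlane
variable {K Γ : Type*} [Field K] [CommGroup Γ] (D : QuantumPlane K Γ)

/-! ### The filtration by the bidegree -/

/-- The bidegrees that the deformed relations can lower to `(0, 0)`. -/
def Drop (P Q : Params K) (a b : ℕ) : Prop :=
  ∃ s t n : ℕ, a = s * D.r₁ + n ∧ b = t * D.r₂ + n ∧ (s ≠ 0 → P.c₁ ≠ 0 ∨ Q.c₁ ≠ 0) ∧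
    (t ≠ 0 → P.c₂ ≠ 0 ∨ Q.c₂ ≠ 0) ∧ (n ≠ 0 → P.c₁₂ ≠ 0 ∨ Q.c₁₂ ≠ 0)

namespace Drop

variable {D} {P Q : Params K} {a b : ℕ}

lemma zero : D.Drop P Q 0 0 := ⟨0, 0, 0, by simp⟩

lemma add₁ (h : D.Drop P Q a b) (hc : P.c₁ ≠ 0 ∨ Q.c₁ ≠ 0) : D.Drop P Q (D.r₁ + a) b := by
  obtain ⟨s, t, n, rfl, rfl, h1, h2, h3⟩ := h
  exact ⟨s + 1, t, n, by ring, rfl, fun _ => hc, h2, h3⟩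

lemma add₂ (h : D.Drop P Q a b) (hc : P.c₂ ≠ 0 ∨ Q.c₂ ≠ 0) : D.Drop P Q a (D.r₂ + b) := by
  obtain ⟨s, t, n, rfl, rfl, h1, h2, h3⟩ := h
  exact ⟨s, t + 1, n, rfl, by ring, h1, fun _ => hc, h3⟩

lemma add₁₂ (h : D.Drop P Q a b) (hc : P.c₁₂ ≠ 0 ∨ Q.c₁₂ ≠ 0) :
    D.Drop P Q (a + 1) (b + 1) := by
  obtain ⟨s, t, n, rfl, rfl, h1, h2, h3⟩ := h
  exact ⟨s, t, n + 1, by ring, by ring, h1, h2, fun _ => hc⟩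

end Drop

namespace Rep

variable {D} {P Q : Params K} {U : Type*} [Ring U] [Algebra K U] (u : D.Rep P Q U)

/-- The span of the monomials to which the relations can reduce the bidegree `(a, b)`. -/
def fil (a b : ℕ) : Submodule K U :=
  Submodule.span K {z | ∃ i j a' b' h, i < D.r₁ ∧ j < D.r₂ ∧ a = i + a' ∧ b = j + b' ∧
    D.Drop P Q a' b' ∧ z = u.x₁ ^ i * u.x₂ ^ j * u.G h}

variable {u}

lemma mem_fil {i j a b : ℕ} (hi : i < D.r₁) (hj : j < D.r₂) (h : D.Drop P Q a b) (g : Γ) :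
    u.x₁ ^ i * u.x₂ ^ j * u.G g ∈ u.fil (i + a) (j + b) :=
  Submodule.subset_span ⟨i, j, a, b, g, hi, hj, rfl, rfl, h, rfl⟩

lemma fil_le_comap {a b : ℕ} {S : Submodule K U} {f : U →ₗ[K] U}
    (h : ∀ i j a' b' g, i < D.r₁ → j < D.r₂ → a = i + a' → b = j + b' → D.Drop P Q a' b' →
      f (u.x₁ ^ i * u.x₂ ^ j * u.G g) ∈ S) {w : U} (hw : w ∈ u.fil a b) : f w ∈ S := by
  refine (Submodule.span_le (p := S.comap f)).2 ?_ hw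
  rintro _ ⟨i, j, a', b', g, hi, hj, ha, hb, hd, rfl⟩
  exact h i j a' b' g hi hj ha hb hd

lemma G_mul_mem_fil {a b : ℕ} (h : Γ) {w : U} (hw : w ∈ u.fil a b) : u.G h * w ∈ u.fil a b := by
  refine fil_le_comap (f := LinearMap.mulLeft K (u.G h)) (fun i j a' b' g hi hj ha hb hd => ?_) hw
  subst ha hb
  rw [LinearMap.mulLeft_apply, ← mul_assoc, comm_mon, smul_mul_assoc, mul_assoc _ (u.G h),
    ← map_mul]
  exact Submodule.smul_mem _ _ (mem_fil hi hj hd _)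

/-- Either the exponent of x₁ stays below r₁, or x₁^r₁ is replaced by a scalar plus a multiple of a
group element. In the second case the lost degree r₁ is recorded by `Drop.add₁`, and only if one of
the coefficients is nonzero. -/
lemma x₁_mul_mem_fil {a b : ℕ} {w : U} (hw : w ∈ u.fil a b) : u.x₁ * w ∈ u.fil (a + 1) b := by
  refine fil_le_comap (f := LinearMap.mulLeft K u.x₁) (fun i j a' b' g hi hj ha hb hd => ?_) hw
  subst ha hb
  rw [LinearMap.mulLeft_apply, ← mul_assoc, ← mul_assoc, ← pow_succ']
  by_cases h : i + 1 < D.r₁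
  · rw [add_right_comm]
    exact mem_fil h hj hd g
  · obtain hr : i + 1 = D.r₁ := by omega
    have key : (P.c₁ ≠ 0 ∨ Q.c₁ ≠ 0) → u.x₂ ^ j * u.G g ∈ u.fil (i + a' + 1) (j + b') := by
      intro hc
      have := mem_fil (u := u) D.r₁_pos hj (hd.add₁ hc) g
      rwa [pow_zero, one_mul, ← hr, show 0 + (i + 1 + a') = i + a' + 1 by ring] at this
    rw [hr, u.pow₁, mul_assoc, sub_mul, smul_mul_assoc, smul_mul_assoc, one_mul]
    refine Submodule.sub_mem _ ?_ ?_
    · by_cases h0 : P.c₁ = 0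
      · simp [h0]
      · exact Submodule.smul_mem _ _ (key (.inl h0))
    · by_cases h0 : Q.c₁ = 0
      · simp [h0]
      · exact Submodule.smul_mem _ _ (G_mul_mem_fil _ (key (.inr h0)))

/-- Induction on the power of x₁ that x₂ must cross: each crossing either q-commutes or loses
bidegree (1, 1) through the linking relation. Once it has crossed, x₂ may complete an r₂-th power.
-/
lemma x₂_mul_mem_fil {a b : ℕ} {w : U} (hw : w ∈ u.fil a b) : u.x₂ * w ∈ u.fil a (b + 1) := by
  refine fil_le_comap (f := LinearMap.mulLeft K u.x₂) (fun i j a' b' g hi hj ha hb hd => ?_) hw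
  subst ha hb
  rw [LinearMap.mulLeft_apply, mul_assoc]
  -- The membership mentions i; left in the context it would become a premise of the induction
  -- hypothesis.
  clear hw
  induction i with
  | zero =>
    rw [pow_zero, one_mul, ← mul_assoc, ← pow_succ']
    by_cases h : j + 1 < D.r₂
    · have := mem_fil (u := u) hi h hd g
      rwa [pow_zero, one_mul, add_right_comm] at this
    · obtain hr : j + 1 = D.r₂ := by omega
      have key : (P.c₂ ≠ 0 ∨ Q.c₂ ≠ 0) → u.G g ∈ u.fil (0 + a') (j + b' + 1) := by
        intro hc
        have := mem_fil (u := u) hi D.r₂_pos (hd.add₂ hc) g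
        rwa [pow_zero, pow_zero, one_mul, one_mul, ← hr,
          show 0 + (j + 1 + b') = j + b' + 1 by ring] at this
      rw [hr, u.pow₂, sub_mul, smul_mul_assoc, smul_mul_assoc, one_mul]
      refine Submodule.sub_mem _ ?_ ?_
      · by_cases h0 : P.c₂ = 0
        · simp [h0]
        · exact Submodule.smul_mem _ _ (key (.inl h0))
      · by_cases h0 : Q.c₂ = 0
        · simp [h0]
        · exact Submodule.smul_mem _ _ (G_mul_mem_fil _ (key (.inr h0)))
  | succ i ih =>
    have key : (P.c₁₂ ≠ 0 ∨ Q.c₁₂ ≠ 0) →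
        u.x₁ ^ i * (u.x₂ ^ j * u.G g) ∈ u.fil (i + 1 + a') (j + b' + 1) := by
      intro hc
      have := mem_fil (u := u) (show i < D.r₁ by omega) hj (hd.add₁₂ hc) g
      rwa [mul_assoc, show i + (a' + 1) = i + 1 + a' by ring] at this
    rw [pow_succ', mul_assoc u.x₁, ← mul_assoc u.x₂, u.link, add_mul, sub_mul, smul_mul_assoc,
      smul_mul_assoc, smul_mul_assoc, one_mul, mul_assoc u.x₁]
    refine Submodule.add_mem _ (Submodule.smul_mem _ _ ?_) (Submodule.sub_mem _ ?_ ?_)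
    · rw [add_right_comm]
      exact x₁_mul_mem_fil (ih (by omega))
    · by_cases h0 : P.c₁₂ = 0
      · simp [h0]
      · exact Submodule.smul_mem _ _ (key (.inl h0))
    · by_cases h0 : Q.c₁₂ = 0
      · simp [h0]
      · exact Submodule.smul_mem _ _ (G_mul_mem_fil _ (key (.inr h0)))

lemma mon_mul_mem_fil (i j : ℕ) {a b : ℕ} {w : U} (hw : w ∈ u.fil a b) :
    u.x₁ ^ i * u.x₂ ^ j * w ∈ u.fil (a + i) (b + j) := by
  have h2 : ∀ j, u.x₂ ^ j * w ∈ u.fil a (b + j) := by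
    intro j
    induction j with
    | zero => simpa using hw
    | succ j ih => rw [pow_succ', mul_assoc, ← add_assoc]; exact x₂_mul_mem_fil ih
  induction i with
  | zero => simpa using h2 j
  | succ i ih =>
    rw [pow_succ', mul_assoc, mul_assoc, ← mul_assoc (u.x₁ ^ i), ← add_assoc]
    exact x₁_mul_mem_fil ih

lemma mono_mul_mono_mem_fil {i j k l : ℕ} (hi : i < D.r₁) (hj : j < D.r₂) (hk : k < D.r₁)
    (hl : l < D.r₂) (h h' : Γ) :
    u.mono (D.bas i j h) * u.mono (D.bas k l h') ∈ u.fil (k + i) (l + j) := by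
  rw [mono_bas _ hi hj, mono_bas _ hk hl, mul_assoc _ (u.G h)]
  exact mon_mul_mem_fil i j (G_mul_mem_fil h (mem_fil hk hl Drop.zero h'))

lemma mono_mem_fil {i j : ℕ} (hi : i < D.r₁) (hj : j < D.r₂) (h : Γ) :
    u.mono (D.bas i j h) ∈ u.fil i j := by
  rw [mono_bas _ hi hj]
  exact mem_fil hi hj Drop.zero h

lemma fil_le_range (a b : ℕ) : u.fil a b ≤ LinearMap.range u.mono := by
  refine Submodule.span_le.2 ?_
  rintro _ ⟨i, j, a', b', g, hi, hj, -, -, -, rfl⟩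
  exact ⟨_, mono_bas _ hi hj g⟩

lemma mul_mem_range {y : U} (hy : ∀ i < D.r₁, ∀ j < D.r₂, ∀ h,
    y * u.mono (D.bas i j h) ∈ LinearMap.range u.mono) {w : U}
    (hw : w ∈ LinearMap.range u.mono) : y * w ∈ LinearMap.range u.mono := by
  obtain ⟨x, rfl⟩ := hw
  have : (⊤ : Submodule K D.Bos) ≤
      (LinearMap.range u.mono).comap (LinearMap.mulLeft K y ∘ₗ u.mono) := by
    rw [← D.basis.span_eq, Submodule.span_le]
    rintro _ ⟨p, rfl⟩
    rw [basis_apply]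
    exact hy _ p.1.1.2 _ p.1.2.2 _
  exact this (Submodule.mem_top (x := x))

end Rep

/-! ### The universal solution -/

/-- The deformed relations. -/
inductive CogRel (P Q : Params K) : FreeAlgebra K (Gen Γ) → FreeAlgebra K (Gen Γ) → Prop
  | one : CogRel P Q (fr K (.grp 1)) 1
  | mul (h k : Γ) : CogRel P Q (fr K (.grp h) * fr K (.grp k)) (fr K (.grp (h * k)))
  | comm₁ (h : Γ) : CogRel P Q (fr K (.grp h) * fr K .x₁) (D.χ₁ h • (fr K .x₁ * fr K (.grp h)))
  | comm₂ (h : Γ) : CogRel P Q (fr K (.grp h) * fr K .x₂) (D.χ₂ h • (fr K .x₂ * fr K (.grp h)))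
  | pow₁ : CogRel P Q (fr K .x₁ ^ D.r₁) (P.c₁ • 1 - Q.c₁ • fr K (.grp (D.g₁ ^ D.r₁)))
  | pow₂ : CogRel P Q (fr K .x₂ ^ D.r₂) (P.c₂ • 1 - Q.c₂ • fr K (.grp (D.g₂ ^ D.r₂)))
  | link : CogRel P Q (fr K .x₂ * fr K .x₁)
      (D.χ₁ D.g₂ • (fr K .x₁ * fr K .x₂) + (P.c₁₂ • 1 - Q.c₁₂ • fr K (.grp (D.g₁ * D.g₂))))

/-- The algebra defined by the deformed relations. -/
def Cog (P Q : Params K) : Type _ := RingQuot (D.CogRel P Q)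

namespace Cog

variable (P Q : Params K)

instance : Ring (D.Cog P Q) := inferInstanceAs (Ring (RingQuot (D.CogRel P Q)))

instance : Algebra K (D.Cog P Q) := inferInstanceAs (Algebra K (RingQuot (D.CogRel P Q)))

/-- The quotient map from the free algebra. -/
def mk : FreeAlgebra K (Gen Γ) →ₐ[K] D.Cog P Q := RingQuot.mkAlgHom K (D.CogRel P Q)

variable {P Q} in
lemma mk_rel {x y : FreeAlgebra K (Gen Γ)} (h : D.CogRel P Q x y) :
    mk D P Q x = mk D P Q y :=
  RingQuot.mkAlgHom_rel K h

lemma mk_surjective : Function.Surjective (mk D P Q) := RingQuot.mkAlgHom_surjective K _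

/-- The universal solution of the deformed relations. -/
def univ : D.Rep P Q (D.Cog P Q) where
  G :=
    { toFun := fun h => mk D P Q (fr K (.grp h))
      map_one' := by rw [mk_rel D .one, map_one]
      map_mul' := fun h k => by rw [← mk_rel D (.mul h k), map_mul] }
  x₁ := mk D P Q (fr K .x₁)
  x₂ := mk D P Q (fr K .x₂)
  comm₁ h := by simpa using mk_rel D (CogRel.comm₁ (D := D) (P := P) (Q := Q) h)
  comm₂ h := by simpa using mk_rel D (CogRel.comm₂ (D := D) (P := P) (Q := Q) h)
  pow₁ := by simpa using mk_rel D (CogRel.pow₁ (D := D) (P := P) (Q := Q))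
  pow₂ := by simpa using mk_rel D (CogRel.pow₂ (D := D) (P := P) (Q := Q))
  link := by simpa using mk_rel D (CogRel.link (D := D) (P := P) (Q := Q))

end Cog

namespace Rep

variable {D} {P Q : Params K} {U V W : Type*} [Ring U] [Algebra K U] [Ring V] [Algebra K V]
  [Ring W] [Algebra K W]

/-- The values of a solution on the generators. -/
def val (u : D.Rep P Q U) : Gen Γ → U
  | .grp h => u.G h
  | .x₁ => u.x₁
  | .x₂ => u.x₂

lemma val_rel (u : D.Rep P Q U) ⦃x y : FreeAlgebra K (Gen Γ)⦄ (h : D.CogRel P Q x y) :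
    FreeAlgebra.lift K u.val x = FreeAlgebra.lift K u.val y := by
  cases h with
  | one => simp [val]
  | mul h k => simp [val]
  | comm₁ h => simpa [val] using u.comm₁ h
  | comm₂ h => simpa [val] using u.comm₂ h
  | pow₁ => simpa [val] using u.pow₁
  | pow₂ => simpa [val] using u.pow₂
  | link => simpa [val] using u.link

/-- The homomorphism from the universal algebra given by a solution. -/
def lift (u : D.Rep P Q U) : D.Cog P Q →ₐ[K] U :=
  RingQuot.liftAlgHom K ⟨FreeAlgebra.lift K u.val, u.val_rel⟩

lemma lift_mk (u : D.Rep P Q U) (s : Gen Γ) : u.lift (Cog.mk D P Q (fr K s)) = u.val s :=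
  (RingQuot.liftAlgHom_mkAlgHom_apply K _ u.val_rel _).trans (by simp)

lemma lift_G (u : D.Rep P Q U) (h : Γ) : u.lift ((Cog.univ D P Q).G h) = u.G h := u.lift_mk _

lemma lift_x₁ (u : D.Rep P Q U) : u.lift (Cog.univ D P Q).x₁ = u.x₁ := u.lift_mk _

lemma lift_x₂ (u : D.Rep P Q U) : u.lift (Cog.univ D P Q).x₂ = u.x₂ := u.lift_mk _

lemma lift_mono (u : D.Rep P Q U) : u.lift.toLinearMap ∘ₗ (Cog.univ D P Q).mono = u.mono :=
  bos_ext fun i hi j hj h => by simp [mono_bas _ hi hj, lift_G, lift_x₁, lift_x₂]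

/-- One solution with independent monomials suffices, since its monomials are the images of the
universal ones. -/
lemma mono_univ_injective (u : D.Rep P Q U) (hu : Function.Injective u.mono) :
    Function.Injective (Cog.univ D P Q).mono := by
  rw [← u.lift_mono, LinearMap.coe_comp] at hu
  exact hu.of_comp

/-- A solution for (P, 0) and one for (0, Q) enclose one for (0, 0), which alone has to have
independent monomials. -/
lemma mono_univ_injective_of_tensor [Nontrivial U] [Nontrivial V] (u : D.Rep P 0 U)
    (w : D.Rep 0 0 W) (v : D.Rep 0 Q V) (hw : Function.Injective w.mono) :
    Function.Injective (Cog.univ D P Q).mono :=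
  (u.tensor (w.tensor v)).mono_univ_injective
    (mono_tensor_injective_right _ _ (mono_tensor_injective_left _ _ hw))

end Rep

/-! ### The monomial basis of the universal algebra. -/

namespace Cog

/-- The span of the monomials contains 1 and is stable under left multiplication by each generator,
by the filtration lemmas; hence it is everything. -/
lemma mono_surjective (P Q : Params K) : Function.Surjective (univ D P Q).mono := by
  have key : ∀ z, ∀ w ∈ LinearMap.range (univ D P Q).mono,
      mk D P Q z * w ∈ LinearMap.range (univ D P Q).mono := by
    intro z
    induction z using FreeAlgebra.induction with
    | grade0 r =>
      intro w hw
      rw [AlgHom.commutes, ← Algebra.smul_def]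
      exact Submodule.smul_mem _ _ hw
    | grade1 s =>
      intro w hw
      refine Rep.mul_mem_range (fun i hi j hj h => ?_) hw
      have h0 := Rep.mono_mem_fil (u := univ D P Q) hi hj h
      cases s with
      | grp g => exact Rep.fil_le_range _ _ (Rep.G_mul_mem_fil g h0)
      | x₁ => exact Rep.fil_le_range _ _ (Rep.x₁_mul_mem_fil h0)
      | x₂ => exact Rep.fil_le_range _ _ (Rep.x₂_mul_mem_fil h0)
    | mul x y hx hy =>
      intro w hw
      rw [map_mul, mul_assoc]
      exact hx _ (hy _ hw)
    | add x y hx hy =>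
      intro w hw
      rw [map_add, add_mul]
      exact Submodule.add_mem _ (hx _ hw) (hy _ hw)
  intro z
  obtain ⟨z, rfl⟩ := mk_surjective D P Q z
  have h1 : (1 : D.Cog P Q) ∈ LinearMap.range (univ D P Q).mono :=
    ⟨D.bas 0 0 1, by simp [Rep.mono_bas _ D.r₁_pos D.r₂_pos]⟩
  simpa using key z 1 h1

variable {D} {P Q : Params K}

lemma mono_injective (hP : D.Admissible P) (hQ : D.Admissible Q) :
    Function.Injective (univ D P Q).mono := by
  obtain ⟨u⟩ := hP.exists_rep_left
  obtain ⟨v⟩ := hQ.exists_rep_right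
  exact Rep.mono_univ_injective_of_tensor u D.reg v D.mono_reg_injective

end Cog

end QuantumPlane

/-! ### The right counit law on a tensor square. -/

namespace QPlane.BialgData

variable {K A : Type*} [Field K] [AddCommMonoid A] [Module K A] (S : BialgData K A)

lemma counit₂_comul₂_right (h : ∀ x, TensorProduct.rid K A
    (TensorProduct.map LinearMap.id S.counit (S.comul x)) = x) (z : A ⊗[K] A) :
    TensorProduct.rid K (A ⊗[K] A) (TensorProduct.map LinearMap.id S.counit₂ (S.comul₂ z)) = z := by
  have key : ∀ X Y : A ⊗[K] A, TensorProduct.rid K (A ⊗[K] A) (TensorProduct.map LinearMap.id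
      S.counit₂ (TensorProduct.tensorTensorTensorComm K A A A A (X ⊗ₜ Y))) =
      TensorProduct.rid K A (TensorProduct.map LinearMap.id S.counit X) ⊗ₜ
        TensorProduct.rid K A (TensorProduct.map LinearMap.id S.counit Y) := by
    intro X Y
    induction X with
    | zero => simp
    | add a b ha hb => simp only [TensorProduct.add_tmul, map_add, ha, hb]
    | tmul a b =>
      induction Y with
      | zero => simp
      | add c d hc hd => simp only [TensorProduct.tmul_add, map_add, hc, hd]
      | tmul c d =>
        simp [counit₂, TensorProduct.smul_tmul', TensorProduct.tmul_smul, smul_smul, mul_comm]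
  induction z with
  | zero => simp
  | add a b ha hb => simp only [map_add, ha, hb]
  | tmul x y => simp only [comul₂, LinearMap.comp_apply, TensorProduct.map_tmul,
      LinearEquiv.coe_coe, key, h]

end QPlane.BialgData

namespace QuantumPlane
open QPlane
variable {K Γ : Type*} [Field K] [CommGroup Γ] (D : QuantumPlane K Γ)

/-! ### The lifting as a solution -/

namespace Lifting

variable (a₁ a₂ a : K)

/-- The generators of the lifting. -/
def sol : D.Rep ⟨a₁, a₂, a⟩ ⟨a₁, a₂, a⟩ (D.Lifting a₁ a₂ a) where
  G :=
    { toFun := fun h => gen D a₁ a₂ a (.grp h)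
      map_one' := gen_one D a₁ a₂ a
      map_mul' := fun h k => (gen_mul D a₁ a₂ a h k).symm }
  x₁ := gen D a₁ a₂ a .x₁
  x₂ := gen D a₁ a₂ a .x₂
  comm₁ := gen_comm₁ D a₁ a₂ a
  comm₂ := gen_comm₂ D a₁ a₂ a
  pow₁ := by rw [gen_pow₁, smul_sub]; rfl
  pow₂ := by rw [gen_pow₂, smul_sub]; rfl
  link := by rw [gen_link, smul_sub]; rfl

lemma val_rel ⦃x y : FreeAlgebra K (Gen Γ)⦄ (h : D.Rel a₁ a₂ a x y) :
    FreeAlgebra.lift K (Cog.univ D ⟨a₁, a₂, a⟩ ⟨a₁, a₂, a⟩).val x =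
      FreeAlgebra.lift K (Cog.univ D ⟨a₁, a₂, a⟩ ⟨a₁, a₂, a⟩).val y := by
  cases h with
  | one => simp [Rep.val]
  | mul h k => simp [Rep.val]
  | comm₁ h => simpa [Rep.val] using Rep.comm₁ _ h
  | comm₂ h => simpa [Rep.val] using Rep.comm₂ _ h
  | pow₁ => simpa [Rep.val, smul_sub] using Rep.pow₁ (Cog.univ D ⟨a₁, a₂, a⟩ ⟨a₁, a₂, a⟩)
  | pow₂ => simpa [Rep.val, smul_sub] using Rep.pow₂ (Cog.univ D ⟨a₁, a₂, a⟩ ⟨a₁, a₂, a⟩)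
  | link => simpa [Rep.val, smul_sub] using Rep.link (Cog.univ D ⟨a₁, a₂, a⟩ ⟨a₁, a₂, a⟩)

/-- The comparison of the lifting with the universal solution. -/
def toCog : D.Lifting a₁ a₂ a →ₐ[K] D.Cog ⟨a₁, a₂, a⟩ ⟨a₁, a₂, a⟩ :=
  RingQuot.liftAlgHom K ⟨FreeAlgebra.lift K (Cog.univ D ⟨a₁, a₂, a⟩ ⟨a₁, a₂, a⟩).val,
    val_rel D a₁ a₂ a⟩

lemma toCog_gen (s : Gen Γ) :
    toCog D a₁ a₂ a (gen D a₁ a₂ a s) = (Cog.univ D ⟨a₁, a₂, a⟩ ⟨a₁, a₂, a⟩).val s :=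
  (RingQuot.liftAlgHom_mkAlgHom_apply K _ (val_rel D a₁ a₂ a) _).trans (by simp)

/-- The lifting is E(P, P) with its relations written differently. This one composite is enough to
transfer the basis. -/
lemma lift_comp_toCog : (sol D a₁ a₂ a).lift.comp (toCog D a₁ a₂ a) = AlgHom.id K _ := by
  refine hom_ext D fun s => ?_
  rw [AlgHom.comp_apply, toCog_gen]
  cases s with
  | grp h => exact Rep.lift_G _ h
  | x₁ => exact Rep.lift_x₁ _
  | x₂ => exact Rep.lift_x₂ _

lemma toCog_mono : (toCog D a₁ a₂ a).toLinearMap ∘ₗ (sol D a₁ a₂ a).mono =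
    (Cog.univ D ⟨a₁, a₂, a⟩ ⟨a₁, a₂, a⟩).mono :=
  bos_ext fun i hi j hj h => by
    simp [Rep.mono_bas _ hi hj, sol, toCog_gen, Rep.val]

lemma mono_bijective (h : D.Admissible ⟨a₁, a₂, a⟩) :
    Function.Bijective (sol D a₁ a₂ a).mono := by
  constructor
  · have := Cog.mono_injective h h
    rw [← toCog_mono, LinearMap.coe_comp] at this
    exact this.of_comp
  · rw [← Rep.lift_mono, LinearMap.coe_comp]
    refine Function.Surjective.comp (fun x => ⟨toCog D a₁ a₂ a x, ?_⟩) (Cog.mono_surjective D _ _)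
    exact DFunLike.congr_fun (lift_comp_toCog D a₁ a₂ a) x

lemma comul_gen (s : Gen Γ) :
    Coalgebra.comul (R := K) (gen D a₁ a₂ a s) = comulGen D a₁ a₂ a s := comulHom_gen D a₁ a₂ a s

lemma counit_gen (s : Gen Γ) :
    Coalgebra.counit (R := K) (gen D a₁ a₂ a s) = counitGen s := counitHom_gen D a₁ a₂ a s

/-- The comultiplication sends the generators to those of the tensor square of the solution, so
`mono_tensor` computes it on all monomials. -/
lemma comul_mono (x : D.Bos) : Coalgebra.comul (R := K) ((sol D a₁ a₂ a).mono x) =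
    TensorProduct.map (sol D a₁ a₂ a).mono (sol D a₁ a₂ a).mono (D.nichols.radford.comul x) := by
  rw [← LinearMap.comp_apply (TensorProduct.map _ _), ← Rep.mono_tensor,
    ← LinearMap.comp_apply Coalgebra.comul]
  refine LinearMap.congr_fun (bos_ext fun i hi j hj h => ?_) x
  simp [Rep.mono_bas _ hi hj, Rep.tensor, Rep.diagG_apply, sol, comul_gen, comulGen]

lemma counit_mono (x : D.Bos) : Coalgebra.counit (R := K) ((sol D a₁ a₂ a).mono x) =
    D.nichols.radford.counit x := by
  rw [← LinearMap.comp_apply Coalgebra.counit]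
  refine LinearMap.congr_fun (bos_ext fun i hi j hj h => ?_) x
  rw [LinearMap.comp_apply, Rep.mono_bas _ hi hj, radford_counit_bas D hi hj]
  simp only [sol, Bialgebra.counit_mul, Bialgebra.counit_pow, counit_gen, counitGen,
    MonoidHom.coe_mk, OneHom.coe_mk, mul_one]
  rcases Nat.eq_zero_or_pos i with rfl | hi0
  · rcases Nat.eq_zero_or_pos j with rfl | hj0
    · simp
    · simp [hj0.ne']
  · simp [hi0.ne']

end Lifting

/-! ### The coalgebra `A` -/

/-- The coalgebra axioms of A, here and in the next two lemmas, are those of the lifting with zero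
parameters, carried over by the monomial map, which respects Δ and ε and is injective. -/
lemma counit_comul_left (x : D.Bos) : TensorProduct.lid K D.Bos
    (TensorProduct.map D.nichols.radford.counit LinearMap.id (D.nichols.radford.comul x)) = x := by
  apply (Lifting.mono_bijective D 0 0 0 admissible_zero).1
  have h := congrArg (TensorProduct.lid K _)
    (Coalgebra.rTensor_counit_comul (R := K) ((Lifting.sol D 0 0 0).mono x))
  rw [Lifting.comul_mono, TensorProduct.lid_tmul, one_smul] at h
  rw [← h]
  induction D.nichols.radford.comul x with
  | zero => simp
  | add a b ha hb => simp only [map_add, ha, hb]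
  | tmul a b => simp [Lifting.counit_mono]

lemma counit_comul_right (x : D.Bos) : TensorProduct.rid K D.Bos
    (TensorProduct.map LinearMap.id D.nichols.radford.counit (D.nichols.radford.comul x)) = x := by
  apply (Lifting.mono_bijective D 0 0 0 admissible_zero).1
  have h := congrArg (TensorProduct.rid K _)
    (Coalgebra.lTensor_counit_comul (R := K) ((Lifting.sol D 0 0 0).mono x))
  rw [Lifting.comul_mono, TensorProduct.rid_tmul, one_smul] at h
  rw [← h]
  induction D.nichols.radford.comul x with
  | zero => simp
  | add a b ha hb => simp only [map_add, ha, hb]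
  | tmul a b => simp [Lifting.counit_mono]

lemma coassoc_radford (x : D.Bos) : TensorProduct.assoc K D.Bos D.Bos D.Bos
    (TensorProduct.map D.nichols.radford.comul LinearMap.id (D.nichols.radford.comul x)) =
    TensorProduct.map LinearMap.id D.nichols.radford.comul (D.nichols.radford.comul x) := by
  have hinj := (Lifting.mono_bijective D 0 0 0 admissible_zero).1
  have h := Coalgebra.coassoc_apply (R := K) ((Lifting.sol D 0 0 0).mono x)
  rw [Lifting.comul_mono] at h
  let μ := (Lifting.sol D 0 0 0).mono
  apply TensorProduct.map_injective_of_flat_flat μ (TensorProduct.map μ μ) hinj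
    (TensorProduct.map_injective_of_flat_flat μ μ hinj hinj)
  have h1 : ∀ X : D.Bos ⊗[K] D.Bos, TensorProduct.map μ (TensorProduct.map μ μ)
      (TensorProduct.assoc K _ _ _ (TensorProduct.map D.nichols.radford.comul LinearMap.id X)) =
      TensorProduct.assoc K _ _ _ (Coalgebra.comul.rTensor _ (TensorProduct.map μ μ X)) := by
    intro X
    induction X with
    | zero => simp
    | add a b ha hb => simp only [map_add, ha, hb]
    | tmul a b =>
      simp only [TensorProduct.map_tmul, LinearMap.rTensor_tmul, LinearMap.id_apply, μ,
        Lifting.comul_mono]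
      induction D.nichols.radford.comul a with
      | zero => simp
      | add a b ha hb => simp only [map_add, ha, hb, TensorProduct.add_tmul]
      | tmul a b => simp
  have h2 : ∀ X : D.Bos ⊗[K] D.Bos, TensorProduct.map μ (TensorProduct.map μ μ)
      (TensorProduct.map LinearMap.id D.nichols.radford.comul X) =
      Coalgebra.comul.lTensor _ (TensorProduct.map μ μ X) := by
    intro X
    induction X with
    | zero => simp
    | add a b ha hb => simp only [map_add, ha, hb]
    | tmul a b => simp [μ, Lifting.comul_mono]
  rw [h1, h2]
  exact h

/-! ### The multiplications on `A` -/

/-- The admissible parameters. -/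
abbrev Par : Type _ := {P : Params K // D.Admissible P}

variable {D}

/-- The identification of the bases of `A` and of the universal algebra. -/
def toCog (P Q : D.Par) : D.Bos ≃ₗ[K] D.Cog P.1 Q.1 :=
  LinearEquiv.ofBijective (Cog.univ D P.1 Q.1).mono
    ⟨Cog.mono_injective P.2 Q.2, Cog.mono_surjective D _ _⟩

lemma toCog_apply (P Q : D.Par) (x : D.Bos) : toCog P Q x = (Cog.univ D P.1 Q.1).mono x := rfl

lemma toCog_toLinearMap (P Q : D.Par) :
    (toCog P Q).toLinearMap = (Cog.univ D P.1 Q.1).mono := rfl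

/-- The multiplication of the universal algebra, transported to `A`. -/
def cmul (P Q : D.Par) : D.Bos ⊗[K] D.Bos →ₗ[K] D.Bos :=
  (toCog P Q).symm.toLinearMap ∘ₗ LinearMap.mul' K (D.Cog P.1 Q.1) ∘ₗ
    TensorProduct.map (toCog P Q).toLinearMap (toCog P Q).toLinearMap

lemma toCog_cmul (P Q : D.Par) (x y : D.Bos) :
    toCog P Q (cmul P Q (x ⊗ₜ y)) = toCog P Q x * toCog P Q y := by
  simp [cmul]

lemma cmul_assoc (P Q : D.Par) (x y z : D.Bos) :
    cmul P Q (cmul P Q (x ⊗ₜ y) ⊗ₜ z) = cmul P Q (x ⊗ₜ cmul P Q (y ⊗ₜ z)) := by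
  apply (toCog P Q).injective
  simp only [toCog_cmul, mul_assoc]

lemma toCog_one (P Q : D.Par) : toCog P Q (D.bas 0 0 1) = 1 := by
  simp [toCog_apply, Rep.mono_bas _ D.r₁_pos D.r₂_pos]

lemma cmul_one (P Q : D.Par) (x : D.Bos) : cmul P Q (x ⊗ₜ D.bas 0 0 1) = x := by
  apply (toCog P Q).injective
  rw [toCog_cmul, toCog_one, mul_one]

lemma one_cmul (P Q : D.Par) (x : D.Bos) : cmul P Q (D.bas 0 0 1 ⊗ₜ x) = x := by
  apply (toCog P Q).injective
  rw [toCog_cmul, toCog_one, one_mul]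

/-- The central identity. The algebra map E(P, Q) → E(P, S) ⊗ E(S, Q) is Δ in the monomial bases,
and its multiplicativity is this statement. The middle parameter S is free. -/
lemma comul_cmul (P S Q : D.Par) (z : D.Bos ⊗[K] D.Bos) :
    D.nichols.radford.comul (cmul P Q z) =
      TensorProduct.map (cmul P S) (cmul S Q) (D.nichols.radford.comul₂ z) := by
  have hδ : ∀ x : D.Bos, ((Cog.univ D P.1 S.1).tensor (Cog.univ D S.1 Q.1)).lift (toCog P Q x) =
      TensorProduct.map (toCog P S).toLinearMap (toCog S Q).toLinearMap
        (D.nichols.radford.comul x) := by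
    intro x
    have := LinearMap.congr_fun ((Cog.univ D P.1 S.1).tensor (Cog.univ D S.1 Q.1)).lift_mono x
    rw [Rep.mono_tensor] at this
    exact this
  have hmul : ∀ X Y : D.Bos ⊗[K] D.Bos,
      TensorProduct.map (toCog P S).toLinearMap (toCog S Q).toLinearMap
        (TensorProduct.map (cmul P S) (cmul S Q)
          (TensorProduct.tensorTensorTensorComm K _ _ _ _ (X ⊗ₜ Y))) =
      TensorProduct.map (toCog P S).toLinearMap (toCog S Q).toLinearMap X *
        TensorProduct.map (toCog P S).toLinearMap (toCog S Q).toLinearMap Y := by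
    intro X Y
    induction X with
    | zero => simp
    | add a b ha hb => simp only [TensorProduct.add_tmul, map_add, ha, hb, add_mul]
    | tmul a b =>
      induction Y with
      | zero => simp
      | add c d hc hd => simp only [TensorProduct.tmul_add, map_add, hc, hd, mul_add]
      | tmul c d => simp [toCog_cmul]
  induction z with
  | zero => simp
  | add a b ha hb => simp only [map_add, ha, hb]
  | tmul x y =>
    apply (TensorProduct.congr (toCog P S) (toCog S Q)).injective
    change TensorProduct.map (toCog P S).toLinearMap (toCog S Q).toLinearMap _ =
      TensorProduct.map (toCog P S).toLinearMap (toCog S Q).toLinearMap _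
    rw [← hδ, toCog_cmul, map_mul, hδ, hδ, BialgData.comul₂, LinearMap.comp_apply,
      TensorProduct.map_tmul, LinearEquiv.coe_coe, hmul]

/-- The counit of a product. -/
def form (P Q : D.Par) : D.Bos ⊗[K] D.Bos →ₗ[K] K := D.nichols.radford.counit ∘ₗ cmul P Q

/-- The counit applied to the left factor of `comul_cmul`. -/
lemma cmul_eq_conv_left (P S Q : D.Par) : conv D.nichols.radford.comul₂
    (TensorProduct.lid K D.Bos).toLinearMap (form P S) (cmul S Q) = cmul P Q := by
  ext1
  refine LinearMap.ext₂ fun x y => ?_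
  have := D.counit_comul_left (cmul P Q (x ⊗ₜ y))
  rw [comul_cmul P S Q, ← LinearMap.comp_apply (TensorProduct.map _ _),
    ← TensorProduct.map_comp, LinearMap.id_comp] at this
  exact this

lemma cmul_eq_conv_right (P S Q : D.Par) : conv D.nichols.radford.comul₂
    (TensorProduct.rid K D.Bos).toLinearMap (cmul P S) (form S Q) = cmul P Q := by
  ext1
  refine LinearMap.ext₂ fun x y => ?_
  have := D.counit_comul_right (cmul P Q (x ⊗ₜ y))
  rw [comul_cmul P S Q, ← LinearMap.comp_apply (TensorProduct.map _ _),
    ← TensorProduct.map_comp, LinearMap.id_comp] at this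
  exact this

lemma comp_conv {C L M N N' : Type*} [AddCommMonoid C] [Module K C]
    [AddCommMonoid L] [Module K L] [AddCommMonoid M] [Module K M] [AddCommMonoid N] [Module K N]
    [AddCommMonoid N'] [Module K N'] (Δ : C →ₗ[K] C ⊗[K] C) (μ : L ⊗[K] M →ₗ[K] N) (f : C →ₗ[K] L)
    (g : C →ₗ[K] M) (k : N →ₗ[K] N') : k ∘ₗ conv Δ μ f g = conv Δ (k ∘ₗ μ) f g := rfl

lemma conv_comp {C L M N L' M' : Type*} [AddCommMonoid C] [Module K C]
    [AddCommMonoid L] [Module K L] [AddCommMonoid M] [Module K M] [AddCommMonoid N] [Module K N]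
    [AddCommMonoid L'] [Module K L'] [AddCommMonoid M'] [Module K M']
    (Δ : C →ₗ[K] C ⊗[K] C) (μ : L ⊗[K] M →ₗ[K] N) (k : L' →ₗ[K] L) (k' : M' →ₗ[K] M)
    (f : C →ₗ[K] L') (g : C →ₗ[K] M') :
    conv Δ μ (k ∘ₗ f) (k' ∘ₗ g) = conv Δ (μ ∘ₗ TensorProduct.map k k') f g := by
  simp only [conv, TensorProduct.map_comp, LinearMap.comp_assoc]

lemma comp_lid {M : Type*} [AddCommMonoid M] [Module K M] (f : M →ₗ[K] K) :
    f ∘ₗ (TensorProduct.lid K M).toLinearMap =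
      LinearMap.mul' K K ∘ₗ TensorProduct.map LinearMap.id f := by
  ext; simp

lemma convForm_form (P S Q : D.Par) :
    convForm D.nichols.radford.comul₂ (form P S) (form S Q) = form P Q := by
  rw [show form P Q = D.nichols.radford.counit ∘ₗ cmul P Q from rfl, ← cmul_eq_conv_left P S Q,
    comp_conv, comp_lid, ← conv_comp]
  rfl

lemma form_self (P : D.Par) : form P P = D.nichols.radford.counit₂ := by
  let κ : D.Rep P.1 P.1 K := ⟨1, 0, 0, by simp, by simp, by simp [D.r₁_pos.ne'],
    by simp [D.r₂_pos.ne'], by simp⟩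
  have hκ : ∀ x : D.Bos, κ.lift (toCog P P x) = D.nichols.radford.counit x := by
    intro x
    refine LinearMap.congr_fun (f := κ.lift.toLinearMap ∘ₗ (toCog P P).toLinearMap)
      (bos_ext fun i hi j hj h => ?_) x
    rw [toCog_toLinearMap, κ.lift_mono, κ.mono_bas hi hj, radford_counit_bas D hi hj]
    rcases Nat.eq_zero_or_pos i with rfl | hi0
    · rcases Nat.eq_zero_or_pos j with rfl | hj0
      · simp [κ]
      · simp [hj0.ne', κ]
    · simp [hi0.ne', κ]
  ext1
  refine LinearMap.ext₂ fun x y => ?_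
  simp [form, BialgData.counit₂, ← hκ, toCog_cmul]

lemma isConvInv_form (P Q : D.Par) : IsConvInv D.nichols.radford.comul₂ D.nichols.radford.counit₂
    (form P Q) (form Q P) :=
  ⟨by rw [convForm_form, form_self], by rw [convForm_form, form_self]⟩

/-- Convolution with `form Q P` on the right moves the second parameter from Q to P, and with `form
P Q` on the left it moves the first. -/
lemma convTwist_form (P Q : D.Par) : convTwist D.nichols.radford.comul₂ (form P Q) (form Q P)
    (cmul Q Q) = cmul P P := by
  rw [convTwist, cmul_eq_conv_right, cmul_eq_conv_left]

end QuantumPlane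

namespace QuantumPlane
open QPlane
variable {K Γ : Type*} [Field K] [CommGroup Γ] (D : QuantumPlane K Γ)

/-! ### The braided coalgebra `R ⊗ R` -/

lemma actT_mon (g : Γ) (i j : ℕ) :
    D.nichols.actT (MonoidAlgebra.of K Γ g ⊗ₜ D.mon i j) =
      (D.χ₁ g ^ i * D.χ₂ g ^ j) • D.mon i j := by
  simpa [BraidedData.actT] using D.act_mon g i j

lemma braiding_mon (i j k l : ℕ) : D.nichols.braiding (D.mon i j ⊗ₜ D.mon k l) =
    (D.χ₁ (D.g₁ ^ i * D.g₂ ^ j) ^ k * D.χ₂ (D.g₁ ^ i * D.g₂ ^ j) ^ l) •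
      (D.mon k l ⊗ₜ D.mon i j) := by
  rw [BraidedData.braiding, LinearMap.comp_apply, LinearMap.comp_apply, TensorProduct.map_tmul,
    coact_mon, LinearMap.id_apply, LinearEquiv.coe_coe, TensorProduct.rightComm_tmul,
    TensorProduct.map_tmul, actT_mon, LinearMap.id_apply, TensorProduct.smul_tmul']

/-- The inclusion `r ↦ r # 1`. -/
def incl : D.Nic →ₗ[K] D.Bos := (TensorProduct.mk K D.Nic (MonoidAlgebra K Γ)).flip 1

lemma incl_mon (i j : ℕ) : D.incl (D.mon i j) = D.bas i j 1 := rfl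

/-- The inclusion of `R ⊗ R` into `A ⊗ A`. -/
def incl₂ : D.Nic ⊗[K] D.Nic →ₗ[K] D.Bos ⊗[K] D.Bos := TensorProduct.map D.incl D.incl

lemma incl₂_mon (i j k l : ℕ) :
    D.incl₂ (D.mon i j ⊗ₜ D.mon k l) = D.bas i j 1 ⊗ₜ D.bas k l 1 := rfl

lemma restrict_eq (γ : D.Bos ⊗[K] D.Bos →ₗ[K] K) : D.nichols.restrict γ = γ ∘ₗ D.incl₂ := rfl

/-- The projection `(r # h) ⊗ (s # k) ↦ ε(k) r ⊗ h · s`. -/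
def proj : D.Bos ⊗[K] D.Bos →ₗ[K] D.Nic ⊗[K] D.Nic :=
  TensorProduct.map LinearMap.id D.nichols.actT ∘ₗ
    (TensorProduct.assoc K D.Nic (MonoidAlgebra K Γ) D.Nic).toLinearMap ∘ₗ
      TensorProduct.map LinearMap.id ((TensorProduct.rid K D.Nic).toLinearMap ∘ₗ
        TensorProduct.map LinearMap.id Coalgebra.counit)

lemma proj_bas (i j k l : ℕ) (h h' : Γ) : D.proj (D.bas i j h ⊗ₜ D.bas k l h') =
    (D.χ₁ h ^ k * D.χ₂ h ^ l) • (D.mon i j ⊗ₜ D.mon k l) := by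
  have := D.actT_mon h k l
  simp only [MonoidAlgebra.of_apply] at this
  simp [proj, bas, this]

lemma proj_incl₂ (z : D.Nic ⊗[K] D.Nic) : D.proj (D.incl₂ z) = z := by
  refine LinearMap.congr_fun (f := D.proj ∘ₗ D.incl₂) (g := LinearMap.id)
    (nic₂_ext fun i hi j hj k hk l hl => ?_) z
  simp [incl₂_mon, proj_bas]

/-- The map `r ⊗ s ↦ (r # s₍₋₁₎) ⊗ (s₍₀₎ # 1)`. -/
def cosmash : D.Nic ⊗[K] D.Nic →ₗ[K] D.Bos ⊗[K] D.Bos :=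
  TensorProduct.map LinearMap.id D.incl ∘ₗ
    (TensorProduct.assoc K D.Nic (MonoidAlgebra K Γ) D.Nic).symm.toLinearMap ∘ₗ
      TensorProduct.map LinearMap.id D.nichols.coact

lemma cosmash_mon (i j k l : ℕ) : D.cosmash (D.mon i j ⊗ₜ D.mon k l) =
    D.bas i j (D.g₁ ^ k * D.g₂ ^ l) ⊗ₜ D.bas k l 1 := by
  rw [cosmash, LinearMap.comp_apply, LinearMap.comp_apply, TensorProduct.map_tmul, coact_mon]
  rfl

lemma comul_incl (r : D.Nic) :
    D.nichols.radford.comul (D.incl r) = D.cosmash (D.nichols.comul r) := by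
  refine LinearMap.congr_fun (f := D.nichols.radford.comul ∘ₗ D.incl)
    (g := D.cosmash ∘ₗ D.nichols.comul) (nic_ext fun i hi j hj => ?_) r
  simp only [LinearMap.comp_apply, incl_mon, radford_comul_bas D hi hj, comul_mon D hi hj, map_sum,
    map_smul, cosmash_mon, mul_one]

/-- Δ(r # 1) leaves r⁽²⁾₍₋₁₎ as the group part of the left factor. Letting it act on s⁽¹⁾, which is
what `proj` does, reproduces the braiding in the comultiplication of R ⊗ R. -/
lemma comul₂_incl₂ (z : D.Nic ⊗[K] D.Nic) :
    TensorProduct.map D.proj LinearMap.id (D.nichols.radford.comul₂ (D.incl₂ z)) =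
      TensorProduct.map LinearMap.id D.incl₂ (D.nichols.comul₂ z) := by
  have key : (TensorProduct.map D.proj LinearMap.id ∘ₗ
      (TensorProduct.tensorTensorTensorComm K D.Bos D.Bos D.Bos D.Bos).toLinearMap ∘ₗ
        TensorProduct.map D.cosmash D.cosmash) =
      TensorProduct.map LinearMap.id D.incl₂ ∘ₗ
        (TensorProduct.assoc K D.Nic D.Nic (D.Nic ⊗[K] D.Nic)).symm.toLinearMap ∘ₗ
        TensorProduct.map LinearMap.id
          ((TensorProduct.assoc K D.Nic D.Nic D.Nic).toLinearMap ∘ₗ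
            TensorProduct.map D.nichols.braiding LinearMap.id ∘ₗ
              (TensorProduct.assoc K D.Nic D.Nic D.Nic).symm.toLinearMap) ∘ₗ
          (TensorProduct.assoc K D.Nic D.Nic (D.Nic ⊗[K] D.Nic)).toLinearMap := by
    refine TensorProduct.ext ?_
    refine nic₂_ext fun i hi j hj k hk l hl => ?_
    refine nic₂_ext fun i' hi' j' hj' k' hk' l' hl' => ?_
    simp only [LinearMap.compr₂ₛₗ_apply, TensorProduct.mk_apply, LinearMap.comp_apply,
      TensorProduct.map_tmul, cosmash_mon, LinearEquiv.coe_coe,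
      TensorProduct.tensorTensorTensorComm_tmul, proj_bas, LinearMap.id_apply,
      TensorProduct.assoc_tmul, TensorProduct.assoc_symm_tmul, braiding_mon,
      ← TensorProduct.smul_tmul', map_smul, TensorProduct.tmul_smul, incl₂_mon]
  induction z with
  | zero => simp
  | add a b ha hb => simp only [map_add, ha, hb]
  | tmul r s =>
    have := LinearMap.congr_fun key (D.nichols.comul r ⊗ₜ D.nichols.comul s)
    simp only [LinearMap.comp_apply, TensorProduct.map_tmul, ← comul_incl] at this
    exact this

lemma counit₂_incl₂ : D.nichols.radford.counit₂ ∘ₗ D.incl₂ = D.nichols.counit₂ :=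
  nic₂_ext fun i hi j hj k hk l hl => by
    simp [incl₂_mon, BialgData.counit₂, BraidedData.counit₂, radford_counit_bas, counit_mon, hi, hj,
      hk, hl]

lemma counit₂_comul₂_right (z : D.Nic ⊗[K] D.Nic) : TensorProduct.rid K _
    (TensorProduct.map LinearMap.id D.nichols.counit₂ (D.nichols.comul₂ z)) = z := by
  have h := congrArg D.proj
    (D.nichols.radford.counit₂_comul₂_right D.counit_comul_right (D.incl₂ z))
  rw [proj_incl₂] at h
  conv_rhs => rw [← h]
  have h1 := congrArg (TensorProduct.map LinearMap.id D.nichols.radford.counit₂) (D.comul₂_incl₂ z)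
  rw [← LinearMap.comp_apply, ← LinearMap.comp_apply (TensorProduct.map _ D.nichols.radford.counit₂),
    ← TensorProduct.map_comp, ← TensorProduct.map_comp, counit₂_incl₂] at h1
  simp only [LinearMap.id_comp, LinearMap.comp_id] at h1
  rw [← h1]
  induction D.nichols.radford.comul₂ (D.incl₂ z) with
  | zero => simp
  | add a b ha hb => simp only [map_add, ha, hb]
  | tmul a b => simp

variable {D}

/-- Convolution over `A ⊗ A` restricts to convolution over the braided coalgebra `R ⊗ R`. -/
lemma conv_comp_incl₂ {L M N : Type*} [AddCommMonoid L] [Module K L] [AddCommMonoid M] [Module K M]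
    [AddCommMonoid N] [Module K N] (μ : L ⊗[K] M →ₗ[K] N) {F : D.Bos ⊗[K] D.Bos →ₗ[K] L}
    (G : D.Bos ⊗[K] D.Bos →ₗ[K] M) (hF : F ∘ₗ D.incl₂ ∘ₗ D.proj = F) :
    conv D.nichols.radford.comul₂ μ F G ∘ₗ D.incl₂ =
      conv D.nichols.comul₂ μ (F ∘ₗ D.incl₂) (G ∘ₗ D.incl₂) := by
  refine LinearMap.ext fun z => ?_
  have h := congrArg (TensorProduct.map (F ∘ₗ D.incl₂) G) (D.comul₂_incl₂ z)
  rw [← LinearMap.comp_apply, ← LinearMap.comp_apply (TensorProduct.map _ G),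
    ← TensorProduct.map_comp, ← TensorProduct.map_comp, LinearMap.comp_assoc, hF,
    LinearMap.comp_id, LinearMap.comp_id] at h
  exact congrArg μ h

/-! ### Products of basis elements -/

variable (D) in
/-- Right multiplication by `g ∈ Γ`. -/
def mulG (g : Γ) : D.Bos →ₗ[K] D.Bos :=
  TensorProduct.map LinearMap.id (LinearMap.mulRight K (MonoidAlgebra.of K Γ g))

lemma mulG_bas (g : Γ) (i j : ℕ) (h : Γ) : D.mulG g (D.bas i j h) = D.bas i j (h * g) := by
  simp [mulG, bas]

lemma toCog_mulG (P Q : D.Par) (g : Γ) (x : D.Bos) :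
    toCog P Q (D.mulG g x) = toCog P Q x * (Cog.univ D P.1 Q.1).G g := by
  refine LinearMap.congr_fun (f := (toCog P Q).toLinearMap ∘ₗ D.mulG g)
    (g := LinearMap.mulRight K ((Cog.univ D P.1 Q.1).G g) ∘ₗ (toCog P Q).toLinearMap)
    (bos_ext fun i hi j hj h => ?_) x
  simp [mulG_bas, toCog_apply, Rep.mono_bas _ hi hj, mul_assoc]

/-- The group parts enter every product in the same way, through the characters and a right
translation. Products are therefore determined by their values on R ⊗ R. -/
lemma cmul_bas (P Q : D.Par) {i j k l : ℕ} (hi : i < D.r₁) (hj : j < D.r₂) (hk : k < D.r₁)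
    (hl : l < D.r₂) (h h' : Γ) : cmul P Q (D.bas i j h ⊗ₜ D.bas k l h') =
      (D.χ₁ h ^ k * D.χ₂ h ^ l) •
        D.mulG (h * h') (cmul P Q (D.bas i j 1 ⊗ₜ D.bas k l 1)) := by
  apply (toCog P Q).injective
  simp only [toCog_cmul, map_smul, toCog_mulG]
  simp only [toCog_apply, Rep.mono_bas _ hi hj,
    Rep.mono_bas _ hk hl, map_one, mul_one, map_mul]
  rw [mul_assoc _ (Rep.G _ h), ← mul_assoc (Rep.G _ h), Rep.comm_mon, smul_mul_assoc,
    mul_smul_comm]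
  simp only [mul_assoc]

/-- The multiplication M and the cocycle ξ are arbitrary so that the formula covers both the Radford
biproduct and the twisted one. The group parts enter as in `cmul_bas`, so comparing multiplications
reduces to R ⊗ R. -/
lemma biproduct_mul_bas (M : D.Nic ⊗[K] D.Nic →ₗ[K] D.Nic)
    (ξ : D.Nic ⊗[K] D.Nic →ₗ[K] MonoidAlgebra K Γ) (i j k l : ℕ) (h h' : Γ) :
    (({ D.nichols with mul := M } : BraidedData K Γ D.Nic).biproduct ξ).mul
      (D.bas i j h ⊗ₜ D.bas k l h') = (D.χ₁ h ^ k * D.χ₂ h ^ l) •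
        D.mulG (h * h') (TensorProduct.map M ξ (D.nichols.comul₂ (D.mon i j ⊗ₜ D.mon k l))) := by
  have ha := D.actT_mon h k l
  simp only [MonoidAlgebra.of_apply] at ha
  change (TensorProduct.map LinearMap.id (LinearMap.mul' K (MonoidAlgebra K Γ)) ∘ₗ
      (TensorProduct.assoc K D.Nic (MonoidAlgebra K Γ) (MonoidAlgebra K Γ)).toLinearMap ∘ₗ
        TensorProduct.map
          (TensorProduct.map M ξ ∘ₗ D.nichols.comul₂ ∘ₗ
            TensorProduct.map LinearMap.id D.nichols.actT ∘ₗ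
              (TensorProduct.assoc K D.Nic (MonoidAlgebra K Γ) D.Nic).toLinearMap)
          (LinearMap.mul' K (MonoidAlgebra K Γ)) ∘ₗ
          (TensorProduct.tensorTensorTensorComm K (D.Nic ⊗[K] MonoidAlgebra K Γ)
            (MonoidAlgebra K Γ) D.Nic (MonoidAlgebra K Γ)).toLinearMap ∘ₗ
            TensorProduct.map
              ((TensorProduct.assoc K D.Nic (MonoidAlgebra K Γ)
                (MonoidAlgebra K Γ)).symm.toLinearMap ∘ₗ
                TensorProduct.map LinearMap.id Coalgebra.comul)
              LinearMap.id) (D.bas i j h ⊗ₜ D.bas k l h') = _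
  simp only [bas, LinearMap.comp_apply, TensorProduct.map_tmul, LinearMap.id_apply,
    MonoidAlgebra.of_apply, MonoidAlgebra.comul_single, CommSemiring.comul_apply,
    LinearEquiv.coe_coe, TensorProduct.assoc_symm_tmul, TensorProduct.tensorTensorTensorComm_tmul,
    TensorProduct.assoc_tmul, LinearMap.mul'_apply, MonoidAlgebra.single_mul_single, mul_one,
    MonoidAlgebra.lsingle_apply, ha, TensorProduct.tmul_smul, map_smul, ← TensorProduct.smul_tmul']
  congr 1
  induction TensorProduct.map M ξ (D.nichols.comul₂ (D.mon i j ⊗ₜ D.mon k l)) with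
  | zero => simp
  | add a b ha hb => simp only [map_add, TensorProduct.add_tmul, ha, hb]
  | tmul a b => simp [mulG]

lemma x₂_pow_mul_x₁_pow {P Q : Params K} (hP : P.c₁₂ = 0) (hQ : Q.c₁₂ = 0) {U : Type*} [Ring U]
    [Algebra K U] (u : D.Rep P Q U) (j k : ℕ) :
    u.x₂ ^ j * u.x₁ ^ k = D.χ₁ D.g₂ ^ (j * k) • (u.x₁ ^ k * u.x₂ ^ j) := by
  have h1 : ∀ k, u.x₂ * u.x₁ ^ k = D.χ₁ D.g₂ ^ k • (u.x₁ ^ k * u.x₂) := by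
    intro k
    induction k with
    | zero => simp
    | succ k ih =>
      have hl : u.x₂ * u.x₁ = D.χ₁ D.g₂ • (u.x₁ * u.x₂) := by simpa [hP, hQ] using u.link
      rw [pow_succ, ← mul_assoc, ih, smul_mul_assoc, mul_assoc, hl, mul_smul_comm, smul_smul,
        ← pow_succ, mul_assoc]
  induction j with
  | zero => simp
  | succ j ih =>
    rw [pow_succ', mul_assoc, ih, mul_smul_comm, ← mul_assoc, h1, smul_mul_assoc, smul_smul,
      ← pow_add, mul_assoc, ← pow_succ', Nat.succ_mul]

lemma cmul_zero_bas {i j k l : ℕ} (hi : i < D.r₁) (hj : j < D.r₂) (hk : k < D.r₁)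
    (hl : l < D.r₂) (P : D.Par) (hP : P.1 = 0) : cmul P P (D.bas i j 1 ⊗ₜ D.bas k l 1) =
      D.χ₁ D.g₂ ^ (j * k) • D.bas (i + k) (j + l) 1 := by
  obtain ⟨_, hP'⟩ := P
  subst hP
  set P : D.Par := ⟨0, hP'⟩
  let u := Cog.univ D (0 : Params K) 0
  have hx₁ : u.x₁ ^ D.r₁ = 0 := by simpa using u.pow₁
  have hx₂ : u.x₂ ^ D.r₂ = 0 := by simpa using u.pow₂
  apply (toCog P P).injective
  have hall : toCog P P (D.bas (i + k) (j + l) 1) = u.x₁ ^ (i + k) * u.x₂ ^ (j + l) := by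
    by_cases h : i + k < D.r₁ ∧ j + l < D.r₂
    · rw [toCog_apply, Rep.mono_bas _ h.1 h.2, map_one, mul_one]
    · rw [bas_eq_zero D h, map_zero]
      rcases not_and_or.1 h with h | h
      · rw [pow_eq_zero_of_le (not_lt.1 h) hx₁, zero_mul]
      · rw [pow_eq_zero_of_le (not_lt.1 h) hx₂, mul_zero]
  rw [toCog_cmul, map_smul, hall, toCog_apply, toCog_apply, Rep.mono_bas _ hi hj,
    Rep.mono_bas _ hk hl, map_one, mul_one, mul_one]
  change u.x₁ ^ i * u.x₂ ^ j * (u.x₁ ^ k * u.x₂ ^ l) = _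
  rw [mul_assoc, ← mul_assoc (u.x₂ ^ j), x₂_pow_mul_x₁_pow rfl rfl, smul_mul_assoc, mul_smul_comm, pow_add, pow_add]
  simp only [mul_assoc]

variable (D) in
/-- The zero parameters. -/
def zeroPar : D.Par := ⟨0, admissible_zero⟩

lemma radford_mul : D.nichols.radford.mul = cmul D.zeroPar D.zeroPar := by
  refine bos₂_ext fun i hi j hj h k hk l hl h' => ?_
  rw [cmul_bas _ _ hi hj hk hl, cmul_zero_bas hi hj hk hl _ rfl]
  refine (biproduct_mul_bas D.nichols.mul D.nichols.trivialCocycle i j k l h h').trans ?_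
  congr 2
  have h1 := congrArg (D.incl ∘ₗ D.nichols.mul) (D.counit₂_comul₂_right (D.mon i j ⊗ₜ D.mon k l))
  rw [LinearMap.comp_apply, LinearMap.comp_apply, mul_mon, map_smul, incl_mon] at h1
  rw [← h1]
  induction D.nichols.comul₂ (D.mon i j ⊗ₜ D.mon k l) with
  | zero => simp
  | add a b ha hb => simp only [map_add, ha, hb]
  | tmul a b =>
    simp [BraidedData.trivialCocycle, incl, Algebra.algebraMap_eq_smul_one,
      TensorProduct.tmul_smul]

lemma radford_mul_bas {i j k l : ℕ} (hi : i < D.r₁) (hj : j < D.r₂) (hk : k < D.r₁)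
    (hl : l < D.r₂) (h h' : Γ) : D.nichols.radford.mul (D.bas i j h ⊗ₜ D.bas k l h') =
      (D.χ₁ h ^ k * D.χ₂ h ^ l * D.χ₁ D.g₂ ^ (j * k)) • D.bas (i + k) (j + l) (h * h') := by
  rw [radford_mul, cmul_bas _ _ hi hj hk hl, cmul_zero_bas hi hj hk hl _ rfl, map_smul, smul_smul,
    mulG_bas, one_mul]

/-! ### Projections of `A` -/

variable (D) in
/-- The projection `r # h ↦ ε(h) r`. -/
def toNic : D.Bos →ₗ[K] D.Nic :=
  (TensorProduct.rid K D.Nic).toLinearMap ∘ₗ TensorProduct.map LinearMap.id Coalgebra.counit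

lemma toNic_bas (i j : ℕ) (h : Γ) : D.toNic (D.bas i j h) = D.mon i j := by
  simp [toNic, bas]

lemma toNic_incl (r : D.Nic) : D.toNic (D.incl r) = r := by
  simp [toNic, incl]

variable (D) in
/-- The projection `r # h ↦ ε(r) h`. -/
def toGrp : D.Bos →ₗ[K] MonoidAlgebra K Γ :=
  (TensorProduct.lid K (MonoidAlgebra K Γ)).toLinearMap ∘ₗ
    TensorProduct.map D.nichols.counit LinearMap.id

lemma toGrp_bas {i j : ℕ} (hi : i < D.r₁) (hj : j < D.r₂) (h : Γ) :
    D.toGrp (D.bas i j h) = if i = 0 ∧ j = 0 then MonoidAlgebra.of K Γ h else 0 := by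
  simp only [toGrp, bas, LinearMap.comp_apply, TensorProduct.map_tmul, counit_mon D hi hj]
  split_ifs <;> simp

lemma toNic_mulG (g : Γ) (x : D.Bos) : D.toNic (D.mulG g x) = D.toNic x :=
  LinearMap.congr_fun (f := D.toNic ∘ₗ D.mulG g)
    (bos_ext fun i hi j hj h => by simp [mulG_bas, toNic_bas]) x

lemma counit_mulG (g : Γ) (x : D.Bos) :
    D.nichols.radford.counit (D.mulG g x) = D.nichols.radford.counit x :=
  LinearMap.congr_fun (f := D.nichols.radford.counit ∘ₗ D.mulG g)
    (bos_ext fun i hi j hj h => by simp [mulG_bas, radford_counit_bas, hi, hj]) x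

/-- Maps that do not see right multiplication by `Γ` factor over `R ⊗ R`. -/
lemma comp_cmul_proj {M : Type*} [AddCommMonoid M] [Module K M] (P Q : D.Par)
    {f : D.Bos →ₗ[K] M} (hf : ∀ g x, f (D.mulG g x) = f x) :
    (f ∘ₗ cmul P Q) ∘ₗ D.incl₂ ∘ₗ D.proj = f ∘ₗ cmul P Q :=
  bos₂_ext fun i hi j hj h k hk l hl h' => by
    simp only [LinearMap.comp_apply, proj_bas, map_smul, incl₂_mon, cmul_bas P Q hi hj hk hl h h',
      hf]

lemma form_proj (P Q : D.Par) : form P Q ∘ₗ D.incl₂ ∘ₗ D.proj = form P Q :=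
  comp_cmul_proj P Q counit_mulG

end QuantumPlane

namespace QuantumPlane
open QPlane
variable {K Γ : Type*} [Field K] [CommGroup Γ] {D : QuantumPlane K Γ}

/-! ### The Nichols algebra -/

lemma incl_mul (z : D.Nic ⊗[K] D.Nic) :
    D.incl (D.nichols.mul z) = cmul D.zeroPar D.zeroPar (D.incl₂ z) := by
  refine LinearMap.congr_fun (f := D.incl ∘ₗ D.nichols.mul)
    (g := cmul D.zeroPar D.zeroPar ∘ₗ D.incl₂) (nic₂_ext fun i hi j hj k hk l hl => ?_) z
  rw [LinearMap.comp_apply, LinearMap.comp_apply, incl₂_mon, cmul_zero_bas hi hj hk hl _ rfl,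
    mul_mon, map_smul, incl_mon]

lemma toNic_cmul_incl₂ : (D.toNic ∘ₗ cmul D.zeroPar D.zeroPar) ∘ₗ D.incl₂ = D.nichols.mul :=
  LinearMap.ext fun z => by
    rw [LinearMap.comp_apply, LinearMap.comp_apply, ← incl_mul, toNic_incl]

lemma incl_injective : Function.Injective D.incl :=
  Function.LeftInverse.injective toNic_incl

/-- Since forgetting the group part is a surjective map of coalgebras, R inherits coassociativity
and the counit laws from A. -/
lemma comul_toNic (x : D.Bos) :
    D.nichols.comul (D.toNic x) = TensorProduct.map D.toNic D.toNic (D.nichols.radford.comul x) := by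
  refine LinearMap.congr_fun (f := D.nichols.comul ∘ₗ D.toNic)
    (g := TensorProduct.map D.toNic D.toNic ∘ₗ D.nichols.radford.comul)
    (bos_ext fun i hi j hj h => ?_) x
  simp only [LinearMap.comp_apply, toNic_bas, comul_mon D hi hj, radford_comul_bas D hi hj, map_sum,
    map_smul, TensorProduct.map_tmul]

lemma counit_toNic : D.nichols.counit ∘ₗ D.toNic = D.nichols.radford.counit :=
  bos_ext fun i hi j hj h => by
    simp [toNic_bas, counit_mon D hi hj, radford_counit_bas D hi hj]

lemma comul_eq (r : D.Nic) : D.nichols.comul r =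
    TensorProduct.map D.toNic D.toNic (D.nichols.radford.comul (D.incl r)) := by
  rw [← comul_toNic, toNic_incl]

lemma coact₂_mon (i j k l : ℕ) : D.nichols.coact₂ (D.mon i j ⊗ₜ D.mon k l) =
    MonoidAlgebra.of K Γ (D.g₁ ^ (i + k) * D.g₂ ^ (j + l)) ⊗ₜ (D.mon i j ⊗ₜ D.mon k l) := by
  simp only [BraidedData.coact₂, LinearMap.comp_apply, TensorProduct.map_tmul, coact_mon,
    LinearEquiv.coe_coe, TensorProduct.tensorTensorTensorComm_tmul, LinearMap.mul'_apply,
    LinearMap.id_apply, ← map_mul]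
  rw [pow_add, pow_add, mul_mul_mul_comm]

lemma coassoc_nichols (r : D.Nic) : TensorProduct.assoc K D.Nic D.Nic D.Nic
    (TensorProduct.map D.nichols.comul LinearMap.id (D.nichols.comul r)) =
      TensorProduct.map LinearMap.id D.nichols.comul (D.nichols.comul r) := by
  have h := congrArg (TensorProduct.map D.toNic (TensorProduct.map D.toNic D.toNic))
    (D.coassoc_radford (D.incl r))
  have h1 : ∀ X : D.Bos ⊗[K] D.Bos, TensorProduct.map D.toNic (TensorProduct.map D.toNic D.toNic)
      (TensorProduct.assoc K _ _ _ (TensorProduct.map D.nichols.radford.comul LinearMap.id X)) =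
      TensorProduct.assoc K _ _ _ (TensorProduct.map D.nichols.comul LinearMap.id
        (TensorProduct.map D.toNic D.toNic X)) := by
    intro X
    induction X with
    | zero => simp
    | add a b ha hb => simp only [map_add, ha, hb]
    | tmul a b =>
      simp only [TensorProduct.map_tmul, LinearMap.id_apply, comul_toNic]
      induction D.nichols.radford.comul a with
      | zero => simp
      | add a b ha hb => simp only [map_add, ha, hb, TensorProduct.add_tmul]
      | tmul a b => simp
  have h2 : ∀ X : D.Bos ⊗[K] D.Bos, TensorProduct.map D.toNic (TensorProduct.map D.toNic D.toNic)
      (TensorProduct.map LinearMap.id D.nichols.radford.comul X) =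
      TensorProduct.map LinearMap.id D.nichols.comul (TensorProduct.map D.toNic D.toNic X) := by
    intro X
    induction X with
    | zero => simp
    | add a b ha hb => simp only [map_add, ha, hb]
    | tmul a b => simp [comul_toNic]
  rwa [h1, h2, ← comul_eq] at h

lemma counit_comul_left_nichols (r : D.Nic) : TensorProduct.lid K D.Nic
    (TensorProduct.map D.nichols.counit LinearMap.id (D.nichols.comul r)) = r := by
  have h := congrArg D.toNic (D.counit_comul_left (D.incl r))
  rw [toNic_incl] at h
  conv_rhs => rw [← h]
  rw [comul_eq, ← counit_toNic]
  induction D.nichols.radford.comul (D.incl r) with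
  | zero => simp
  | add a b ha hb => simp only [map_add, ha, hb]
  | tmul a b => simp

lemma counit_comul_right_nichols (r : D.Nic) : TensorProduct.rid K D.Nic
    (TensorProduct.map LinearMap.id D.nichols.counit (D.nichols.comul r)) = r := by
  have h := congrArg D.toNic (D.counit_comul_right (D.incl r))
  rw [toNic_incl] at h
  conv_rhs => rw [← h]
  rw [comul_eq, ← counit_toNic]
  induction D.nichols.radford.comul (D.incl r) with
  | zero => simp
  | add a b ha hb => simp only [map_add, ha, hb]
  | tmul a b => simp

/-- This is `comul_cmul` for A with the group parts forgotten; the braided comultiplication of R ⊗ R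
comes from `conv_comp_incl₂`. -/
lemma comul_mul_nichols (z : D.Nic ⊗[K] D.Nic) : D.nichols.comul (D.nichols.mul z) =
    TensorProduct.map D.nichols.mul D.nichols.mul (D.nichols.comul₂ z) := by
  have h := LinearMap.congr_fun (conv_comp_incl₂ (D := D) LinearMap.id
    (D.toNic ∘ₗ cmul D.zeroPar D.zeroPar)
    (comp_cmul_proj D.zeroPar D.zeroPar (f := D.toNic) toNic_mulG)) z
  rw [toNic_cmul_incl₂] at h
  refine Eq.trans ?_ h
  rw [comul_eq, incl_mul, comul_cmul _ D.zeroPar, ← LinearMap.comp_apply (TensorProduct.map _ _),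
    ← TensorProduct.map_comp]
  rfl

lemma counit_mul_nichols : D.nichols.counit ∘ₗ D.nichols.mul = D.nichols.counit₂ := by
  rw [← toNic_cmul_incl₂, ← LinearMap.comp_assoc, ← LinearMap.comp_assoc, counit_toNic,
    ← counit₂_incl₂, ← form_self D.zeroPar]
  rfl

lemma act_mul_nichols (g : Γ) (z : D.Nic ⊗[K] D.Nic) :
    D.nichols.act (MonoidAlgebra.of K Γ g) (D.nichols.mul z) =
      D.nichols.mul (TensorProduct.map (D.nichols.act (MonoidAlgebra.of K Γ g))
        (D.nichols.act (MonoidAlgebra.of K Γ g)) z) := by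
  refine LinearMap.congr_fun (f := D.nichols.act (MonoidAlgebra.of K Γ g) ∘ₗ D.nichols.mul)
    (g := D.nichols.mul ∘ₗ (TensorProduct.map (D.nichols.act (MonoidAlgebra.of K Γ g))
        (D.nichols.act (MonoidAlgebra.of K Γ g)))) (nic₂_ext fun i hi j hj k hk l hl => ?_) z
  simp only [LinearMap.comp_apply, TensorProduct.map_tmul, act_mon, mul_mon, map_smul,
    TensorProduct.tmul_smul, ← TensorProduct.smul_tmul', smul_smul]
  congr 1
  ring

lemma isBraidedBialgebra_nichols : D.nichols.IsBraidedBialgebra where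
  mul_assoc r s t := by
    apply incl_injective
    have h : ∀ x y : D.Nic, D.incl (D.nichols.mul (x ⊗ₜ y)) =
      cmul D.zeroPar D.zeroPar (D.incl x ⊗ₜ D.incl y) := fun x y => incl_mul _
    rw [h, h, h, h, cmul_assoc]
  one_mul r := by
    apply incl_injective
    rw [incl_mul]
    exact one_cmul _ _ _
  mul_one r := by
    apply incl_injective
    rw [incl_mul]
    exact cmul_one _ _ _
  coassoc := LinearMap.ext coassoc_nichols
  counit_left := LinearMap.ext counit_comul_left_nichols
  counit_right := LinearMap.ext counit_comul_right_nichols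
  coact_coassoc := nic_ext fun i hi j hj => by
    simp only [LinearMap.comp_apply, TensorProduct.map_tmul, coact_mon, MonoidAlgebra.of_apply,
      MonoidAlgebra.comul_single, CommSemiring.comul_apply, LinearMap.id_apply,
      LinearEquiv.coe_coe, TensorProduct.assoc_tmul, MonoidAlgebra.lsingle_apply]
  coact_counit := nic_ext fun i hi j hj => by
    simp only [LinearMap.comp_apply, coact_mon]
    simp
  yd g := nic_ext fun i hi j hj => by
    simp only [LinearMap.comp_apply, coact_mon, act_mon, map_smul, TensorProduct.map_tmul,
      TensorProduct.tmul_smul, LinearMap.id_apply]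
  act_mul g r s := by simpa using act_mul_nichols g (r ⊗ₜ s)
  act_one g := by simpa [one_eq] using D.act_mon g 0 0
  act_comul g := nic_ext fun i hi j hj => by
    simp only [LinearMap.comp_apply, act_mon, map_smul, comul_mon D hi hj, map_sum,
      TensorProduct.map_tmul, TensorProduct.tmul_smul, ← TensorProduct.smul_tmul',
      Finset.smul_sum, smul_smul]
    refine Finset.sum_congr rfl fun n hn => Finset.sum_congr rfl fun m hm => ?_
    congr 1
    obtain ⟨n', rfl⟩ := Nat.exists_eq_add_of_le (Nat.lt_succ_iff.1 (Finset.mem_range.1 hn))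
    obtain ⟨m', rfl⟩ := Nat.exists_eq_add_of_le (Nat.lt_succ_iff.1 (Finset.mem_range.1 hm))
    rw [Nat.add_sub_cancel_left, Nat.add_sub_cancel_left]
    ring
  act_counit g := nic_ext fun i hi j hj => by
    simp only [LinearMap.comp_apply, act_mon, map_smul, counit_mon D hi hj]
    split_ifs with h
    · simp [h.1, h.2]
    · simp
  coact_mul := nic₂_ext fun i hi j hj k hk l hl => by
    simp only [LinearMap.comp_apply, mul_mon, map_smul, coact_mon, coact₂_mon,
      TensorProduct.map_tmul, TensorProduct.tmul_smul, LinearMap.id_apply]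
  coact_one := by simpa [one_eq, ← MonoidAlgebra.one_def] using D.coact_mon 0 0
  coact_comul := nic_ext fun i hi j hj => by
    simp only [LinearMap.comp_apply, coact_mon, TensorProduct.map_tmul, comul_mon D hi hj, map_sum,
      map_smul, coact₂_mon, LinearMap.id_apply, TensorProduct.tmul_sum, TensorProduct.tmul_smul]
    refine Finset.sum_congr rfl fun n hn => Finset.sum_congr rfl fun m hm => ?_
    have := Finset.mem_range.1 hn
    have := Finset.mem_range.1 hm
    rw [show n + (i - n) = i by omega, show m + (j - m) = j by omega]
  coact_counit_unit r := by
    refine LinearMap.congr_fun (f := TensorProduct.map LinearMap.id D.nichols.counit ∘ₗ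
      D.nichols.coact) (g := TensorProduct.mk K _ _ 1 ∘ₗ D.nichols.counit)
      (nic_ext fun i hi j hj => ?_) r
    simp only [LinearMap.comp_apply, coact_mon, TensorProduct.map_tmul, counit_mon D hi hj,
      LinearMap.id_apply]
    split_ifs with h
    · simp [h.1, h.2, MonoidAlgebra.one_def]
    · simp
  comul_mul := LinearMap.ext comul_mul_nichols
  comul_one := by
    rw [one_eq, comul_mon D D.r₁_pos D.r₂_pos]
    simp [qBinom]
  counit_mul := counit_mul_nichols
  counit_one := by simp [one_eq, counit_mon D D.r₁_pos D.r₂_pos]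

/-! ### The grading and the primitive elements of the Nichols algebra. -/

lemma nicholsGrading_eq (n : ℕ) :
    D.nicholsGrading n = Finsupp.supported K K {p | (p.1 + p.2 : ℕ) = n} := by
  rw [Finsupp.supported_eq_span_single]
  refine le_antisymm (Submodule.span_le.2 ?_) (Submodule.span_mono ?_)
  · rintro _ ⟨i, j, rfl, rfl⟩
    by_cases h : i < D.r₁ ∧ j < D.r₂
    · rw [mon_of_lt D h.1 h.2]
      exact Submodule.subset_span ⟨_, rfl, rfl⟩
    · rw [mon_eq_zero D h]
      exact Submodule.zero_mem _
  · rintro _ ⟨p, rfl, rfl⟩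
    exact ⟨p.1, p.2, rfl, by rw [mon_of_lt D p.1.2 p.2.2]⟩

lemma mon_mem_grading (i j : ℕ) : D.mon i j ∈ D.nicholsGrading (i + j) :=
  Submodule.subset_span ⟨i, j, rfl, rfl⟩

lemma isInternal_grading : DirectSum.IsInternal D.nicholsGrading := by
  have hG : D.nicholsGrading = fun n => Finsupp.supported K K {p | (p.1 + p.2 : ℕ) = n} :=
    funext nicholsGrading_eq
  rw [hG]
  refine DirectSum.isInternal_submodule_of_iSupIndep_of_iSup_eq_top (fun n => ?_) ?_
  · have hle : ⨆ m, ⨆ (_ : m ≠ n), Finsupp.supported K K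
        {p : Fin D.r₁ × Fin D.r₂ | (p.1 + p.2 : ℕ) = m} ≤
        Finsupp.supported K K {p : Fin D.r₁ × Fin D.r₂ | (p.1 + p.2 : ℕ) ≠ n} :=
      iSup₂_le fun m hm => Finsupp.supported_mono fun p hp => by
        simp only [Set.mem_ofPred_eq] at hp ⊢
        omega
    refine Disjoint.mono_right hle (Finsupp.disjoint_supported_supported ?_)
    rw [Set.disjoint_left]
    exact fun p hp hp' => hp' hp
  · rw [← Finsupp.supported_iUnion]
    convert Finsupp.supported_univ (M := K) (R := K)
    ext p
    simp

lemma grading_induction {n : ℕ} {S : Submodule K D.Nic}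
    (h : ∀ i j, i + j = n → D.mon i j ∈ S) : D.nicholsGrading n ≤ S := by
  refine Submodule.span_le.2 ?_
  rintro _ ⟨i, j, hij, rfl⟩
  exact h i j hij

lemma qNat_ne_zero {q : K} {r n : ℕ} (hq : IsPrimitiveRoot q r) (h0 : 0 < n) (hn : n < r) :
    qNat q n ≠ 0 := by
  intro h
  have h1 : q ^ n = 1 := by
    have := mul_neg_geom_sum q n
    rw [show ∑ j ∈ Finset.range n, q ^ j = 0 from h, mul_zero] at this
    exact (sub_eq_zero.1 this.symm).symm
  have := Nat.le_of_dvd h0 (hq.dvd_of_pow_eq_one _ h1)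
  omega

lemma qBinom_one (q : K) (n : ℕ) : qBinom q n 1 = qNat q n := by
  induction n with
  | zero => simp [qBinom, qNat]
  | succ n ih =>
    rw [qBinom, ih, qBinom_zero_right, add_comm n, qNat_add]
    simp [qNat]

lemma mon_apply {i j : ℕ} (hi : i < D.r₁) (hj : j < D.r₂) (p : Fin D.r₁ × Fin D.r₂) :
    D.mon i j p = if i = p.1 ∧ j = p.2 then 1 else 0 := by
  classical
  rw [mon_of_lt D hi hj, Finsupp.single_apply]
  refine if_congr ?_ rfl rfl
  rw [Prod.ext_iff, Fin.ext_iff, Fin.ext_iff]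

variable (D) in
/-- The coefficient of `p ⊗ q`. -/
def coeff₂ (p q : Fin D.r₁ × Fin D.r₂) : D.Nic ⊗[K] D.Nic →ₗ[K] K :=
  LinearMap.mul' K K ∘ₗ TensorProduct.map (Finsupp.lapply p) (Finsupp.lapply q)

lemma coeff₂_tmul (p q : Fin D.r₁ × Fin D.r₂) (r s : D.Nic) :
    D.coeff₂ p q (r ⊗ₜ s) = r p * s q := by
  simp [coeff₂]

/-- Only one monomial s has p ⊗ q in its coproduct, the one whose exponents are the sums of those of
p and q. -/
lemma coeff₂_comul (p q s : Fin D.r₁ × Fin D.r₂) (h₁ : (s.1 : ℕ) = p.1 + q.1)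
    (h₂ : (s.2 : ℕ) = p.2 + q.2) (r : D.Nic) : D.coeff₂ p q (D.nichols.comul r) =
      (qBinom (D.χ₁ D.g₁) s.1 p.1 * qBinom (D.χ₂ D.g₂) s.2 p.2 *
        D.χ₂ D.g₁ ^ ((q.1 : ℕ) * p.2)) * r s := by
  refine LinearMap.congr_fun (f := D.coeff₂ p q ∘ₗ D.nichols.comul)
    (g := (qBinom (D.χ₁ D.g₁) s.1 p.1 * qBinom (D.χ₂ D.g₂) s.2 p.2 *
        D.χ₂ D.g₁ ^ ((q.1 : ℕ) * p.2)) • Finsupp.lapply s) (nic_ext fun i hi j hj => ?_) r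
  simp only [LinearMap.comp_apply, comul_mon D hi hj, map_sum, map_smul, coeff₂_tmul,
    LinearMap.smul_apply, Finsupp.lapply_apply, mon_apply hi hj]
  have key : ∀ n ∈ Finset.range (i + 1), ∀ m ∈ Finset.range (j + 1),
      D.mon n m p * D.mon (i - n) (j - m) q =
        if (n = p.1 ∧ m = p.2) ∧ (i = s.1 ∧ j = s.2) then 1 else 0 := by
    intro n hn m hm
    have := Finset.mem_range.1 hn
    have := Finset.mem_range.1 hm
    rw [mon_apply (by omega) (by omega), mon_apply (by omega) (by omega)]
    split_ifs <;> first | (exfalso; omega) | simp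
  by_cases hij : i = s.1 ∧ j = s.2
  · rw [if_pos hij, Finset.sum_eq_single (p.1 : ℕ), Finset.sum_eq_single (p.2 : ℕ)]
    · rw [key _ (by simp; omega) _ (by simp; omega), if_pos ⟨⟨rfl, rfl⟩, hij⟩, hij.1, hij.2,
        show (s.1 - p.1 : ℕ) = q.1 by omega]
    · intro m hm hne
      rw [key _ (by simp; omega) _ hm, if_neg (by tauto), smul_zero]
    · intro h
      simp only [Finset.mem_range] at h
      omega
    · intro n hn hne
      refine Finset.sum_eq_zero fun m hm => ?_
      rw [key _ hn _ hm, if_neg (by tauto), smul_zero]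
    · intro h
      simp only [Finset.mem_range] at h
      omega
  · rw [if_neg hij, smul_zero]
    refine Finset.sum_eq_zero fun n hn => Finset.sum_eq_zero fun m hm => ?_
    rw [key _ hn _ hm, if_neg (by tauto), smul_zero]

/-- Each monomial of degree at least 2 has in its coproduct a term of positive degree on both sides
with nonzero coefficient, while a primitive element has no such terms. In degree 0 primitivity reads
c = 2c. -/
lemma mem_grading_one_of_primitive {r : D.Nic}
    (hr : D.nichols.comul r = r ⊗ₜ D.nichols.one + D.nichols.one ⊗ₜ r) :
    r ∈ D.nicholsGrading 1 := by
  have hc : ∀ p q, D.coeff₂ p q (D.nichols.comul r) =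
      r p * D.mon 0 0 q + D.mon 0 0 p * r q := by
    intro p q
    rw [hr, map_add, coeff₂_tmul, coeff₂_tmul, one_eq]
  rw [nicholsGrading_eq, Finsupp.mem_supported']
  rintro ⟨⟨i, hi⟩, ⟨j, hj⟩⟩ hij
  simp only [Set.mem_ofPred_eq] at hij
  have h1 := D.two_le_r₁
  have h2 := D.two_le_r₂
  have split : ∀ n m n' m' : ℕ, ∀ (hn : i = n + n') (hm : j = m + m'), n + m ≠ 0 → n' + m' ≠ 0 →
      qBinom (D.χ₁ D.g₁) i n * qBinom (D.χ₂ D.g₂) j m * D.χ₂ D.g₁ ^ (n' * m) ≠ 0 →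
      r (⟨i, hi⟩, ⟨j, hj⟩) = 0 := by
    intro n m n' m' hn hm h h' hne
    have e := hc (⟨n, by omega⟩, ⟨m, by omega⟩) (⟨n', by omega⟩, ⟨m', by omega⟩)
    rw [coeff₂_comul _ _ (⟨i, hi⟩, ⟨j, hj⟩) hn hm, mon_apply D.r₁_pos D.r₂_pos,
      mon_apply D.r₁_pos D.r₂_pos, if_neg (by simp only; omega), if_neg (by simp only; omega),
      mul_zero, zero_mul, add_zero] at e
    exact (mul_eq_zero.1 e).resolve_left hne
  rcases Nat.eq_zero_or_pos i with rfl | hi0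
  · rcases Nat.eq_zero_or_pos j with rfl | hj0
    · have e := hc (⟨0, hi⟩, ⟨0, hj⟩) (⟨0, hi⟩, ⟨0, hj⟩)
      rw [coeff₂_comul _ _ (⟨0, hi⟩, ⟨0, hj⟩) rfl rfl] at e
      simpa [mon_apply D.r₁_pos D.r₂_pos, qBinom] using e
    -- The coefficient of x₂ ⊗ x₂ʲ⁻¹ is (j)_q for q = χ₂(g₂), nonzero since 0 < j < r₂. The pure
    -- powers of x₁ are treated alike, and a mixed monomial is split as x₁ⁱ ⊗ x₂ʲ with coefficient
    -- 1.
    · refine split 0 1 0 (j - 1) (by omega) (by omega) (by omega) (by omega) ?_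
      simpa [qBinom, qBinom_one] using qNat_ne_zero D.prim₂ hj0 hj
  · rcases Nat.eq_zero_or_pos j with rfl | hj0
    · refine split 1 0 (i - 1) 0 (by omega) (by omega) (by omega) (by omega) ?_
      simpa [qBinom, qBinom_one] using qNat_ne_zero D.prim₁ hi0 hi
    · refine split i 0 0 j (by omega) (by omega) (by omega) (by omega) ?_
      simp [qBinom_self, qBinom_zero_right]

lemma grading_zero : D.nicholsGrading 0 = Submodule.span K {D.nichols.one} := by
  refine le_antisymm (grading_induction fun i j hij => ?_) (Submodule.span_le.2 ?_)
  · obtain ⟨rfl, rfl⟩ : i = 0 ∧ j = 0 := by omega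
    exact Submodule.subset_span rfl
  · rintro _ rfl
    exact mon_mem_grading 0 0

lemma grading_one : D.nicholsGrading 1 = Submodule.span K {D.mon 1 0, D.mon 0 1} := by
  refine le_antisymm (grading_induction fun i j hij => ?_) (Submodule.span_le.2 ?_)
  · obtain ⟨rfl, rfl⟩ | ⟨rfl, rfl⟩ : (i = 1 ∧ j = 0) ∨ (i = 0 ∧ j = 1) := by omega
    · exact Submodule.subset_span (by simp)
    · exact Submodule.subset_span (by simp)
  · rintro _ (rfl | rfl)
    · exact mon_mem_grading 1 0
    · exact mon_mem_grading 0 1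

lemma isNicholsAlgebra_nichols :
    D.IsNicholsAlgebra D.nichols (D.mon 1 0) (D.mon 0 1) D.nicholsGrading where
  bialgebra := isBraidedBialgebra_nichols
  internal := isInternal_grading
  act_mem n g r hr := by
    refine grading_induction (S := (D.nicholsGrading n).comap
      (D.nichols.act (MonoidAlgebra.of K Γ g))) (fun i j hij => ?_) hr
    subst hij
    rw [Submodule.mem_comap, act_mon]
    exact Submodule.smul_mem _ _ (mon_mem_grading i j)
  coact_mem n r hr := by
    refine grading_induction (S := (LinearMap.range (TensorProduct.map
      (LinearMap.id (R := K) (M := MonoidAlgebra K Γ)) (D.nicholsGrading n).subtype)).comap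
        D.nichols.coact) (fun i j hij => ?_) hr
    subst hij
    rw [Submodule.mem_comap, coact_mon]
    exact ⟨MonoidAlgebra.of K Γ _ ⊗ₜ ⟨_, mon_mem_grading i j⟩, rfl⟩
  mul_mem m n r hr s hs := by
    refine grading_induction (S := (D.nicholsGrading (m + n)).comap
      (D.nichols.mul ∘ₗ (TensorProduct.mk K _ _).flip s)) (fun i j hij => ?_) hr
    refine grading_induction (S := (D.nicholsGrading (m + n)).comap
      (D.nichols.mul ∘ₗ TensorProduct.mk K _ _ (D.mon i j))) (fun k l hkl => ?_) hs
    rw [Submodule.mem_comap, LinearMap.comp_apply, TensorProduct.mk_apply, mul_mon,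
      show m + n = (i + k) + (j + l) by omega]
    exact Submodule.smul_mem _ _ (mon_mem_grading _ _)
  comul_mem n r hr := by
    refine grading_induction (S := (⨆ p ∈ Finset.HasAntidiagonal.antidiagonal n,
      LinearMap.range (TensorProduct.map (D.nicholsGrading p.1).subtype
        (D.nicholsGrading p.2).subtype)).comap D.nichols.comul) (fun i j hij => ?_) hr
    subst hij
    rw [Submodule.mem_comap]
    by_cases h : i < D.r₁ ∧ j < D.r₂
    · rw [comul_mon D h.1 h.2]
      refine Submodule.sum_mem _ fun a ha => Submodule.sum_mem _ fun b hb =>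
        Submodule.smul_mem _ _ ?_
      have := Finset.mem_range.1 ha
      have := Finset.mem_range.1 hb
      refine Submodule.mem_iSup_of_mem (a + b, (i - a) + (j - b)) (Submodule.mem_iSup_of_mem ?_ ?_)
      · rw [Finset.HasAntidiagonal.mem_antidiagonal]
        omega
      · exact ⟨⟨_, mon_mem_grading a b⟩ ⊗ₜ ⟨_, mon_mem_grading (i - a) (j - b)⟩, rfl⟩
    · rw [mon_eq_zero D h, map_zero]
      exact Submodule.zero_mem _
  degree_zero := grading_zero
  degree_one := grading_one
  independent := by
    have h1 := D.two_le_r₁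
    have h2 := D.two_le_r₂
    rw [LinearIndependent.pair_iff]
    intro s t h
    have e1 := DFunLike.congr_fun h (⟨1, h1⟩, ⟨0, D.r₂_pos⟩)
    have e2 := DFunLike.congr_fun h (⟨0, D.r₁_pos⟩, ⟨1, h2⟩)
    simp only [Finsupp.add_apply, Finsupp.smul_apply, Finsupp.zero_apply,
      mon_apply (show 1 < D.r₁ from h1) D.r₂_pos, mon_apply D.r₁_pos (show 1 < D.r₂ from h2)] at e1 e2
    exact ⟨by simpa using e1, by simpa using e2⟩
  act_x₁ g := by simpa using D.act_mon g 1 0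
  act_x₂ g := by simpa using D.act_mon g 0 1
  coact_x₁ := by simpa using D.coact_mon 1 0
  coact_x₂ := by simpa using D.coact_mon 0 1
  primitive r := by
    refine ⟨mem_grading_one_of_primitive, fun hr => ?_⟩
    have h1 := D.two_le_r₁
    have h2 := D.two_le_r₂
    refine grading_induction (S := LinearMap.eqLocus D.nichols.comul
      ((TensorProduct.mk K _ _).flip D.nichols.one + TensorProduct.mk K _ _ D.nichols.one))
      (fun i j hij => ?_) hr
    rw [LinearMap.mem_eqLocus]
    obtain ⟨rfl, rfl⟩ | ⟨rfl, rfl⟩ : (i = 1 ∧ j = 0) ∨ (i = 0 ∧ j = 1) := by omega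
    · rw [comul_mon D h1 D.r₂_pos]
      simp [Finset.sum_range_succ, qBinom, one_eq, add_comm]
    · rw [comul_mon D D.r₁_pos h2]
      simp [Finset.sum_range_succ, qBinom, one_eq, add_comm]
  generated S h0 hx₁ hx₂ hmul := by
    have h1 : ∀ i, D.mon i 0 ∈ S := by
      intro i
      induction i with
      | zero => exact h0
      | succ i ih => simpa [mul_mon, add_comm] using hmul _ hx₁ _ ih
    have h2 : ∀ j, D.mon 0 j ∈ S := by
      intro j
      induction j with
      | zero => exact h0
      | succ j ih => simpa [mul_mon, add_comm] using hmul _ hx₂ _ ih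
    have h3 : ∀ i j, D.mon i j ∈ S := fun i j => by simpa [mul_mon] using hmul _ (h1 i) _ (h2 j)
    rw [eq_top_iff, ← Finsupp.basisSingleOne.span_eq, Submodule.span_le]
    rintro _ ⟨p, rfl⟩
    have := h3 p.1 p.2
    rw [mon_of_lt D p.1.2 p.2.2] at this
    simpa using this

end QuantumPlane

namespace QuantumPlane
open QPlane
variable {K Γ : Type*} [Field K] [CommGroup Γ] {D : QuantumPlane K Γ}

/-! ### The counit of a product -/

/-- The counit of `A` as a linear form on the universal algebra. -/
def cogCounit (P Q : D.Par) : D.Cog P.1 Q.1 →ₗ[K] K :=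
  D.nichols.radford.counit ∘ₗ (toCog P Q).symm.toLinearMap

lemma cogCounit_toCog (P Q : D.Par) (x : D.Bos) :
    cogCounit P Q (toCog P Q x) = D.nichols.radford.counit x := by
  simp [cogCounit]

lemma form_tmul (P Q : D.Par) (x y : D.Bos) :
    form P Q (x ⊗ₜ y) = cogCounit P Q (toCog P Q x * toCog P Q y) := by
  rw [← toCog_cmul, cogCounit_toCog]
  rfl

lemma toCog_regG (P Q : D.Par) (g : Γ) (x : D.Bos) :
    toCog P Q (D.regG g x) = (Cog.univ D P.1 Q.1).G g * toCog P Q x := by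
  refine LinearMap.congr_fun (f := (toCog P Q).toLinearMap ∘ₗ D.regG g)
    (g := LinearMap.mulLeft K ((Cog.univ D P.1 Q.1).G g) ∘ₗ (toCog P Q).toLinearMap)
    (bos_ext fun i hi j hj h => ?_) x
  simp only [LinearMap.comp_apply, LinearMap.mulLeft_apply, regG_bas, map_smul, LinearEquiv.coe_coe]
  simp only [toCog_apply, Rep.mono_bas _ hi hj]
  rw [← mul_assoc, Rep.comm_mon, smul_mul_assoc, map_mul, mul_assoc _ (Rep.G _ g)]

lemma counit_regG (g : Γ) (x : D.Bos) :
    D.nichols.radford.counit (D.regG g x) = D.nichols.radford.counit x := by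
  refine LinearMap.congr_fun (f := D.nichols.radford.counit ∘ₗ D.regG g)
    (bos_ext fun i hi j hj h => ?_) x
  simp only [LinearMap.comp_apply, regG_bas, map_smul, radford_counit_bas D hi hj]
  split_ifs with h0
  · simp [h0.1, h0.2]
  · simp

lemma cogCounit_G_mul (P Q : D.Par) (g : Γ) (z : D.Cog P.1 Q.1) :
    cogCounit P Q ((Cog.univ D P.1 Q.1).G g * z) = cogCounit P Q z := by
  obtain ⟨x, rfl⟩ := (toCog P Q).surjective z
  rw [← toCog_regG, cogCounit_toCog, cogCounit_toCog, counit_regG]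

lemma cogCounit_mul_G (P Q : D.Par) (g : Γ) (z : D.Cog P.1 Q.1) :
    cogCounit P Q (z * (Cog.univ D P.1 Q.1).G g) = cogCounit P Q z := by
  obtain ⟨x, rfl⟩ := (toCog P Q).surjective z
  rw [← toCog_mulG, cogCounit_toCog, cogCounit_toCog, counit_mulG]

lemma cogCounit_mon (P Q : D.Par) {i j : ℕ} (hi : i < D.r₁) (hj : j < D.r₂) :
    cogCounit P Q ((Cog.univ D P.1 Q.1).x₁ ^ i * (Cog.univ D P.1 Q.1).x₂ ^ j) =
      if i = 0 ∧ j = 0 then 1 else 0 := by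
  have := cogCounit_toCog P Q (D.bas i j 1)
  rwa [toCog_apply, Rep.mono_bas _ hi hj, map_one, mul_one, radford_counit_bas D hi hj] at this

lemma cogCounit_one (P Q : D.Par) : cogCounit P Q 1 = 1 := by
  simpa using cogCounit_mon P Q D.r₁_pos D.r₂_pos

lemma cogCounit_ext (P Q : D.Par) {f g : D.Cog P.1 Q.1 →ₗ[K] K}
    (h : ∀ i < D.r₁, ∀ j < D.r₂, ∀ k, f ((Cog.univ D P.1 Q.1).x₁ ^ i *
      (Cog.univ D P.1 Q.1).x₂ ^ j * (Cog.univ D P.1 Q.1).G k) = g ((Cog.univ D P.1 Q.1).x₁ ^ i *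
      (Cog.univ D P.1 Q.1).x₂ ^ j * (Cog.univ D P.1 Q.1).G k)) (z : D.Cog P.1 Q.1) : f z = g z := by
  obtain ⟨x, rfl⟩ := (toCog P Q).surjective z
  refine LinearMap.congr_fun (f := f ∘ₗ (toCog P Q).toLinearMap)
    (g := g ∘ₗ (toCog P Q).toLinearMap) (bos_ext fun i hi j hj k => ?_) x
  simpa [toCog_apply, Rep.mono_bas _ hi hj] using h i hi j hj k

/-- With equal parameters c₁ the power x₁^r₁ is c₁(1 - g₁^r₁), which the counit does not see. So a
left factor x₁ kills it even when the exponent overflows. -/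
lemma cogCounit_x₁_mul {P Q : D.Par} (hc : P.1.c₁ = Q.1.c₁) (z : D.Cog P.1 Q.1) :
    cogCounit P Q ((Cog.univ D P.1 Q.1).x₁ * z) = 0 := by
  refine cogCounit_ext P Q (f := cogCounit P Q ∘ₗ LinearMap.mulLeft K (Cog.univ D P.1 Q.1).x₁)
    (g := 0) (fun i hi j hj k => ?_) z
  rw [LinearMap.comp_apply, LinearMap.mulLeft_apply, ← mul_assoc, cogCounit_mul_G, ← mul_assoc,
    ← pow_succ', LinearMap.zero_apply]
  by_cases h : i + 1 < D.r₁
  · rw [cogCounit_mon P Q h hj, if_neg (by omega)]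
  · rw [show i + 1 = D.r₁ by omega, Rep.pow₁, sub_mul, smul_mul_assoc, smul_mul_assoc, map_sub,
      map_smul, map_smul, cogCounit_G_mul, one_mul, hc, sub_self]

lemma cogCounit_mul_x₂ {P Q : D.Par} (hc : P.1.c₂ = Q.1.c₂) (z : D.Cog P.1 Q.1) :
    cogCounit P Q (z * (Cog.univ D P.1 Q.1).x₂) = 0 := by
  refine cogCounit_ext P Q (f := cogCounit P Q ∘ₗ LinearMap.mulRight K (Cog.univ D P.1 Q.1).x₂)
    (g := 0) (fun i hi j hj k => ?_) z
  rw [LinearMap.comp_apply, LinearMap.mulRight_apply, mul_assoc, Rep.comm₂, mul_smul_comm, map_smul,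
    ← mul_assoc, cogCounit_mul_G, mul_assoc, ← pow_succ, LinearMap.zero_apply]
  by_cases h : j + 1 < D.r₂
  · rw [cogCounit_mon P Q hi h, if_neg (by omega), smul_zero]
  · rw [show j + 1 = D.r₂ by omega, Rep.pow₂, mul_sub, mul_smul_comm, mul_smul_comm, map_sub,
      map_smul, map_smul, cogCounit_mul_G, mul_one, hc, sub_self, smul_zero]

lemma cogCounit_mon_eq_zero₁ {P Q : D.Par} (hc : P.1.c₁ = Q.1.c₁) {i : ℕ} (hi : i ≠ 0)
    (z : D.Cog P.1 Q.1) : cogCounit P Q ((Cog.univ D P.1 Q.1).x₁ ^ i * z) = 0 := by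
  obtain ⟨i, rfl⟩ := Nat.exists_eq_succ_of_ne_zero hi
  rw [Nat.succ_eq_add_one, pow_succ', mul_assoc, cogCounit_x₁_mul hc]

lemma cogCounit_mon_eq_zero₂ {P Q : D.Par} (hc : P.1.c₂ = Q.1.c₂) {j : ℕ} (hj : j ≠ 0)
    (z : D.Cog P.1 Q.1) : cogCounit P Q (z * (Cog.univ D P.1 Q.1).x₂ ^ j) = 0 := by
  obtain ⟨j, rfl⟩ := Nat.exists_eq_succ_of_ne_zero hj
  rw [Nat.succ_eq_add_one, pow_succ, ← mul_assoc, cogCounit_mul_x₂ hc]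

lemma form_mon (P Q : D.Par) {i j k l : ℕ} (hi : i < D.r₁) (hj : j < D.r₂) (hk : k < D.r₁)
    (hl : l < D.r₂) : form P Q (D.bas i j 1 ⊗ₜ D.bas k l 1) =
      cogCounit P Q ((Cog.univ D P.1 Q.1).x₁ ^ i * (Cog.univ D P.1 Q.1).x₂ ^ j *
        ((Cog.univ D P.1 Q.1).x₁ ^ k * (Cog.univ D P.1 Q.1).x₂ ^ l)) := by
  rw [form_tmul, toCog_apply, toCog_apply, Rep.mono_bas _ hi hj, Rep.mono_bas _ hk hl, map_one,
    mul_one, mul_one]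

/-! ### The cocycles `γ₁`, `γ₂`, `γ_a` -/

lemma extend_bas (v : D.Nic ⊗[K] D.Nic →ₗ[K] K) (i j k l : ℕ) (h h' : Γ) :
    D.nichols.extend v (D.bas i j h ⊗ₜ D.bas k l h') =
      (D.χ₁ h⁻¹ ^ i * D.χ₂ h⁻¹ ^ j) * v (D.mon i j ⊗ₜ D.mon k l) := by
  have := D.actT_mon h⁻¹ i j
  simp only [MonoidAlgebra.of_apply] at this
  simp only [BraidedData.extend, bas, LinearMap.comp_apply, TensorProduct.map_tmul,
    LinearMap.id_apply, MonoidAlgebra.of_apply, MonoidAlgebra.antipode_single,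
    CommSemiring.antipode_eq_id, LinearEquiv.coe_coe, TensorProduct.comm_tmul,
    MonoidAlgebra.counit_single, CommSemiring.counit_apply, TensorProduct.rid_tmul, one_smul, this,
    ← TensorProduct.smul_tmul', map_smul, smul_eq_mul]

/-- Forms of products do not see Γ at the outer ends, so they are the H-bilinear extensions of their
restrictions to R ⊗ R. -/
lemma extend_form (P Q : D.Par) : D.nichols.extend (form P Q ∘ₗ D.incl₂) = form P Q := by
  refine bos₂_ext fun i hi j hj h k hk l hl h' => ?_
  rw [extend_bas, LinearMap.comp_apply, incl₂_mon, form_mon P Q hi hj hk hl, form_tmul, toCog_apply,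
    toCog_apply, Rep.mono_bas _ hi hj, Rep.mono_bas _ hk hl]
  have h1 := Rep.comm_mon (Cog.univ D P.1 Q.1) h i j
  have h2 : (D.χ₁ h⁻¹ ^ i * D.χ₂ h⁻¹ ^ j) * (D.χ₁ h ^ i * D.χ₂ h ^ j) = 1 := by
    rw [mul_mul_mul_comm, ← mul_pow, ← mul_pow, ← map_mul, ← map_mul]
    simp
  have h3 := congrArg ((D.χ₁ h⁻¹ ^ i * D.χ₂ h⁻¹ ^ j) • ·) h1
  simp only [smul_smul, h2, one_smul] at h3
  rw [← h3, smul_mul_assoc, map_smul, mul_assoc (Rep.G _ h), cogCounit_G_mul,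
    ← mul_assoc _ _ (Rep.G _ h'), cogCounit_mul_G, smul_eq_mul]

lemma eq_form_of_incl₂ {P Q : D.Par} {f : ℕ → ℕ → ℕ → ℕ → K}
    (h : ∀ i < D.r₁, ∀ j < D.r₂, ∀ k < D.r₁, ∀ l < D.r₂,
      f i j k l = form P Q (D.bas i j 1 ⊗ₜ D.bas k l 1)) :
    D.nichols.extend (D.lin₂ f) = form P Q := by
  rw [← extend_form]
  congr 1
  exact nic₂_ext fun i hi j hj k hk l hl => by
    rw [lin₂_mon D _ hi hj hk hl, h i hi j hj k hk l hl]
    rfl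

lemma form_mon_of_c₁₂ {P Q : D.Par} (hP : P.1.c₁₂ = 0) (hQ : Q.1.c₁₂ = 0) {i j k l : ℕ}
    (hi : i < D.r₁) (hj : j < D.r₂) (hk : k < D.r₁) (hl : l < D.r₂) :
    form P Q (D.bas i j 1 ⊗ₜ D.bas k l 1) = D.χ₁ D.g₂ ^ (j * k) *
      cogCounit P Q ((Cog.univ D P.1 Q.1).x₁ ^ (i + k) * (Cog.univ D P.1 Q.1).x₂ ^ (j + l)) := by
  rw [form_mon P Q hi hj hk hl, mul_assoc, ← mul_assoc (Rep.x₂ _ ^ j), x₂_pow_mul_x₁_pow hP hQ,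
    smul_mul_assoc, mul_smul_comm, map_smul, smul_eq_mul, pow_add, pow_add]
  simp only [mul_assoc]

/-- P and Q differ only in c₁, and there is no linking, so monomials may be reordered up to a
scalar. Any x₂ gives zero, and a pure power of x₁ contributes beyond degree 0 only when i + k = r₁,
through x₁^r₁ = P.c₁. -/
lemma gamma₁_eq_form {P Q : D.Par} (hP : P.1.c₁₂ = 0) (hQ : Q.1.c₁₂ = 0) (h₂ : P.1.c₂ = Q.1.c₂)
    (hQ₁ : Q.1.c₁ = 0) : D.gamma₁ P.1.c₁ = form P Q := by
  refine eq_form_of_incl₂ fun i hi j hj k hk l hl => ?_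
  rw [form_mon_of_c₁₂ hP hQ hi hj hk hl]
  by_cases hjl : j + l = 0
  · obtain ⟨rfl, rfl⟩ : j = 0 ∧ l = 0 := by omega
    by_cases h : i + k < D.r₁
    · rw [cogCounit_mon P Q h hj, if_neg (by omega), zero_mul, pow_zero, one_mul]
      exact if_congr (by omega) rfl rfl
    · obtain ⟨n, hn⟩ := Nat.exists_eq_add_of_le (not_lt.1 h)
      have h0 := cogCounit_mon P Q (i := n) (by omega) hj
      rw [pow_zero, mul_one] at h0
      rw [hn, pow_add, Rep.pow₁, hQ₁, zero_smul, sub_zero, smul_mul_assoc, one_mul, smul_mul_assoc,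
        map_smul, add_zero, pow_zero, mul_one, h0, zero_mul, pow_zero, one_mul, smul_eq_mul]
      by_cases hn0 : n = 0
      · rw [if_pos (by omega), if_pos ⟨hn0, rfl⟩, mul_one]
      · rw [if_neg (by omega), if_neg (by omega), if_neg (by omega), mul_zero]
  · rw [cogCounit_mon_eq_zero₂ h₂ hjl, mul_zero, if_neg (by omega), if_neg (by omega)]

lemma gamma₂_eq_form {P Q : D.Par} (hP : P.1.c₁₂ = 0) (hQ : Q.1.c₁₂ = 0) (h₁ : P.1.c₁ = Q.1.c₁)
    (hQ₂ : Q.1.c₂ = 0) : D.gamma₂ P.1.c₂ = form P Q := by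
  refine eq_form_of_incl₂ fun i hi j hj k hk l hl => ?_
  rw [form_mon_of_c₁₂ hP hQ hi hj hk hl]
  by_cases hik : i + k = 0
  · obtain ⟨rfl, rfl⟩ : i = 0 ∧ k = 0 := by omega
    by_cases h : j + l < D.r₂
    · rw [cogCounit_mon P Q hi h, if_neg (by omega), mul_zero, pow_zero, one_mul]
      exact if_congr (by omega) rfl rfl
    · obtain ⟨n, hn⟩ := Nat.exists_eq_add_of_le (not_lt.1 h)
      have h0 := cogCounit_mon P Q (j := n) hi (by omega)
      rw [pow_zero, one_mul] at h0
      rw [hn, pow_add _ D.r₂ n, Rep.pow₂, hQ₂, zero_smul, sub_zero, smul_mul_assoc, one_mul,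
        mul_smul_comm, map_smul, add_zero, pow_zero, one_mul, h0, mul_zero, pow_zero, one_mul, smul_eq_mul]
      by_cases hn0 : n = 0
      · rw [if_pos (by omega), if_pos ⟨rfl, hn0⟩, mul_one]
      · rw [if_neg (by omega), if_neg (by omega), if_neg (by omega), mul_zero]
  · rw [cogCounit_mon_eq_zero₁ h₁ hik, mul_zero, if_neg (by omega), if_neg (by omega)]

lemma x₂_mul_x₁_pow {P Q : Params K} (hQ : Q.c₁₂ = 0) {U : Type*} [Ring U] [Algebra K U]
    (u : D.Rep P Q U) (k : ℕ) : u.x₂ * u.x₁ ^ k = D.χ₁ D.g₂ ^ k • (u.x₁ ^ k * u.x₂) +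
      (P.c₁₂ * qNat (D.χ₁ D.g₂) k) • u.x₁ ^ (k - 1) := by
  have hl : u.x₂ * u.x₁ = D.χ₁ D.g₂ • (u.x₁ * u.x₂) + P.c₁₂ • 1 := by simpa [hQ] using u.link
  induction k with
  | zero => simp [qNat]
  | succ k ih =>
    have e : (P.c₁₂ * qNat (D.χ₁ D.g₂) k) • (u.x₁ ^ (k - 1) * u.x₁) =
        (P.c₁₂ * qNat (D.χ₁ D.g₂) k) • u.x₁ ^ k := by
      obtain rfl | h0 := Nat.eq_zero_or_pos k
      · simp [qNat]
      · rw [← pow_succ, Nat.sub_add_cancel h0]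
    have e' : qNat (D.χ₁ D.g₂) (k + 1) = qNat (D.χ₁ D.g₂) k + D.χ₁ D.g₂ ^ k := by
      rw [qNat_add]; simp [qNat]
    rw [pow_succ, ← mul_assoc, ih, add_mul, smul_mul_assoc, smul_mul_assoc, mul_assoc, hl, mul_add,
      mul_smul_comm, mul_smul_comm, mul_one, smul_add, smul_smul, smul_smul, e,
      ← mul_assoc, e', Nat.add_sub_cancel, pow_succ, add_assoc, ← add_smul]
    congr 2
    ring

/-- Moving one x₂ through x₁ᵏ leaves a term ending in x₂, invisible to the counit, and c₁₂(k)_q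
x₁ᵏ⁻¹. Iteration builds up the q-factorial. -/
lemma cogCounit_x₂_pow_mul_x₁_pow {P Q : D.Par} (h₁ : P.1.c₁ = Q.1.c₁) (h₂ : P.1.c₂ = Q.1.c₂)
    (hQ : Q.1.c₁₂ = 0) (j k : ℕ) :
    cogCounit P Q ((Cog.univ D P.1 Q.1).x₂ ^ j * (Cog.univ D P.1 Q.1).x₁ ^ k) =
      if j = k then qFact (D.χ₁ D.g₂) j * P.1.c₁₂ ^ j else 0 := by
  induction j generalizing k with
  | zero =>
    rcases eq_or_ne k 0 with rfl | hk
    · simp [cogCounit_one, qFact]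
    · have := cogCounit_mon_eq_zero₁ h₁ hk 1
      rw [mul_one] at this
      rw [pow_zero, one_mul, this, if_neg hk.symm]
  | succ j ih =>
    rw [pow_succ, mul_assoc, x₂_mul_x₁_pow hQ, mul_add, mul_smul_comm, mul_smul_comm, map_add,
      map_smul, map_smul, ← mul_assoc, cogCounit_mul_x₂ h₂, smul_zero, zero_add, ih, smul_eq_mul]
    rcases Nat.eq_zero_or_pos k with rfl | hk
    · simp [qNat]
    · obtain ⟨k, rfl⟩ : ∃ m, k = m + 1 := ⟨k - 1, by omega⟩
      rw [Nat.add_sub_cancel]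
      by_cases hjk : j = k
      · subst hjk
        rw [if_pos rfl, if_pos rfl, qFact_succ]
        ring
      · rw [if_neg hjk, if_neg (by omega), mul_zero]

lemma gamma₁₂_eq_form {P Q : D.Par} (h₁ : P.1.c₁ = Q.1.c₁) (h₂ : P.1.c₂ = Q.1.c₂)
    (hQ : Q.1.c₁₂ = 0) : D.gamma₁₂ P.1.c₁₂ = form P Q := by
  refine eq_form_of_incl₂ fun i hi j hj k hk l hl => ?_
  rw [form_mon P Q hi hj hk hl]
  rcases eq_or_ne i 0 with rfl | hi0
  · rcases eq_or_ne l 0 with rfl | hl0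
    · rw [pow_zero, pow_zero, one_mul, mul_one, cogCounit_x₂_pow_mul_x₁_pow h₁ h₂ hQ]
      refine if_congr (by omega) ?_ rfl
      -- The q-factorial of the computation is taken at χ₁(g₂), that of the definition at χ₁(g₁).
      -- They agree when the linking parameter is nonzero, and otherwise only the term j = 0
      -- remains.
      by_cases hc : P.1.c₁₂ = 0
      · rcases eq_or_ne j 0 with rfl | hj0
        · simp [qFact]
        · simp [hc, hj0]
      · rw [(χ_link (P.2.cond₁₂ hc)).1]
    · rw [← mul_assoc, cogCounit_mon_eq_zero₂ h₂ hl0, if_neg (by omega)]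
  · rw [mul_assoc, cogCounit_mon_eq_zero₁ h₁ hi0, if_neg (by omega)]

/-! ### The cocycle `α` -/

section Alpha

variable {a₁ a₂ a : K}

lemma IsLiftingDatum.admissible (hB : D.IsLiftingDatum a₁ a₂ a) : D.Admissible ⟨a₁, a₂, a⟩ :=
  ⟨fun h => (hB.cond₁ h).2, fun h => (hB.cond₂ h).2, fun h => (hB.cond₁₂ h).2⟩

/-- The parameters `(a₁, a₂, a)`. -/
abbrev IsLiftingDatum.par (hB : D.IsLiftingDatum a₁ a₂ a) : D.Par := ⟨⟨a₁, a₂, a⟩, hB.admissible⟩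

/-- The parameters `(a₁, a₂, 0)`. -/
abbrev IsLiftingDatum.par₁₂ (hB : D.IsLiftingDatum a₁ a₂ a) : D.Par :=
  ⟨⟨a₁, a₂, 0⟩, hB.admissible.cond₁, hB.admissible.cond₂, by simp⟩

/-- The parameters `(0, a₂, 0)`. -/
abbrev IsLiftingDatum.par₂ (hB : D.IsLiftingDatum a₁ a₂ a) : D.Par :=
  ⟨⟨0, a₂, 0⟩, by simp, hB.admissible.cond₂, by simp⟩

lemma IsLiftingDatum.gamma₁_eq (hB : D.IsLiftingDatum a₁ a₂ a) :
    D.gamma₁ a₁ = form hB.par₁₂ hB.par₂ :=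
  gamma₁_eq_form (P := hB.par₁₂) (Q := hB.par₂) rfl rfl rfl rfl

lemma IsLiftingDatum.convA_gamma (hB : D.IsLiftingDatum a₁ a₂ a) :
    D.convA (D.gamma₁ a₁) (D.gamma₂ a₂) = form hB.par₁₂ D.zeroPar := by
  rw [hB.gamma₁_eq, show D.gamma₂ a₂ = form hB.par₂ D.zeroPar from
    gamma₂_eq_form (P := hB.par₂) (Q := D.zeroPar) rfl rfl rfl rfl]
  exact convForm_form _ _ _

/-- The convolution telescopes along (a₁, a₂, a), (a₁, a₂, 0), (0, a₂, 0), (0, 0, 0). -/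
lemma IsLiftingDatum.alpha_eq (hB : D.IsLiftingDatum a₁ a₂ a) :
    D.alpha a₁ a₂ a = form hB.par D.zeroPar := by
  rw [alpha, hB.convA_gamma, show D.gamma₁₂ a = form hB.par hB.par₁₂ from
    gamma₁₂_eq_form (P := hB.par) (Q := hB.par₁₂) rfl rfl rfl]
  exact convForm_form _ _ _

end Alpha

lemma convForm_comp_cmul (P S Q : D.Par) (f : D.Bos →ₗ[K] K) :
    convForm D.nichols.radford.comul₂ (form P S) (f ∘ₗ cmul S Q) = f ∘ₗ cmul P Q := by
  rw [← cmul_eq_conv_left P S Q, comp_conv, comp_lid, ← conv_comp]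
  rfl

lemma cmul_grp_left (P Q : D.Par) (g : Γ) (x : D.Bos) :
    cmul P Q (D.bas 0 0 g ⊗ₜ x) = D.regG g x := by
  apply (toCog P Q).injective
  rw [toCog_cmul, toCog_regG, toCog_apply, Rep.mono_bas _ D.r₁_pos D.r₂_pos]
  simp

lemma cmul_grp_right (P Q : D.Par) (g : Γ) (x : D.Bos) :
    cmul P Q (x ⊗ₜ D.bas 0 0 g) = D.mulG g x := by
  apply (toCog P Q).injective
  rw [toCog_cmul, toCog_mulG, toCog_apply, toCog_apply, Rep.mono_bas _ D.r₁_pos D.r₂_pos]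
  simp

lemma form_bilinear (P Q : D.Par) (h k : MonoidAlgebra K Γ) (x y : D.Bos) :
    form P Q (D.nichols.radford.mul (D.nichols.inclH h ⊗ₜ x) ⊗ₜ
      D.nichols.radford.mul (y ⊗ₜ D.nichols.inclH k)) =
      Coalgebra.counit (R := K) h * Coalgebra.counit (R := K) k * form P Q (x ⊗ₜ y) := by
  have hg : ∀ g : Γ, D.nichols.inclH (MonoidAlgebra.of K Γ g) = D.bas 0 0 g := fun g => rfl
  induction h using MonoidAlgebra.induction_on with
  | of g =>
    induction k using MonoidAlgebra.induction_on with
    | of g' =>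
      rw [hg, hg, radford_mul, cmul_grp_left, cmul_grp_right, form_tmul, toCog_regG, toCog_mulG,
        mul_assoc, cogCounit_G_mul, ← mul_assoc, cogCounit_mul_G, ← form_tmul]
      simp
    | add a b ha hb =>
      simp only [map_add, TensorProduct.tmul_add, ha, hb, mul_add, add_mul]
    | smul c a ha =>
      simp only [map_smul, TensorProduct.tmul_smul, ha, smul_eq_mul]
      ring
  | add a b ha hb =>
    simp only [map_add, TensorProduct.add_tmul, ha, hb, add_mul]
  | smul c a ha =>
    simp only [map_smul, ← TensorProduct.smul_tmul', ha, smul_eq_mul]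
    ring

/-- Both sides of the cocycle identity are ε of the triple product of x, y, z for `cmul P 0`, so the
identity is associativity. -/
lemma isBilinearCocycle_form (P : D.Par) : D.nichols.radford.IsBilinearCocycle D.nichols.inclH
    (form P D.zeroPar) (form D.zeroPar P) where
  inv := isConvInv_form _ _
  cocycle x y z := by
    rw [radford_mul]
    refine (LinearMap.congr_fun (convForm_comp_cmul P D.zeroPar D.zeroPar
      (form P D.zeroPar ∘ₗ TensorProduct.mk K _ _ x)) (y ⊗ₜ z)).trans (Eq.trans ?_
      (LinearMap.congr_fun (convForm_comp_cmul P D.zeroPar D.zeroPar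
        (form P D.zeroPar ∘ₗ (TensorProduct.mk K _ _).flip z)) (x ⊗ₜ y)).symm)
    exact congrArg D.nichols.radford.counit (cmul_assoc P D.zeroPar x y z).symm
  unit_right x := congrArg D.nichols.radford.counit (cmul_one P D.zeroPar x)
  unit_left x := congrArg D.nichols.radford.counit (one_cmul P D.zeroPar x)
  bilinear := form_bilinear _ _

end QuantumPlane

namespace QuantumPlane
open QPlane
variable {K Γ : Type*} [Field K] [CommGroup Γ] {D : QuantumPlane K Γ}

/-! ### Convolution with forms over `R ⊗ R` -/

lemma comp_conv_lid {C M N : Type*} [AddCommMonoid C] [Module K C] [AddCommMonoid M] [Module K M]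
    [AddCommMonoid N] [Module K N] (Δ : C →ₗ[K] C ⊗[K] C) (v : C →ₗ[K] K) (m : C →ₗ[K] M)
    (f : M →ₗ[K] N) : f ∘ₗ conv Δ (TensorProduct.lid K M).toLinearMap v m =
      conv Δ (TensorProduct.lid K N).toLinearMap v (f ∘ₗ m) := by
  have h : f ∘ₗ (TensorProduct.lid K M).toLinearMap =
      (TensorProduct.lid K N).toLinearMap ∘ₗ TensorProduct.map LinearMap.id f := by ext; simp
  rw [comp_conv, h, ← conv_comp, LinearMap.id_comp]

lemma comp_conv_rid {C M N : Type*} [AddCommMonoid C] [Module K C] [AddCommMonoid M] [Module K M]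
    [AddCommMonoid N] [Module K N] (Δ : C →ₗ[K] C ⊗[K] C) (v : C →ₗ[K] K) (m : C →ₗ[K] M)
    (f : M →ₗ[K] N) : f ∘ₗ conv Δ (TensorProduct.rid K M).toLinearMap m v =
      conv Δ (TensorProduct.rid K N).toLinearMap (f ∘ₗ m) v := by
  have h : f ∘ₗ (TensorProduct.rid K M).toLinearMap =
      (TensorProduct.rid K N).toLinearMap ∘ₗ TensorProduct.map f LinearMap.id := by ext; simp
  rw [comp_conv, h, ← conv_comp, LinearMap.id_comp]

lemma conv_algebraMap {C A : Type*} [AddCommMonoid C] [Module K C] [Ring A] [Algebra K A]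
    (Δ : C →ₗ[K] C ⊗[K] C) (v : C →ₗ[K] K) (m : C →ₗ[K] A) :
    conv Δ (LinearMap.mul' K A) (Algebra.linearMap K A ∘ₗ v) m =
      conv Δ (TensorProduct.lid K A).toLinearMap v m := by
  have h : (TensorProduct.lid K A).toLinearMap =
      LinearMap.mul' K A ∘ₗ TensorProduct.map (Algebra.linearMap K A) LinearMap.id := by ext; simp
  rw [h, ← conv_comp, LinearMap.id_comp]

lemma conv_form_left {M : Type*} [AddCommMonoid M] [Module K M] (P S Q : D.Par)
    (f : D.Bos →ₗ[K] M) : conv D.nichols.comul₂ (TensorProduct.lid K M).toLinearMap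
      (form P S ∘ₗ D.incl₂) ((f ∘ₗ cmul S Q) ∘ₗ D.incl₂) = (f ∘ₗ cmul P Q) ∘ₗ D.incl₂ := by
  rw [← conv_comp_incl₂ _ _ (form_proj P S), ← comp_conv_lid, cmul_eq_conv_left]

/-- The invariance of f is required because here the factor with values in M stands on the left,
where restriction to R ⊗ R asks for compatibility with `proj`. In `conv_form_left` that place is
taken by a form, which always has it. -/
lemma conv_form_right {M : Type*} [AddCommMonoid M] [Module K M] (P S Q : D.Par)
    {f : D.Bos →ₗ[K] M} (hf : ∀ g x, f (D.mulG g x) = f x) :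
    conv D.nichols.comul₂ (TensorProduct.rid K M).toLinearMap
      ((f ∘ₗ cmul P S) ∘ₗ D.incl₂) (form S Q ∘ₗ D.incl₂) = (f ∘ₗ cmul P Q) ∘ₗ D.incl₂ := by
  rw [← conv_comp_incl₂ _ _ (comp_cmul_proj P S hf), ← comp_conv_rid, cmul_eq_conv_right]

lemma isConvInv_form_incl₂ (P Q : D.Par) : IsConvInv D.nichols.comul₂ D.nichols.counit₂
    (form P Q ∘ₗ D.incl₂) (form Q P ∘ₗ D.incl₂) := by
  have h : ∀ P Q : D.Par, convForm D.nichols.comul₂ (form P Q ∘ₗ D.incl₂) (form Q P ∘ₗ D.incl₂) =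
      D.nichols.counit₂ := fun P Q => by
    rw [convForm, ← conv_comp_incl₂ _ _ (form_proj P Q), ← counit₂_incl₂, ← form_self P,
      ← convForm_form P Q P, convForm]
  exact ⟨h P Q, h Q P⟩

lemma convTwist_form_incl₂ (P : D.Par) : convTwist D.nichols.comul₂
    (form P D.zeroPar ∘ₗ D.incl₂) (form D.zeroPar P ∘ₗ D.incl₂) D.nichols.mul =
      (D.toNic ∘ₗ cmul P P) ∘ₗ D.incl₂ := by
  rw [convTwist, ← toNic_cmul_incl₂, conv_form_right _ _ _ toNic_mulG, conv_form_left]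

/-! ### The twisted cocycle -/

lemma toGrp_cmul_zero (x y : D.Bos) :
    D.toGrp (cmul D.zeroPar D.zeroPar (x ⊗ₜ y)) = D.toGrp x * D.toGrp y := by
  refine LinearMap.congr_fun (f := D.toGrp ∘ₗ cmul D.zeroPar D.zeroPar)
    (g := LinearMap.mul' K _ ∘ₗ TensorProduct.map D.toGrp D.toGrp)
    (bos₂_ext fun i hi j hj h k hk l hl h' => ?_) (x ⊗ₜ y)
  rw [LinearMap.comp_apply, ← radford_mul, radford_mul_bas hi hj hk hl, map_smul]
  simp only [LinearMap.comp_apply, TensorProduct.map_tmul, LinearMap.mul'_apply, toGrp_bas hi hj,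
    toGrp_bas hk hl]
  by_cases h0 : i + k = 0 ∧ j + l = 0
  · obtain ⟨rfl, rfl, rfl, rfl⟩ : i = 0 ∧ k = 0 ∧ j = 0 ∧ l = 0 := by omega
    simp [toGrp_bas D.r₁_pos D.r₂_pos]
  · have h1 : (if i = 0 ∧ j = 0 then MonoidAlgebra.of K Γ h else 0) *
        (if k = 0 ∧ l = 0 then MonoidAlgebra.of K Γ h' else 0) = 0 := by
      by_cases hij : i = 0 ∧ j = 0
      · rw [if_neg (show ¬(k = 0 ∧ l = 0) by omega), mul_zero]
      · rw [if_neg hij, zero_mul]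
    rw [h1]
    by_cases h2 : i + k < D.r₁ ∧ j + l < D.r₂
    · rw [toGrp_bas h2.1 h2.2, if_neg h0, smul_zero]
    · rw [bas_eq_zero D h2, map_zero, smul_zero]

lemma map_toGrp_comul_bas {i j : ℕ} (hi : i < D.r₁) (hj : j < D.r₂) :
    TensorProduct.map D.toGrp LinearMap.id (D.nichols.radford.comul (D.bas i j 1)) =
      MonoidAlgebra.of K Γ (D.g₁ ^ i * D.g₂ ^ j) ⊗ₜ D.bas i j 1 := by
  rw [radford_comul_bas D hi hj]
  simp only [map_sum, map_smul, TensorProduct.map_tmul, LinearMap.id_apply]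
  rw [Finset.sum_eq_single 0, Finset.sum_eq_single 0]
  · rw [toGrp_bas D.r₁_pos D.r₂_pos]
    simp [qBinom_zero_right]
  · intro m hm hm0
    have := Finset.mem_range.1 hm
    rw [toGrp_bas D.r₁_pos (by omega), if_neg (by omega), TensorProduct.zero_tmul, smul_zero]
  · simp
  · intro n hn hn0
    have := Finset.mem_range.1 hn
    refine Finset.sum_eq_zero fun m hm => ?_
    have := Finset.mem_range.1 hm
    rw [toGrp_bas (by omega) (by omega), if_neg (by omega), TensorProduct.zero_tmul, smul_zero]
  · simp

/-- An element of R # H is recovered from its two projections; this will glue the R-part and the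
H-part of a product. -/
lemma map_toNic_toGrp_comul (x : D.Bos) :
    TensorProduct.map D.toNic D.toGrp (D.nichols.radford.comul x) = x := by
  refine LinearMap.congr_fun (f := TensorProduct.map D.toNic D.toGrp ∘ₗ D.nichols.radford.comul)
    (g := LinearMap.id) (bos_ext fun i hi j hj h => ?_) x
  rw [LinearMap.comp_apply, radford_comul_bas D hi hj]
  simp only [map_sum, map_smul, TensorProduct.map_tmul, LinearMap.id_apply, toNic_bas]
  rw [Finset.sum_eq_single i, Finset.sum_eq_single j]
  · rw [Nat.sub_self, Nat.sub_self, toGrp_bas D.r₁_pos D.r₂_pos]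
    simp [qBinom_self, bas]
  · intro m hm hm0
    have := Finset.mem_range.1 hm
    rw [toGrp_bas (by omega) (by omega), if_neg (by omega), TensorProduct.tmul_zero, smul_zero]
  · simp
  · intro n hn hn0
    have := Finset.mem_range.1 hn
    refine Finset.sum_eq_zero fun m hm => ?_
    have := Finset.mem_range.1 hm
    rw [toGrp_bas (by omega) (by omega), if_neg (by omega), TensorProduct.tmul_zero, smul_zero]
  · simp

lemma coact_form_mon (P : D.Par) (i j k l : ℕ) :
    ((TensorProduct.rid K (MonoidAlgebra K Γ)).toLinearMap ∘ₗ TensorProduct.map LinearMap.id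
      (form D.zeroPar P ∘ₗ D.incl₂) ∘ₗ D.nichols.coact₂) (D.mon i j ⊗ₜ D.mon k l) =
      form D.zeroPar P (D.bas i j 1 ⊗ₜ D.bas k l 1) •
        MonoidAlgebra.of K Γ (D.g₁ ^ (i + k) * D.g₂ ^ (j + l)) := by
  rw [LinearMap.comp_apply, LinearMap.comp_apply, coact₂_mon, TensorProduct.map_tmul,
    LinearEquiv.coe_coe, TensorProduct.rid_tmul]
  rfl

/-- By `cmul_eq_conv_right`, toGrp ∘ cmul(0, P) is (toGrp ∘ m_A) * form(0, P). As toGrp is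
multiplicative on A and (toGrp ⊗ id)Δ is the coaction on R, the first factor turns into the diagonal
coaction. -/
lemma coact_form (P : D.Par) :
    (TensorProduct.rid K (MonoidAlgebra K Γ)).toLinearMap ∘ₗ TensorProduct.map LinearMap.id
      (form D.zeroPar P ∘ₗ D.incl₂) ∘ₗ D.nichols.coact₂ =
      (D.toGrp ∘ₗ cmul D.zeroPar P) ∘ₗ D.incl₂ := by
  have key : ∀ X Y : D.Bos ⊗[K] D.Bos,
      TensorProduct.map (D.toGrp ∘ₗ cmul D.zeroPar D.zeroPar) LinearMap.id
        (TensorProduct.tensorTensorTensorComm K _ _ _ _ (X ⊗ₜ Y)) =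
      TensorProduct.map (LinearMap.mul' K _) LinearMap.id
        (TensorProduct.tensorTensorTensorComm K _ _ _ _
          (TensorProduct.map D.toGrp LinearMap.id X ⊗ₜ
            TensorProduct.map D.toGrp LinearMap.id Y)) := by
    intro X Y
    induction X with
    | zero => simp
    | add a b ha hb => simp only [map_add, TensorProduct.add_tmul, ha, hb]
    | tmul a b =>
      induction Y with
      | zero => simp
      | add c d hc hd => simp only [map_add, TensorProduct.tmul_add, hc, hd]
      | tmul c d => simp [toGrp_cmul_zero]
  refine nic₂_ext fun i hi j hj k hk l hl => ?_
  rw [coact_form_mon, LinearMap.comp_apply, incl₂_mon, ← cmul_eq_conv_right _ D.zeroPar,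
    comp_conv_rid]
  have h := key (D.nichols.radford.comul (D.bas i j 1)) (D.nichols.radford.comul (D.bas k l 1))
  rw [map_toGrp_comul_bas hi hj, map_toGrp_comul_bas hk hl,
    TensorProduct.tensorTensorTensorComm_tmul, TensorProduct.map_tmul, LinearMap.mul'_apply,
    ← map_mul, mul_mul_mul_comm, ← pow_add, ← pow_add, LinearMap.id_apply] at h
  have h' := congrArg ((TensorProduct.rid K (MonoidAlgebra K Γ)).toLinearMap ∘ₗ
    TensorProduct.map LinearMap.id (form D.zeroPar P)) h
  rw [LinearMap.comp_apply, LinearMap.comp_apply, TensorProduct.map_tmul,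
    ← LinearMap.comp_apply (TensorProduct.map _ _), ← TensorProduct.map_comp,
    LinearMap.id_comp, LinearMap.comp_id, LinearEquiv.coe_coe, TensorProduct.rid_tmul] at h'
  exact h'.symm

lemma trivialCocycle_conv (P : D.Par) : conv D.nichols.comul₂
    (LinearMap.mul' K (MonoidAlgebra K Γ)) D.nichols.trivialCocycle
      ((D.toGrp ∘ₗ cmul D.zeroPar P) ∘ₗ D.incl₂) = (D.toGrp ∘ₗ cmul D.zeroPar P) ∘ₗ D.incl₂ := by
  rw [BraidedData.trivialCocycle, conv_algebraMap, ← counit₂_incl₂, ← form_self D.zeroPar,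
    conv_form_left]

/-- So ε_{α_R} is the H-component of the product of the lifting, restricted to R ⊗ R. -/
lemma twistCocycle_form (P : D.Par) : D.nichols.twistCocycle D.nichols.trivialCocycle
    (form P D.zeroPar ∘ₗ D.incl₂) (form D.zeroPar P ∘ₗ D.incl₂) =
      (D.toGrp ∘ₗ cmul P P) ∘ₗ D.incl₂ := by
  rw [BraidedData.twistCocycle, coact_form, trivialCocycle_conv, conv_algebraMap, conv_form_left]

/-- On R ⊗ R, applying toNic ⊗ toGrp to Δ ∘ cmul(P, P) = (cmul(P, P) ⊗ cmul(P, P)) ∘ Δ₂ expresses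
the product through the twisted multiplication and the twisted cocycle. -/
lemma biproduct_twist_mul (P : D.Par) :
    ((D.nichols.twist (form P D.zeroPar ∘ₗ D.incl₂) (form D.zeroPar P ∘ₗ D.incl₂)).biproduct
      (D.nichols.twistCocycle D.nichols.trivialCocycle
        (form P D.zeroPar ∘ₗ D.incl₂) (form D.zeroPar P ∘ₗ D.incl₂))).mul = cmul P P := by
  refine bos₂_ext fun i hi j hj h k hk l hl h' => ?_
  rw [cmul_bas _ _ hi hj hk hl, BraidedData.twist, convTwist_form_incl₂, twistCocycle_form,
    biproduct_mul_bas]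
  congr 2
  have h1 := LinearMap.congr_fun (conv_comp_incl₂ LinearMap.id (D.toGrp ∘ₗ cmul P P)
    (comp_cmul_proj P P toNic_mulG)) (D.mon i j ⊗ₜ D.mon k l)
  refine h1.symm.trans ?_
  have h2 := map_toNic_toGrp_comul (cmul P P (D.bas i j 1 ⊗ₜ D.bas k l 1))
  rw [comul_cmul P P P, ← LinearMap.comp_apply (TensorProduct.map _ _),
    ← TensorProduct.map_comp] at h2
  exact h2

/-! ### The isomorphisms -/

section Iso

variable {a₁ a₂ a : K}

/-- The identification of the bases of `A` and of the lifting. -/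
def IsLiftingDatum.equiv (hB : D.IsLiftingDatum a₁ a₂ a) : D.Bos ≃ₗ[K] D.Lifting a₁ a₂ a :=
  LinearEquiv.ofBijective (Lifting.sol D a₁ a₂ a).mono
    (Lifting.mono_bijective D a₁ a₂ a hB.admissible)

lemma IsLiftingDatum.equiv_bas (hB : D.IsLiftingDatum a₁ a₂ a) {i j : ℕ} (hi : i < D.r₁)
    (hj : j < D.r₂) (h : Γ) : hB.equiv (D.bas i j h) =
      Lifting.gen D a₁ a₂ a .x₁ ^ i * Lifting.gen D a₁ a₂ a .x₂ ^ j *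
        Lifting.gen D a₁ a₂ a (.grp h) :=
  Rep.mono_bas _ hi hj h

lemma IsLiftingDatum.isIso (hB : D.IsLiftingDatum a₁ a₂ a) {S : BialgData K D.Bos}
    (hm : S.mul = cmul hB.par hB.par) (h1 : S.one = D.bas 0 0 1)
    (hc : S.comul = D.nichols.radford.comul) (hε : S.counit = D.nichols.radford.counit) :
    S.IsIso hB.equiv where
  map_mul x y := by
    have hl : ∀ x, (Lifting.sol D a₁ a₂ a).lift (toCog hB.par hB.par x) = hB.equiv x := fun x =>
      LinearMap.congr_fun (Lifting.sol D a₁ a₂ a).lift_mono x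
    rw [hm, ← hl, toCog_cmul, map_mul, hl, hl]
  map_one := by
    rw [h1, hB.equiv_bas D.r₁_pos D.r₂_pos, pow_zero, pow_zero, one_mul, one_mul, Lifting.gen_one]
  map_comul x := by
    rw [hc]
    exact (Lifting.comul_mono D a₁ a₂ a x).symm
  map_counit x := by
    rw [hε]
    exact Lifting.counit_mono D a₁ a₂ a x

end Iso

/-! ### The total integral -/

lemma totalIntegral_one : totalIntegral K Γ (MonoidAlgebra.of K Γ 1) = 1 := by
  simp [totalIntegral]

lemma totalIntegral_of_ne {g : Γ} (hg : g ≠ 1) :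
    totalIntegral K Γ (MonoidAlgebra.of K Γ g) = 0 := by
  simp [totalIntegral, hg]

/-- A product lies in the filtration step of its total bidegree, and of the monomials spanning that
step the counit sees only those with trivial R-part. -/
lemma drop_of_form_ne_zero {P Q : D.Par} {i j k l : ℕ} (hi : i < D.r₁) (hj : j < D.r₂)
    (hk : k < D.r₁) (hl : l < D.r₂) {h h' : Γ}
    (h0 : form P Q (D.bas i j h ⊗ₜ D.bas k l h') ≠ 0) : D.Drop P.1 Q.1 (k + i) (l + j) := by
  by_contra hd
  apply h0
  rw [form_tmul]
  have hle : (Cog.univ D P.1 Q.1).fil (k + i) (l + j) ≤ LinearMap.ker (cogCounit P Q) := by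
    refine Submodule.span_le.2 ?_
    rintro _ ⟨i', j', a', b', g, hi, hj, ha, hb, hdrop, rfl⟩
    rw [SetLike.mem_coe, LinearMap.mem_ker, cogCounit_mul_G, cogCounit_mon P Q hi hj, if_neg]
    rintro ⟨rfl, rfl⟩
    rw [zero_add] at ha hb
    exact hd (by rwa [ha, hb])
  exact hle (Rep.mono_mul_mono_mem_fil hi hj hk hl h h')

lemma form_link (P Q : D.Par) :
    form P Q (D.bas 0 1 1 ⊗ₜ D.bas 1 0 1) = P.1.c₁₂ - Q.1.c₁₂ := by
  have h := cogCounit_mon P Q D.two_le_r₁ D.two_le_r₂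
  rw [pow_one, pow_one, if_neg (by omega)] at h
  rw [form_mon P Q D.r₁_pos D.two_le_r₂ D.two_le_r₁ D.r₂_pos, pow_zero, pow_zero, pow_one, pow_one,
    one_mul, mul_one, Rep.link, map_add, map_smul, map_sub, map_smul, map_smul, h, cogCounit_one,
    ← mul_one (Rep.G _ _), cogCounit_G_mul, cogCounit_one]
  simp

lemma form_pow₁ (P Q : D.Par) :
    form P Q (D.bas 1 0 1 ⊗ₜ D.bas (D.r₁ - 1) 0 1) = P.1.c₁ - Q.1.c₁ := by
  have := D.two_le_r₁
  rw [form_mon P Q D.two_le_r₁ D.r₂_pos (by omega) D.r₂_pos, pow_zero, mul_one, mul_one, ← pow_add,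
    show 1 + (D.r₁ - 1) = D.r₁ by omega, Rep.pow₁, map_sub, map_smul, map_smul, cogCounit_one,
    ← mul_one (Rep.G _ _), cogCounit_G_mul, cogCounit_one]
  simp

lemma form_pow₂ (P Q : D.Par) :
    form P Q (D.bas 0 1 1 ⊗ₜ D.bas 0 (D.r₂ - 1) 1) = P.1.c₂ - Q.1.c₂ := by
  have := D.two_le_r₂
  rw [form_mon P Q D.r₁_pos D.two_le_r₂ D.r₁_pos (by omega), pow_zero, one_mul, one_mul, ← pow_add,
    show 1 + (D.r₂ - 1) = D.r₂ by omega, Rep.pow₂, map_sub, map_smul, map_smul, cogCounit_one,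
    ← mul_one (Rep.G _ _), cogCounit_G_mul, cogCounit_one]
  simp

/-- The cocycle determines its parameters, so a condition such as α = γ₁ forces a₂ = a = 0. -/
lemma form_zeroPar_injective {P P' : D.Par} (h : form P D.zeroPar = form P' D.zeroPar) :
    P.1.c₁ = P'.1.c₁ ∧ P.1.c₂ = P'.1.c₂ ∧ P.1.c₁₂ = P'.1.c₁₂ := by
  have h1 := form_pow₁ P D.zeroPar
  have h2 := form_pow₂ P D.zeroPar
  have h3 := form_link P D.zeroPar
  rw [h] at h1 h2 h3
  rw [form_pow₁] at h1
  rw [form_pow₂] at h2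
  rw [form_link] at h3
  exact ⟨(sub_left_inj.1 h1).symm, (sub_left_inj.1 h2).symm, (sub_left_inj.1 h3).symm⟩

/-- A group element `g^(sr + n) h^(tr + n)` that is trivial only for trivial reasons. -/
lemma eq_zero_of_pow_mul_pow_eq_one {G : Type*} [CommGroup G] {g h : G} {r s t n : ℕ} (hr : 2 ≤ r)
    (hs : s * r + n ≤ 2 * r - 2) (ht : t * r + n ≤ 2 * r - 2) (hd : r ∣ 2 * n)
    (hg : s ≠ 0 → g ^ r ≠ 1) (hh : t ≠ 0 → h ^ r ≠ 1) (hgh : g * h ≠ 1)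
    (hc : ((Odd r ∨ r = 2) ∧ (g * h) ^ r ≠ 1) ∨ ∃ r', r = 2 * r' ∧
      (∀ m ∈ ({1, 2, 3} : Set ℕ), (g * h) ^ (m * r') ≠ 1) ∧
      (g * h) ^ r' * h ^ r ≠ 1 ∧ g ^ r * (g * h) ^ r' ≠ 1)
    (he : g ^ (s * r + n) * h ^ (t * r + n) = 1) : s = 0 ∧ t = 0 ∧ n = 0 := by
  have hs1 : s < 2 := by
    by_contra h2
    have := Nat.mul_le_mul_right r (not_lt.1 h2)
    omega
  have ht1 : t < 2 := by
    by_contra h2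
    have := Nat.mul_le_mul_right r (not_lt.1 h2)
    omega
  have hghr : (g * h) ^ r ≠ 1 := by
    rcases hc with hc | ⟨r', hr', h1, -⟩
    · exact hc.2
    · rw [hr']; exact h1 2 (by simp)
  have hdiag : s = 0 → t = 0 → (g * h) ^ n = 1 := by
    rintro rfl rfl
    simpa [mul_pow] using he
  rcases Nat.eq_zero_or_pos n with rfl | hn
  · interval_cases s <;> interval_cases t <;> simp_all [mul_pow]
  · exfalso
    -- With n > 0 and r ∣ 2n the degree bound leaves few cases. For r odd, n = r and s = t = 0; for
    -- r = 2, n is 1 or 2 and s = t = 0; for r = 2r', n is a multiple mr' with m ≤ 3, and m = 1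
    -- unless s = t = 0.
    rcases hc with ⟨hodd | rfl, -⟩ | ⟨r', rfl, h1, h2, h3⟩
    · obtain ⟨m, rfl⟩ := (Nat.Coprime.dvd_mul_left
        (Nat.coprime_comm.1 (Nat.coprime_two_left.2 hodd))).1 hd
      have hm : m < 2 := by
        by_contra h2
        have := Nat.mul_le_mul_left r (not_lt.1 h2)
        omega
      have hm1 : m = 1 := by
        have : m ≠ 0 := by rintro rfl; simp at hn
        omega
      subst hm1
      rw [mul_one] at hs ht hdiag
      interval_cases s <;> interval_cases t <;> first | omega | exact hghr (hdiag rfl rfl)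
    · obtain ⟨rfl, rfl⟩ : s = 0 ∧ t = 0 := by omega
      obtain rfl | rfl : n = 1 ∨ n = 2 := by omega
      · exact hgh (by simpa using hdiag rfl rfl)
      · exact hghr (hdiag rfl rfl)
    · obtain ⟨m, hm⟩ := hd
      have hn' : n = m * r' := by linarith [mul_assoc 2 r' m, mul_comm r' m]
      subst hn'
      have hm4 : m < 4 := by
        by_contra h4
        have := Nat.mul_le_mul_right r' (not_lt.1 h4)
        omega
      have hm0 : m ≠ 0 := by rintro rfl; simp at hn
      by_cases hst : s = 0 ∧ t = 0
      · refine h1 m ?_ (hdiag hst.1 hst.2)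
        simp only [Set.mem_insert_iff, Set.mem_singleton_iff]
        omega
      · have hm1 : m = 1 := by
          by_contra hm1
          have := Nat.mul_le_mul_right r' (show 2 ≤ m by omega)
          interval_cases s <;> interval_cases t <;> omega
        subst hm1
        rw [one_mul] at he
        interval_cases s <;> interval_cases t
        · exact hst ⟨rfl, rfl⟩
        · refine h2 (Eq.trans ?_ he)
          rw [mul_pow, zero_mul, zero_add, one_mul, pow_add h, mul_assoc, mul_comm (h ^ r')]
        · refine h3 (Eq.trans ?_ he)
          rw [mul_pow, zero_mul, zero_add, one_mul, pow_add g, mul_assoc]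
        -- For s = t = 1 both exponents are r + r' = 3r', so the condition with t = 3 is used here
        -- as well.
        · refine h1 3 (by simp) (Eq.trans ?_ he)
          rw [mul_pow, one_mul, show 3 * r' = 2 * r' + r' by ring]

/-! ### The four conditions and the integral. -/

section Cond

variable {a₁ a₂ a : K}

lemma Cond.of_eq_zero (hB : D.IsLiftingDatum a₁ a₂ a) (hC : D.Cond a₁ a₂ a) (ha : a = 0) :
    a₁ = 0 ∨ a₂ = 0 ∨ D.g₁ ^ D.r₁ * D.g₂ ^ D.r₂ ≠ 1 := by
  rcases hC with (h | h) | h | h | h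
  · let P : D.Par := ⟨⟨a₁, 0, 0⟩, hB.admissible.cond₁, by simp, by simp⟩
    rw [hB.alpha_eq, show D.gamma₁ a₁ = form P D.zeroPar from
      gamma₁_eq_form (P := P) (Q := D.zeroPar) rfl rfl rfl rfl] at h
    exact .inr (.inl (form_zeroPar_injective h).2.1)
  · rw [hB.alpha_eq, show D.gamma₂ a₂ = form hB.par₂ D.zeroPar from
      gamma₂_eq_form (P := hB.par₂) (Q := D.zeroPar) rfl rfl rfl rfl] at h
    exact .inl (form_zeroPar_injective h).1
  · exact .inr (.inr h.2)
  · exact absurd ha h.1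
  · exact absurd ha h.1

lemma Cond.of_ne_zero (hB : D.IsLiftingDatum a₁ a₂ a) (hC : D.Cond a₁ a₂ a) (ha : a ≠ 0) :
    ((Odd D.r₁ ∨ D.r₁ = 2) ∧ (D.g₁ * D.g₂) ^ D.r₁ ≠ 1) ∨ ∃ r', D.r₁ = 2 * r' ∧
      (∀ m ∈ ({1, 2, 3} : Set ℕ), (D.g₁ * D.g₂) ^ (m * r') ≠ 1) ∧
      (D.g₁ * D.g₂) ^ r' * D.g₂ ^ D.r₁ ≠ 1 ∧ D.g₁ ^ D.r₁ * (D.g₁ * D.g₂) ^ r' ≠ 1 := by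
  rcases hC with (h | h) | h | h | ⟨-, r', h, -, h'⟩
  · let P : D.Par := ⟨⟨a₁, 0, 0⟩, hB.admissible.cond₁, by simp, by simp⟩
    rw [hB.alpha_eq, show D.gamma₁ a₁ = form P D.zeroPar from
      gamma₁_eq_form (P := P) (Q := D.zeroPar) rfl rfl rfl rfl] at h
    exact absurd (form_zeroPar_injective h).2.2 ha
  · rw [hB.alpha_eq, show D.gamma₂ a₂ = form hB.par₂ D.zeroPar from
      gamma₂_eq_form (P := hB.par₂) (Q := D.zeroPar) rfl rfl rfl rfl] at h
    exact absurd (form_zeroPar_injective h).2.2 ha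
  · rw [hB.alpha_eq, hB.convA_gamma] at h
    exact absurd (form_zeroPar_injective h.1).2.2 ha
  · exact .inl h.2
  · exact .inr ⟨r', h, h'⟩

/-- For a = 0 there is no n, and the powers left are g₁^r₁, g₂^r₂ and their product. For a ≠ 0 the
problem becomes the elementary statement `eq_zero_of_pow_mul_pow_eq_one`. -/
lemma Cond.eq_zero_of_drop (hB : D.IsLiftingDatum a₁ a₂ a) (hC : D.Cond a₁ a₂ a) {b c : ℕ}
    (hb : b ≤ 2 * D.r₁ - 2) (hc : c ≤ 2 * D.r₂ - 2) (hd : D.Drop D.zeroPar.1 hB.par.1 b c)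
    (he : D.g₁ ^ b * D.g₂ ^ c = 1) : b = 0 ∧ c = 0 := by
  obtain ⟨s, t, n, rfl, rfl, h1, h2, h3⟩ := hd
  have hs : s ≠ 0 → a₁ ≠ 0 := fun h => (h1 h).resolve_left fun h => h rfl
  have ht : t ≠ 0 → a₂ ≠ 0 := fun h => (h2 h).resolve_left fun h => h rfl
  have hn : n ≠ 0 → a ≠ 0 := fun h => (h3 h).resolve_left fun h => h rfl
  suffices h : s = 0 ∧ t = 0 ∧ n = 0 by simp [h]
  by_cases ha : a = 0
  · obtain rfl : n = 0 := by_contra fun h => hn h ha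
    have hr₁ := D.two_le_r₁
    have hr₂ := D.two_le_r₂
    have hs1 : s < 2 := by
      by_contra h2
      have := Nat.mul_le_mul_right D.r₁ (not_lt.1 h2)
      omega
    have ht1 : t < 2 := by
      by_contra h2
      have := Nat.mul_le_mul_right D.r₂ (not_lt.1 h2)
      omega
    interval_cases s <;> interval_cases t <;>
      simp only [zero_mul, one_mul, add_zero, pow_zero, mul_one] at he
    · exact ⟨rfl, rfl, rfl⟩
    · exact absurd he (hB.cond₂ (ht one_ne_zero)).1
    · exact absurd he (hB.cond₁ (hs one_ne_zero)).1
    · rcases Cond.of_eq_zero hB hC ha with h | h | h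
      · exact absurd h (hs one_ne_zero)
      · exact absurd h (ht one_ne_zero)
      · exact absurd he h
  · obtain ⟨hχ, hr⟩ := χ_link (hB.cond₁₂ ha).2
    rw [← hr] at hc he
    refine eq_zero_of_pow_mul_pow_eq_one D.two_le_r₁ hb hc ?_ (fun h => (hB.cond₁ (hs h)).1)
      (fun h => ?_) (hB.cond₁₂ ha).1 (Cond.of_ne_zero hB hC ha) he
    -- Since χ₁(g₂) = χ₁(g₁) is a primitive r-th root of unity, evaluating χ₁ on the trivial group
    -- element shows that r divides (s + t)r + 2n, hence 2n.
    · have h := congrArg D.χ₁ he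
      rw [map_mul, map_pow, map_pow, hχ, ← pow_add, map_one] at h
      have h' := D.prim₁.dvd_of_pow_eq_one _ h
      rw [show s * D.r₁ + n + (t * D.r₁ + n) = (s + t) * D.r₁ + 2 * n by ring] at h'
      exact (Nat.dvd_add_right (Dvd.intro_left _ rfl)).1 h'
    · rw [hr]
      exact (hB.cond₂ (ht h)).1

/-- This says (λ ⊗ α_R⁻¹)ρ = ε on R ⊗ R: in positive degree either the form or the integral
vanishes. The bounds 2rᵢ - 2 come from exponents below rᵢ in each factor. -/
lemma Cond.totalIntegral_coact_form (hB : D.IsLiftingDatum a₁ a₂ a) (hC : D.Cond a₁ a₂ a) :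
    totalIntegral K Γ ∘ₗ (D.toGrp ∘ₗ cmul D.zeroPar hB.par) ∘ₗ D.incl₂ = D.nichols.counit₂ := by
  rw [← coact_form]
  refine nic₂_ext fun i hi j hj k hk l hl => ?_
  rw [LinearMap.comp_apply, coact_form_mon, map_smul, smul_eq_mul]
  have hε : D.nichols.counit₂ (D.mon i j ⊗ₜ D.mon k l) =
      (if i = 0 ∧ j = 0 then 1 else 0) * (if k = 0 ∧ l = 0 then 1 else 0) := by
    rw [BraidedData.counit₂, LinearMap.comp_apply, TensorProduct.map_tmul, LinearMap.mul'_apply,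
      counit_mon D hi hj, counit_mon D hk hl]
  by_cases h0 : i + k = 0 ∧ j + l = 0
  · obtain ⟨rfl, rfl, rfl, rfl⟩ : i = 0 ∧ k = 0 ∧ j = 0 ∧ l = 0 := by omega
    rw [form_mon _ _ hi hj hk hl, hε]
    simp only [pow_zero, mul_one, add_zero, totalIntegral_one, and_self, if_true]
    exact cogCounit_one _ _
  · have hε0 : D.nichols.counit₂ (D.mon i j ⊗ₜ D.mon k l) = 0 := by
      rw [hε]
      by_cases hij : i = 0 ∧ j = 0
      · rw [if_neg (show ¬(k = 0 ∧ l = 0) by omega), mul_zero]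
      · rw [if_neg hij, zero_mul]
    rw [hε0, mul_eq_zero]
    refine or_iff_not_imp_left.2 fun hne => totalIntegral_of_ne fun hg => h0 ?_
    have hd := drop_of_form_ne_zero hi hj hk hl hne
    rw [add_comm k, add_comm l] at hd
    exact Cond.eq_zero_of_drop hB hC (by omega) (by omega) hd hg

lemma Cond.totalIntegral_twistCocycle (hB : D.IsLiftingDatum a₁ a₂ a) (hC : D.Cond a₁ a₂ a) :
    totalIntegral K Γ ∘ₗ D.nichols.twistCocycle D.nichols.trivialCocycle
      (form hB.par D.zeroPar ∘ₗ D.incl₂) (form D.zeroPar hB.par ∘ₗ D.incl₂) =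
        form hB.par D.zeroPar ∘ₗ D.incl₂ := by
  rw [BraidedData.twistCocycle, coact_form, trivialCocycle_conv, conv_algebraMap, comp_conv_lid,
    Cond.totalIntegral_coact_form hB hC]
  refine LinearMap.ext fun z => ?_
  have h := congrArg (form hB.par D.zeroPar ∘ₗ D.incl₂) (D.counit₂_comul₂_right z)
  rw [← h, conv, LinearMap.comp_apply, LinearMap.comp_apply]
  induction D.nichols.comul₂ z with
  | zero => simp
  | add a b ha hb => simp only [map_add, ha, hb]
  | tmul a b => simp [mul_comm]

end Cond

end QuantumPlane

end

theorem mainTheorem2 {K Γ : Type*} [Field K] [CharZero K] [CommGroup Γ] [Finite Γ]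
    (D : QuantumPlane K Γ) (a₁ a₂ a : K) (hB : D.IsLiftingDatum a₁ a₂ a) :
    -- `R` is the Nichols algebra of the quantum plane
    D.IsNicholsAlgebra D.nichols (D.mon 1 0) (D.mon 0 1) D.nicholsGrading ∧
    -- the convolution inverses `α'` of `α` and `v'` of `α_R`
    ∃ (α' : D.Bos ⊗[K] D.Bos →ₗ[K] K) (v' : D.Nic ⊗[K] D.Nic →ₗ[K] K)
      (φ : D.Bos ≃ₗ[K] D.Lifting a₁ a₂ a),
      -- `α` is an `H`-bilinear cocycle on `A = R # H`
      D.nichols.radford.IsBilinearCocycle D.nichols.inclH (D.alpha a₁ a₂ a) α' ∧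
      QPlane.IsConvInv D.nichols.comul₂ D.nichols.counit₂
        (D.nichols.restrict (D.alpha a₁ a₂ a)) v' ∧
      -- `φ` is the identity on the common basis
      (∀ i < D.r₁, ∀ j < D.r₂, ∀ h : Γ,
        φ (D.mon i j ⊗ₜ MonoidAlgebra.of K Γ h) =
          QuantumPlane.Lifting.gen D a₁ a₂ a .x₁ ^ i * QuantumPlane.Lifting.gen D a₁ a₂ a .x₂ ^ j *
            QuantumPlane.Lifting.gen D a₁ a₂ a (.grp h)) ∧
      -- `A^α = B`
      (D.nichols.radford.twist (D.alpha a₁ a₂ a) α').IsIso φ ∧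
      -- `B = R^{α_R} #_{ε_{α_R}} H`
      ((D.nichols.twist (D.nichols.restrict (D.alpha a₁ a₂ a)) v').biproduct
        (D.nichols.twistCocycle D.nichols.trivialCocycle
          (D.nichols.restrict (D.alpha a₁ a₂ a)) v')).IsIso φ ∧
      -- `λ ∘ ε_{α_R} = α_R` under each of the four conditions
      (D.Cond a₁ a₂ a →
        QPlane.totalIntegral K Γ ∘ₗ
            D.nichols.twistCocycle D.nichols.trivialCocycle
              (D.nichols.restrict (D.alpha a₁ a₂ a)) v' =
          D.nichols.restrict (D.alpha a₁ a₂ a)) := by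
  have hα := hB.alpha_eq
  have hv : D.nichols.restrict (D.alpha a₁ a₂ a) =
      QuantumPlane.form hB.par D.zeroPar ∘ₗ D.incl₂ := by rw [D.restrict_eq, hα]
  rw [hv, hα]
  -- Both inverses come from form(0, P), on A ⊗ A and restricted to R ⊗ R, and a single φ serves (a)
  -- and (b) because both multiplications equal `cmul P P`.
  refine ⟨QuantumPlane.isNicholsAlgebra_nichols, QuantumPlane.form D.zeroPar hB.par,
    QuantumPlane.form D.zeroPar hB.par ∘ₗ D.incl₂, hB.equiv,
    QuantumPlane.isBilinearCocycle_form hB.par, QuantumPlane.isConvInv_form_incl₂ _ _,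
    fun i hi j hj h => hB.equiv_bas hi hj h, hB.isIso ?_ rfl rfl rfl,
    hB.isIso (QuantumPlane.biproduct_twist_mul hB.par) rfl rfl rfl,
    QuantumPlane.Cond.totalIntegral_twistCocycle hB⟩
  rw [QPlane.BialgData.twist, QuantumPlane.radford_mul]
  exact QuantumPlane.convTwist_form _ _
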